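/- **Holomorphic Frobenius theorem with parameter.** *Function classes.* For $\Omega\subseteq\mathbb R^N$ open and convex, $\mathscr C^\alpha(\Omega)$ ($\alpha>0$) is the bounded Hölder–Zygmund space: for $0<\alpha<1$, the continuous $f$ with $\sup|f|+\sup_{x\ne y}|x-y|^{-\alpha}|f(x)-f(y)|<\infty$; for $\alpha=1$, the continuous $f$ with $\sup|f|+\sup_{x\neq y}|x-y|^{-1}\big|\tfrac{f(x)+f(y)}2-f(\tfrac{x+y}2)\big|<\infty$; for $\alpha>1$, the $f\in\mathscr C^{\alpha-1}(\Omega)$ with $\partial_jf\in\mathscr C^{\alpha-1}(\Omega)$ for all $j$. For $\Omega$ open, $\mathscr C^\alpha_{\mathrm{loc}}(\Omega)$ consists of the $f$ that are in $\mathscr C^\alpha(\Omega')$ for every convex open $\Omega'\Subset\Omega$. A continuous function $f(x,s)$ on $U\times V$ is in $\mathscr C^{\infty,\beta}_{x,s,\mathrm{loc}}(U,V)$ if for all convex open $U'\Subset U$, $V'\Subset V$ and all $\gamma>0$, $\sup_{x\in U'}\|f(x,\cdot)\|_{\mathscr C^\beta(V')}+\sup_{s\in V'}\|f(\cdot,s)\|_{\mathscr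 C^\gamma(U')}<\infty$. A dyadic resolution of $\mathbb R^N$ is a sequence of real Schwartz functions $(\phi_j)_{j\ge0}$ with $\operatorname{supp}\hat\phi_0\subset\{|\xi|<2\}$, $\hat\phi_0=1$ on $\{|\xi|<1\}$ and $\phi_j(x)=2^{Nj}\phi_0(2^jx)-2^{N(j-1)}\phi_0(2^{j-1}x)$ for $j\ge1$. For $\gamma,\beta>0$, $f\in\mathscr C^\gamma\mathscr C^\beta(U,V)$ means that $f$ is the restriction to $U\times V$ of a bounded continuous $\tilde f$ on $\mathbb R^N_x\times\mathbb R^q_s$ with $\sup_{j,k}2^{j\gamma+k\beta}\|\phi_j*_x(\psi_k*_s\tilde f)\|_{L^\infty}<\infty$, where $(\phi_j)$, $(\psi_k)$ are dyadic resolutions of $\mathbb R^N$, $\mathbb R^q$ (the class does not depend on their choice); $\mathscr C^\infty\mathscr C^\beta(U,V)=\bigcap_{\gamma>0}\mathscr C^\gamma\mathscr C^\beta(U,V)$. Vector-valued functions are treated similarly, and $\mathbb C^n$ is regarded as $\mathbb R^{2n}$. *Statement.* Let $1\le m\le n$, $q\ge0$ and $0<\beta<\infty$. Let $\tilde U_0\subseteq\mathbb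 C^n_\zeta$ and $V_0\subseteq\mathbb R^q_s$ be open, and let $Z_j=\sum_{k=1}^n b_j^k(\zeta,s)\frac{\partial}{\partial\zeta^k}$, $j=1,\dots,m$, be complex vector fields on $\tilde U_0\times V_0$ such that - $Z_1,\dots,Z_m$ are linearly independent over $\mathbb C$ at every point, and pairwise commuting: $[Z_i(\cdot,s),Z_j(\cdot,s)]=0$ on $\tilde U_0$ for all $i,j$ and all $s\in V_0$; - $b_j^k\in\mathscr C^\beta_{\mathrm{loc}}(\tilde U_0\times V_0;\mathbb C)$, and $b_j^k(\cdot,s)$ is holomorphic for each $s\in V_0$. Then for every $(\zeta_0,s_0)\in\tilde U_0\times V_0$ there are an open neighbourhood $\tilde U\times V\subseteq\tilde U_0\times V_0$ of $(\zeta_0,s_0)$ and a map $\tilde G'':\tilde U\times V\to\mathbb C^{n-m}$ of class $\mathscr C^\beta_{\mathrm{loc}}$ such that 1. $\tilde G''(\zeta_0,s_0)=0$; 2. $\tilde G''\in\mathscr C^\infty\mathscr C^\beta(\tilde U,V;\mathbb C^{n-m})$ and $\tilde G''$ is holomorphic in $\zeta$; moreover $\tilde G''$ and all $\partial\tilde G''/\partial\zeta^k$,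 $\partial\tilde G''/\partial\bar\zeta^k$ are in $\mathscr C^{\infty,\beta}_{\zeta,s,\mathrm{loc}}(\tilde U,V)$; 3. for each $s\in V$, the annihilator $\operatorname{Span}_{\mathbb C}(Z_1(\cdot,s),\dots,Z_m(\cdot,s))^\perp|_{\tilde U}\le\mathbb CT^*\tilde U$ has the basis $\big(d\tilde G''^1(\cdot,s),\dots,d\tilde G''^{n-m}(\cdot,s),d\bar\zeta^1,\dots,d\bar\zeta^n\big)$ over $\tilde U$ (at every point of $\tilde U$ these forms are linearly independent and span the annihilator), and the coefficients of these forms with respect to $d\zeta^k$, $d\bar\zeta^k$ are holomorphic; 4. let $U:=\tilde U\cap\mathbb R^n$ with the real coordinates $\xi=\operatorname{Re}\zeta$, and let $X_j:=\sum_{k=1}^n b_j^k(\xi+i0,s)\frac{\partial}{\partial\xi^k}$; then for each $s\in V$, the annihilator $\operatorname{Span}_{\mathbb C}(X_1(\cdot,s),\dots,X_m(\cdot,s))^\perp\le\mathbb CT^*U$ has the basis $\big(d(\tilde G''^1(\cdot,s)|_U),\dots,d(\tilde G''^{n-m}(\cdot,s)|_U)\big)$ over $U$, and these forms are real-analytic.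 -/

import Mathlib

open scoped ContDiff ENNReal TensorProduct SchwartzMap FourierTransform ComplexConjugate

noncomputable section

namespace HolFrob

/-! ## Hölder-Zygmund classes

Spaces on `ℂⁿ` are regarded as spaces on `ℝ²ⁿ`; norms of function spaces are `ℝ≥0∞`-valued, and a
function belongs to the space when its norm is finite. -/

section HolderZygmund

variable {E S F : Type*} [NormedAddCommGroup E] [NormedSpace ℝ E]
  [NormedAddCommGroup S] [NormedSpace ℝ S] [NormedAddCommGroup F] [NormedSpace ℝ F]

/-- The norm of `𝒞ʳ(Ω; F)` for `0 < r ≤ 1`: the supremum norm plus the Hölder quotient if `r < 1`,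
the supremum norm plus the Zygmund (midpoint) quotient if `r = 1`. -/
def baseNorm (r : ℝ) (Ω : Set E) (g : E → F) : ℝ≥0∞ :=
  (⨆ x ∈ Ω, ‖g x‖ₑ) +
    if r < 1 then
      ⨆ x ∈ Ω, ⨆ y ∈ Ω, ⨆ (_ : x ≠ y), ‖g x - g y‖ₑ / edist x y ^ r
    else
      ⨆ x ∈ Ω, ⨆ y ∈ Ω, ⨆ (_ : x ≠ y),
        ‖(2⁻¹ : ℝ) • (g x + g y) - g ((2⁻¹ : ℝ) • (x + y))‖ₑ / edist x y

open Classical in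
/-- The norm of the Hölder-Zygmund space `𝒞^α(Ω; F)`, `α > 0`, for `Ω` open and convex. Write
`α = k + r` with `k ∈ ℕ` and `0 < r ≤ 1`; the recursion `‖f‖_α = ‖f‖_{α-1} + ‖Df‖_{α-1}` is
unrolled, so that `f` is in `𝒞^α` when `f` is `C^k` and its derivatives of order `≤ k` are
in `𝒞^r`. -/
def hzNorm (α : ℝ) (Ω : Set E) (f : E → F) : ℝ≥0∞ :=
  if ContDiffOn ℝ ((⌈α⌉₊ - 1 : ℕ) : ℕ∞) f Ω then
    ∑ i ∈ Finset.range (⌈α⌉₊ - 1 + 1),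
      baseNorm (α - (⌈α⌉₊ - 1 : ℕ)) Ω (iteratedFDerivWithin ℝ i f Ω)
  else ⊤

/-- `A ⋐ B`: `A` is a relatively compact subset of `B`. -/
def RelCompactIn (A B : Set E) : Prop := IsCompact (closure A) ∧ closure A ⊆ B

/-- `f ∈ 𝒞^α_loc(Ω; F)`: `f ∈ 𝒞^α(Ω'; F)` for all convex open `Ω' ⋐ Ω`. -/
def HZLoc (α : ℝ) (Ω : Set E) (f : E → F) : Prop :=
  ∀ Ω' : Set E, IsOpen Ω' → Convex ℝ Ω' → RelCompactIn Ω' Ω → hzNorm α Ω' f < ⊤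

/-- The norm of the mixed space `𝒞^{α,β}_{x,s}(U, V; F)`. -/
def mixedNorm (α β : ℝ) (U : Set E) (V : Set S) (f : E × S → F) : ℝ≥0∞ :=
  (⨆ x ∈ U, hzNorm β V fun s => f (x, s)) + ⨆ s ∈ V, hzNorm α U fun x => f (x, s)

/-- `f ∈ 𝒞^{∞,β}_{x,s,loc}(U, V; F)`: `f` is continuous, and in `𝒞^{γ,β}(U', V'; F)` for all
`γ > 0` and all convex open `U' ⋐ U`, `V' ⋐ V`. -/
def MixedInftyLoc (β : ℝ) (U : Set E) (V : Set S) (f : E × S → F) : Prop :=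
  ContinuousOn f (U ×ˢ V) ∧
    ∀ U' : Set E, IsOpen U' → Convex ℝ U' → RelCompactIn U' U →
    ∀ V' : Set S, IsOpen V' → Convex ℝ V' → RelCompactIn V' V →
    ∀ γ : ℝ, 0 < γ → mixedNorm γ β U' V' f < ⊤

end HolderZygmund

/-! ## The bi-parameter classes `𝒞^α_x 𝒞^β_s` -/

section BiParameter

variable {E S F : Type*}
  [NormedAddCommGroup E] [InnerProductSpace ℝ E] [FiniteDimensional ℝ E]
  [MeasurableSpace E] [BorelSpace E]
  [NormedAddCommGroup S] [InnerProductSpace ℝ S] [FiniteDimensional ℝ S]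
  [MeasurableSpace S] [BorelSpace S]
  [NormedAddCommGroup F] [NormedSpace ℝ F]

/-- `φ = (φ_j)_{j ≥ 0}` is a (Fourier) dyadic resolution of unity of the Euclidean space `E`. -/
structure IsDyadicResolution (φ : ℕ → 𝓢(E, ℝ)) : Prop where
  tsupport_subset : tsupport (𝓕 fun x => (φ 0 x : ℂ)) ⊆ Metric.ball 0 2
  eq_one : ∀ ξ ∈ Metric.ball (0 : E) 1, 𝓕 (fun x => (φ 0 x : ℂ)) ξ = 1
  dilate : ∀ (j : ℕ) (x : E), φ (j + 1) x =
    2 ^ (Module.finrank ℝ E * (j + 1)) * φ 0 ((2 : ℝ) ^ (j + 1) • x) -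
      2 ^ (Module.finrank ℝ E * j) * φ 0 ((2 : ℝ) ^ j • x)

/-- Dyadic resolutions exist. -/
theorem exists_isDyadicResolution (E : Type*)
    [NormedAddCommGroup E] [InnerProductSpace ℝ E] [FiniteDimensional ℝ E]
    [MeasurableSpace E] [BorelSpace E] : ∃ φ : ℕ → 𝓢(E, ℝ), IsDyadicResolution φ := by
  let χ : ContDiffBump (0 : E) := ⟨1, 3 / 2, by norm_num, by norm_num⟩
  have hcs : HasCompactSupport (fun x => (χ x : ℂ)) :=
    χ.hasCompactSupport.comp_left (g := fun r : ℝ => (r : ℂ)) (by simp)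
  have hsm : ContDiff ℝ ∞ (fun x => (χ x : ℂ)) :=
    Complex.ofRealCLM.contDiff.comp χ.contDiff
  let X : 𝓢(E, ℂ) := hcs.toSchwartzMap hsm
  have hX : ∀ x, X x = (χ x : ℂ) := fun x => rfl
  let Φ : 𝓢(E, ℝ) := SchwartzMap.postcompCLM (𝕜 := ℝ) Complex.reCLM (𝓕⁻ X)
  have hreal : ∀ x, ((Φ x : ℝ) : ℂ) = (𝓕⁻ X) x := by
    intro x
    have h1 : (Φ x : ℝ) = ((𝓕⁻ X) x).re := rfl
    rw [h1, ← Complex.conj_eq_iff_re, SchwartzMap.fourierInv_coe, Real.fourierInv_eq',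
      ← integral_conj, ← MeasureTheory.integral_neg_eq_self]
    congr 1
    ext v
    simp only [hX, smul_eq_mul, map_mul, Complex.conj_ofReal, χ.neg, ← Complex.exp_conj]
    simp
  have hF : 𝓕 (fun x => (Φ x : ℂ)) = fun ξ => (χ ξ : ℂ) := by
    have : (fun x => (Φ x : ℂ)) = (𝓕⁻ X : 𝓢(E, ℂ)) := funext hreal
    rw [this, ← SchwartzMap.fourier_coe, FourierTransform.fourier_fourierInv_eq]
    rfl
  let dil : ℕ → E ≃L[ℝ] E := fun j =>
    ContinuousLinearEquiv.smulLeft (Units.mk0 ((2 : ℝ) ^ j) (by positivity))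
  let A : ℕ → 𝓢(E, ℝ) := fun j => (2 : ℝ) ^ (Module.finrank ℝ E * j) •
    SchwartzMap.compCLMOfContinuousLinearEquiv ℝ (dil j) Φ
  refine ⟨fun j => Nat.casesOn j Φ fun i => A (i + 1) - A i, ?_, ?_, ?_⟩
  · show tsupport (𝓕 (fun x => (Φ x : ℂ))) ⊆ _
    rw [hF]
    refine (tsupport_comp_subset (g := fun r : ℝ => (r : ℂ)) (by simp) _).trans ?_
    rw [χ.tsupport_eq]
    exact Metric.closedBall_subset_ball (show (3 / 2 : ℝ) < 2 by norm_num)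
  · intro ξ hξ
    show 𝓕 (fun x => (Φ x : ℂ)) ξ = 1
    rw [hF]
    simp [χ.one_of_mem_closedBall (Metric.ball_subset_closedBall hξ)]
  · intro j x
    rfl

/-- The partial convolution `ρ ∗_x f`. -/
def convFst (ρ : E → ℝ) (f : E × S → F) (p : E × S) : F :=
  ∫ y, ρ (p.1 - y) • f (y, p.2)

/-- The partial convolution `ρ ∗_s f`. -/
def convSnd (ρ : S → ℝ) (f : E × S → F) (p : E × S) : F :=
  ∫ t, ρ (p.2 - t) • f (p.1, t)

/-- The norm of `𝒞^α_x 𝒞^β_s(E, S; F)` with respect to the dyadic resolutions `φ`, `ψ`: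
`sup_{j,k} 2^{jα+kβ} ‖φ_j ∗_x (ψ_k ∗_s f)‖_∞`. -/
def biNorm (φ : ℕ → 𝓢(E, ℝ)) (ψ : ℕ → 𝓢(S, ℝ)) (α β : ℝ) (f : E × S → F) : ℝ≥0∞ :=
  ⨆ (j : ℕ) (k : ℕ) (p : E × S),
    ENNReal.ofReal ((2 : ℝ) ^ (j * α + k * β)) * ‖convFst (φ j) (convSnd (ψ k) f) p‖ₑ

/-- `f ∈ 𝒞^α_x 𝒞^β_s(U, V; F)` for `α, β > 0`: `f` is the restriction of an element of
`𝒞^α_x 𝒞^β_s(E, S; F)`. As `α, β > 0`, the tempered distributions in the latter space are exactly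
the bounded continuous functions with finite norm. Different dyadic resolutions give
equivalent norms, so it does not matter which ones are used; the condition is asked for all. -/
def BiHZ (α β : ℝ) (U : Set E) (V : Set S) (f : E × S → F) : Prop :=
  ∀ (φ : ℕ → 𝓢(E, ℝ)) (ψ : ℕ → 𝓢(S, ℝ)), IsDyadicResolution φ → IsDyadicResolution ψ →
    ∃ g : E × S → F, Continuous g ∧ (∃ C : ℝ, ∀ p, ‖g p‖ ≤ C) ∧
      biNorm φ ψ α β g < ⊤ ∧ Set.EqOn g f (U ×ˢ V)

/-- `f ∈ 𝒞^∞_x 𝒞^β_s(U, V; F) = ⋂_{γ > 0} 𝒞^γ_x 𝒞^β_s(U, V; F)`. -/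
def BiHZInfty (β : ℝ) (U : Set E) (V : Set S) (f : E × S → F) : Prop :=
  ∀ γ : ℝ, 0 < γ → BiHZ γ β U V f

end BiParameter

/-! ## Complexified tangent and cotangent vectors -/

section Complexified

variable {E F : Type*} [NormedAddCommGroup E] [NormedSpace ℝ E]
  [NormedAddCommGroup F] [NormedSpace ℂ F]

/-- The `ℂ`-linear pairing of an `F`-valued covector `θ` at a point of the real vector space `E`
with a complexified tangent vector in `ℂ T_x E = ℂ ⊗ E`. -/
def pairing (θ : E →L[ℝ] F) : ℂ ⊗[ℝ] E →ₗ[ℂ] F :=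
  LinearMap.liftBaseChange ℂ (θ : E →ₗ[ℝ] F)

/-- The annihilator `W^⊥` in `ℂ T_x^* E` of a complex subspace `W` of `ℂ T_x E`. -/
def annihilator (W : Submodule ℂ (ℂ ⊗[ℝ] E)) : Submodule ℂ (E →L[ℝ] ℂ) where
  carrier := {θ | ∀ v ∈ W, pairing θ v = 0}
  zero_mem' := by
    intro v _
    simp [pairing]
  add_mem' := by
    intro θ η hθ hη v hv
    have h : pairing (θ + η) = pairing θ + pairing η := by
      simp [pairing]
    rw [h, LinearMap.add_apply, hθ v hv, hη v hv, add_zero]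
  smul_mem' := by
    intro c θ hθ v hv
    have h : pairing (c • θ) = c • pairing θ := by
      ext x
      simp [pairing]
    rw [h, LinearMap.smul_apply, hθ v hv, smul_zero]

/-- The complex one-forms `θ_a` form a basis of the bundle `W^⊥` over `U`. -/
def IsBasisOfAnnihilator {ι : Type*} (U : Set E) (θ : ι → E → E →L[ℝ] ℂ)
    (W : E → Submodule ℂ (ℂ ⊗[ℝ] E)) : Prop :=
  ∀ x ∈ U, LinearIndependent ℂ (fun a => θ a x) ∧
    Submodule.span ℂ (Set.range fun a => θ a x) = annihilator (W x)

variable {n : ℕ}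

/-- The vector `∂/∂ζ^k = (∂/∂x^k - i ∂/∂y^k) / 2` where `ζ^k = x^k + i y^k`. -/
def partialZeta (k : Fin n) : ℂ ⊗[ℝ] EuclideanSpace ℂ (Fin n) :=
  (1 / 2 : ℂ) ⊗ₜ[ℝ] EuclideanSpace.single k (1 : ℂ) -
    (Complex.I / 2) ⊗ₜ[ℝ] EuclideanSpace.single k Complex.I

/-- The vector `∂/∂ζ̄^k = (∂/∂x^k + i ∂/∂y^k) / 2`. -/
def partialZetaBar (k : Fin n) : ℂ ⊗[ℝ] EuclideanSpace ℂ (Fin n) :=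
  (1 / 2 : ℂ) ⊗ₜ[ℝ] EuclideanSpace.single k (1 : ℂ) +
    (Complex.I / 2) ⊗ₜ[ℝ] EuclideanSpace.single k Complex.I

/-- The value `∑_k b^k ∂/∂ζ^k` of a vector field of type `(1,0)` on `ℂⁿ` with coefficients `b`. -/
def holVector (b : EuclideanSpace ℂ (Fin n)) : ℂ ⊗[ℝ] EuclideanSpace ℂ (Fin n) :=
  ∑ k, b k • partialZeta k

/-- The value `∑_k b^k ∂/∂ξ^k` of a complex vector field on `ℝⁿ` with coefficients `b`. -/
def realVector (b : EuclideanSpace ℂ (Fin n)) : ℂ ⊗[ℝ] EuclideanSpace ℝ (Fin n) :=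
  ∑ k, b k ⊗ₜ[ℝ] EuclideanSpace.single k (1 : ℝ)

/-- The inclusion `ξ ↦ ξ + i0` of `ℝⁿ` in `ℂⁿ`. -/
def realIncl (ξ : EuclideanSpace ℝ (Fin n)) : EuclideanSpace ℂ (Fin n) :=
  WithLp.toLp 2 fun k => (ξ k : ℂ)

end Complexified

end HolFrob

end

/-! The first integrals are constructed as power series in ζ whose coefficients are functions of s.
The monomials then carry all the regularity in ζ, and the coefficients all the regularity in s.

Reduction to graph form. In linear coordinates (z, w) in which the fields at the base point are the
∂/∂z_j, the block of z-components is invertible nearby. Multiplying by its inverse gives fields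
∂/∂z_j + ∑_k a_j^k ∂/∂w_k with the same span (`exists_graph_form`), and these still commute
(`graph_commute`). Cauchy's integral formula with s as a parameter (`HZBound.exists_expansion`)
expands each a_j^k in powers of (z, w), with 𝒞^β coefficients whose bounds grow geometrically.

Formal solution. In place of flows, one solves the single radial equation ∑_j z_j Z_j F = 0 with F =
w_l on z = 0. Here ∑ z_j ∂/∂z_j multiplies a coefficient by its degree in z, while ∑ z_j a_j^k
∂/∂w_k raises that degree, so the equation is a recursion (`exists_formal_radial`). If the Z_j
commute, u = Z_j F satisfies ∑_i z_i Z_i u = -u, and the same recursion forces u = 0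
(`graphField_eq_zero`). Convergence follows from a majorant of the form K^d L^e binom(d+e, d), where
d and e are the degrees in z and w: the binomial absorbs the factor lost in each w-derivative
(`radial_bound`). The recursion runs over an arbitrary ℚ-algebra with an abstract size predicate.
Taking functions of s with the constant of `HZBound` as size, one obtains Cauchy estimates of class
𝒞^β for the coefficients directly (`exists_first_integrals_of_graph`).

Regularity. Each term of the resulting series is a monomial in ζ times a function of s. The bounds
of the two factors multiply and the products are summable on a small polydisc
(`exists_hzBound_tensorSeries`). For the bi-parameter class one cuts off in ζ and in s separately. A
double dyadic block of a term is then a product of two one-variable blocks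
(`ParamBound.biHZInfty_tensorSeries`), and each of these decays by `exists_dyadic_bound`, whose
kernel is written as a sum of second differences.

Independence and annihilators. At the base point the w-derivatives of the first integrals form the
identity matrix, so the differential in ζ stays surjective nearby (`exists_first_integral_map`). The
two statements about annihilators are then pointwise linear algebra
(`isBasis_annihilator_holVector`, `isBasis_annihilator_realVector`). -/

open scoped ContDiff ENNReal TensorProduct SchwartzMap FourierTransform ComplexConjugate

/-! ### Hölder and midpoint bounds with explicit constants, without derivatives. -/

namespace HolFrob

/-- Admissible exponents: `r' = r` for a Hölder exponent `r < 1`, and `r' = 1 / 2` for the Zygmund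
exponent `r = 1`, satisfy these inequalities. -/
structure ZygExp (r' r : ℝ) : Prop where
  pos : 0 < r'
  le : r' ≤ r
  le_one : r ≤ 1
  le_two : r ≤ 2 * r'

lemma ZygExp.pos' {r' r : ℝ} (h : ZygExp r' r) : 0 < r := h.pos.trans_le h.le

lemma ZygExp.le_one' {r' r : ℝ} (h : ZygExp r' r) : r' ≤ 1 := h.le.trans h.le_one

section Base

variable {E E' F F₁ F₂ F₃ : Type} [NormedAddCommGroup E] [NormedSpace ℝ E]
  [NormedAddCommGroup E'] [NormedSpace ℝ E']
  [NormedAddCommGroup F] [NormedSpace ℝ F] [NormedAddCommGroup F₁] [NormedSpace ℝ F₁]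
  [NormedAddCommGroup F₂] [NormedSpace ℝ F₂] [NormedAddCommGroup F₃] [NormedSpace ℝ F₃]

/-- `C` bounds the supremum, the `r'`-Hölder quotient and the `r`-midpoint quotient of `f`. -/
structure ZygBound (r' r : ℝ) (Ω : Set E) (f : E → F) (C : ℝ) : Prop where
  nonneg : 0 ≤ C
  norm_le : ∀ x ∈ Ω, ‖f x‖ ≤ C
  diff_le : ∀ x ∈ Ω, ∀ y ∈ Ω, ‖f x - f y‖ ≤ C * ‖x - y‖ ^ r'
  mid_le : ∀ x ∈ Ω, ∀ y ∈ Ω, (2⁻¹ : ℝ) • (x + y) ∈ Ω →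
    ‖(2⁻¹ : ℝ) • (f x + f y) - f ((2⁻¹ : ℝ) • (x + y))‖ ≤ C * ‖x - y‖ ^ r

/-- The function `f` and its derivatives of order at most `k` satisfy `ZygBound` with `C`. -/
def HZBound (r' r : ℝ) (Ω : Set E) :
    ℕ → ∀ {F : Type} [NormedAddCommGroup F] [NormedSpace ℝ F], (E → F) → ℝ → Prop
  | 0, _, _, _, f, C => ZygBound r' r Ω f C
  | k + 1, _, _, _, f, C => ZygBound r' r Ω f C ∧ DifferentiableOn ℝ f Ω ∧
      HZBound r' r Ω k (fderiv ℝ f) C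

variable {r' r : ℝ} {Ω Ω' : Set E} {f g : E → F} {C D : ℝ}

lemma norm_sub_mid_left (x y : E) : ‖x - (2⁻¹ : ℝ) • (x + y)‖ = ‖x - y‖ / 2 := by
  have : x - (2⁻¹ : ℝ) • (x + y) = (2⁻¹ : ℝ) • (x - y) := by module
  rw [this, norm_smul]; norm_num; ring

lemma norm_sub_mid_right (x y : E) : ‖y - (2⁻¹ : ℝ) • (x + y)‖ = ‖x - y‖ / 2 := by
  rw [add_comm, norm_sub_mid_left, norm_sub_rev]

/-- This is where r ≤ 2r' enters: midpoint differences of products and reciprocals have remainders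
quadratic in the increments, and at distance at most 1 two r'-Hölder increments are as good as one
factor of order r. -/
lemma ZygExp.rpow_mul_rpow_le (h : ZygExp r' r) {t : ℝ} (ht : 0 ≤ t) (ht1 : t ≤ 1) :
    t ^ r' * t ^ r' ≤ t ^ r := by
  rw [← Real.rpow_add_of_nonneg ht h.pos.le h.pos.le]
  exact Real.rpow_le_rpow_of_exponent_ge' ht ht1 h.pos'.le (by linarith [h.le_two])

lemma ZygExp.half_rpow_le (h : ZygExp r' r) {t : ℝ} (ht : 0 ≤ t) : (t / 2) ^ r' ≤ t ^ r' :=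
  Real.rpow_le_rpow (by linarith) (by linarith) h.pos.le

namespace ZygBound

lemma mono (h : ZygBound r' r Ω f C) (hCD : C ≤ D) : ZygBound r' r Ω f D where
  nonneg := h.nonneg.trans hCD
  norm_le x hx := (h.norm_le x hx).trans hCD
  diff_le x hx y hy := (h.diff_le x hx y hy).trans (by gcongr)
  mid_le x hx y hy hm := (h.mid_le x hx y hy hm).trans (by gcongr)

lemma subset (h : ZygBound r' r Ω f C) (hs : Ω' ⊆ Ω) : ZygBound r' r Ω' f C where
  nonneg := h.nonneg
  norm_le x hx := h.norm_le x (hs hx)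
  diff_le x hx y hy := h.diff_le x (hs hx) y (hs hy)
  mid_le x hx y hy hm := h.mid_le x (hs hx) y (hs hy) (hs hm)

lemma congr (h : ZygBound r' r Ω f C) (hfg : Set.EqOn g f Ω) : ZygBound r' r Ω g C where
  nonneg := h.nonneg
  norm_le x hx := by rw [hfg hx]; exact h.norm_le x hx
  diff_le x hx y hy := by rw [hfg hx, hfg hy]; exact h.diff_le x hx y hy
  mid_le x hx y hy hm := by rw [hfg hx, hfg hy, hfg hm]; exact h.mid_le x hx y hy hm

lemma const (c : F) : ZygBound r' r Ω (fun _ => c) ‖c‖ where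
  nonneg := norm_nonneg _
  norm_le _ _ := le_rfl
  diff_le _ _ _ _ := by simp; positivity
  mid_le _ _ _ _ _ := by
    have : (2⁻¹ : ℝ) • (c + c) - c = 0 := by module
    rw [this, norm_zero]; positivity

lemma add (hf : ZygBound r' r Ω f C) (hg : ZygBound r' r Ω g D) :
    ZygBound r' r Ω (fun x => f x + g x) (C + D) where
  nonneg := add_nonneg hf.nonneg hg.nonneg
  norm_le x hx := norm_add_le_of_le (hf.norm_le x hx) (hg.norm_le x hx)
  diff_le x hx y hy := by
    rw [add_mul, add_sub_add_comm]
    exact norm_add_le_of_le (hf.diff_le x hx y hy) (hg.diff_le x hx y hy)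
  mid_le x hx y hy hm := by
    have : (2⁻¹ : ℝ) • (f x + g x + (f y + g y)) - (f ((2⁻¹ : ℝ) • (x + y)) +
        g ((2⁻¹ : ℝ) • (x + y))) = ((2⁻¹ : ℝ) • (f x + f y) - f ((2⁻¹ : ℝ) • (x + y))) +
        ((2⁻¹ : ℝ) • (g x + g y) - g ((2⁻¹ : ℝ) • (x + y))) := by module
    rw [this, add_mul]
    exact norm_add_le_of_le (hf.mid_le x hx y hy hm) (hg.mid_le x hx y hy hm)

lemma clm_comp (hf : ZygBound r' r Ω f C) (B : F →L[ℝ] F₁) :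
    ZygBound r' r Ω (fun x => B (f x)) (‖B‖ * C) where
  nonneg := mul_nonneg (norm_nonneg _) hf.nonneg
  norm_le x hx := B.le_opNorm_of_le (hf.norm_le x hx)
  diff_le x hx y hy := by
    rw [← map_sub, mul_assoc]; exact B.le_opNorm_of_le (hf.diff_le x hx y hy)
  mid_le x hx y hy hm := by
    rw [← map_add, ← map_smul, ← map_sub, mul_assoc]
    exact B.le_opNorm_of_le (hf.mid_le x hx y hy hm)

lemma comp_affine (h : ZygExp r' r) (hf : ZygBound r' r Ω f C) (L : E' →L[ℝ] E) (x₀ : E)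
    {Λ : ℝ} (hΛ : 1 ≤ Λ) (hL : ‖L‖ ≤ Λ) {O : Set E'}
    (hO : ∀ x ∈ O, x₀ + L x ∈ Ω) :
    ZygBound r' r O (fun x => f (x₀ + L x)) (C * Λ) := by
  have key : ∀ (x y : E') (t : ℝ), 0 < t → t ≤ 1 →
      ‖x₀ + L x - (x₀ + L y)‖ ^ t ≤ Λ * ‖x - y‖ ^ t := by
    intro x y t ht ht1
    have : x₀ + L x - (x₀ + L y) = L (x - y) := by rw [map_sub]; abel
    rw [this]
    calc ‖L (x - y)‖ ^ t ≤ (Λ * ‖x - y‖) ^ t := by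
          gcongr; exact L.le_of_opNorm_le hL _
      _ = Λ ^ t * ‖x - y‖ ^ t := Real.mul_rpow (by linarith) (norm_nonneg _)
      _ ≤ Λ * ‖x - y‖ ^ t := by
          gcongr
          calc Λ ^ t ≤ Λ ^ (1 : ℝ) := Real.rpow_le_rpow_of_exponent_le hΛ ht1
            _ = Λ := Real.rpow_one _
  have hC := hf.nonneg
  refine ⟨by positivity, fun x hx => (hf.norm_le _ (hO x hx)).trans (by nlinarith), ?_, ?_⟩
  · intro x hx y hy
    refine (hf.diff_le _ (hO x hx) _ (hO y hy)).trans ?_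
    rw [mul_assoc]; gcongr; exact key x y r' h.pos h.le_one'
  · intro x hx y hy hm
    have e : (2⁻¹ : ℝ) • (x₀ + L x + (x₀ + L y)) = x₀ + L ((2⁻¹ : ℝ) • (x + y)) := by
      rw [map_smul, map_add]; module
    have := hf.mid_le _ (hO x hx) _ (hO y hy) (by rw [e]; exact hO _ hm)
    rw [e] at this
    refine this.trans ?_
    rw [mul_assoc]; gcongr; exact key x y r h.pos' h.le_one

lemma bilin (h : ZygExp r' r) (B : F₁ →L[ℝ] F₂ →L[ℝ] F₃) {b : ℝ} (hB : ‖B‖ ≤ b)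
    {f : E → F₁} {g : E → F₂} (hf : ZygBound r' r Ω f C) (hg : ZygBound r' r Ω g D) :
    ZygBound r' r Ω (fun x => B (f x) (g x)) (4 * (b * C * D)) := by
  have hC := hf.nonneg
  have hD := hg.nonneg
  have hb : 0 ≤ b := B.opNorm_nonneg.trans hB
  have key : ∀ (u : F₁) (v : F₂) (s t : ℝ), ‖u‖ ≤ s → ‖v‖ ≤ t → ‖B u v‖ ≤ b * s * t := by
    intro u v s t hu hv
    refine (B.le_opNorm₂ u v).trans ?_
    have := (norm_nonneg u).trans hu
    gcongr
  have hbCD : 0 ≤ b * C * D := by positivity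
  refine ⟨by positivity, ?_, ?_, ?_⟩
  · intro x hx
    linarith [key _ _ _ _ (hf.norm_le x hx) (hg.norm_le x hx)]
  · intro x hx y hy
    have e : B (f x) (g x) - B (f y) (g y) = B (f x - f y) (g x) + B (f y) (g x - g y) := by
      simp
    have h1 := key _ _ _ _ (hf.diff_le x hx y hy) (hg.norm_le x hx)
    have h2 := key _ _ _ _ (hf.norm_le y hy) (hg.diff_le x hx y hy)
    rw [e]
    have h0 : 0 ≤ b * C * D * ‖x - y‖ ^ r' := by positivity
    refine (norm_add_le_of_le h1 h2).trans ?_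
    linarith
  · intro x hx y hy hm
    set m := (2⁻¹ : ℝ) • (x + y)
    have h0 : 0 ≤ b * C * D * ‖x - y‖ ^ r := by positivity
    rcases le_total ‖x - y‖ 1 with ht | ht
    -- Leibniz rule for midpoint differences: two terms linear in the midpoint differences of f and
    -- g, and two terms quadratic in increments from the midpoint. At distance at least 1 the sup
    -- bounds suffice.
    · have e : (2⁻¹ : ℝ) • (B (f x) (g x) + B (f y) (g y)) - B (f m) (g m) =
          ((2⁻¹ : ℝ) • B (f x - f m) (g x - g m) + (2⁻¹ : ℝ) • B (f y - f m) (g y - g m)) +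
          (B (f m) ((2⁻¹ : ℝ) • (g x + g y) - g m) +
          B ((2⁻¹ : ℝ) • (f x + f y) - f m) (g m)) := by
        simp only [map_sub, map_add, map_smul, sub_apply,
          add_apply, smul_apply]
        module
      have hq : ∀ z ∈ Ω, ‖z - m‖ = ‖x - y‖ / 2 →
          ‖(2⁻¹ : ℝ) • B (f z - f m) (g z - g m)‖ ≤ 2⁻¹ * (b * C * D * ‖x - y‖ ^ r) := by
        intro z hz hzm
        have h1 := hf.diff_le z hz m hm
        have h2 := hg.diff_le z hz m hm
        rw [hzm] at h1 h2
        have h3 := h.half_rpow_le (norm_nonneg (x - y))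
        have h4 := key _ _ _ _ (h1.trans (mul_le_mul_of_nonneg_left h3 hC))
          (h2.trans (mul_le_mul_of_nonneg_left h3 hD))
        rw [norm_smul, Real.norm_of_nonneg (by norm_num)]
        gcongr
        refine h4.trans ?_
        have := mul_le_mul_of_nonneg_left (h.rpow_mul_rpow_le (norm_nonneg (x - y)) ht) hbCD
        linarith
      have h3 := key _ _ _ _ (hf.norm_le m hm) (hg.mid_le x hx y hy hm)
      have h4 := key _ _ _ _ (hf.mid_le x hx y hy hm) (hg.norm_le m hm)
      rw [e]
      refine (norm_add_le_of_le (norm_add_le_of_le (hq x hx (norm_sub_mid_left x y))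
        (hq y hy (norm_sub_mid_right x y))) (norm_add_le_of_le h3 h4)).trans ?_
      linarith
    · have h1 := key _ _ _ _ (hf.norm_le x hx) (hg.norm_le x hx)
      have h2 := key _ _ _ _ (hf.norm_le y hy) (hg.norm_le y hy)
      have h3 := key _ _ _ _ (hf.norm_le m hm) (hg.norm_le m hm)
      have h4 : ‖(2⁻¹ : ℝ) • (B (f x) (g x) + B (f y) (g y)) - B (f m) (g m)‖ ≤
          2⁻¹ * (b * C * D + b * C * D) + b * C * D := by
        refine norm_sub_le_of_le ?_ h3
        rw [norm_smul, Real.norm_of_nonneg (by norm_num)]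
        gcongr
        exact norm_add_le_of_le h1 h2
      have h5 := Real.one_le_rpow ht h.pos'.le
      nlinarith

/-- At distance at most 1 the distance is below each of its powers with exponent at most 1, and at
larger distance the sup bound suffices. -/
lemma of_lipschitz (h : ZygExp r' r) (hC : 0 ≤ C) (h0 : ∀ x ∈ Ω, ‖f x‖ ≤ C)
    (h1 : ∀ x ∈ Ω, ∀ y ∈ Ω, ‖f x - f y‖ ≤ C * ‖x - y‖) : ZygBound r' r Ω f (2 * C) := by
  refine ⟨by positivity, fun x hx => by linarith [h0 x hx], ?_, ?_⟩
  · intro x hx y hy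
    rcases le_total ‖x - y‖ 1 with ht | ht
    · refine (h1 x hx y hy).trans ?_
      have := Real.rpow_le_rpow_of_exponent_ge' (norm_nonneg _) ht h.pos.le h.le_one'
      rw [Real.rpow_one] at this
      have h0 : 0 ≤ ‖x - y‖ := norm_nonneg _
      nlinarith
    · refine (norm_sub_le_of_le (h0 x hx) (h0 y hy)).trans ?_
      have := Real.one_le_rpow ht h.pos.le
      nlinarith
  · intro x hx y hy hm
    set m := (2⁻¹ : ℝ) • (x + y)
    have e : (2⁻¹ : ℝ) • (f x + f y) - f m = (2⁻¹ : ℝ) • (f x - f m) + (2⁻¹ : ℝ) • (f y - f m) := by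
      module
    have hz : ∀ z ∈ Ω, ∀ c : ℝ, ‖f z - f m‖ ≤ c → ‖(2⁻¹ : ℝ) • (f z - f m)‖ ≤ 2⁻¹ * c := by
      intro z _ c hc
      rw [norm_smul, Real.norm_of_nonneg (by norm_num)]; gcongr
    rw [e]
    rcases le_total ‖x - y‖ 1 with ht | ht
    · have h2 := h1 x hx m hm
      have h3 := h1 y hy m hm
      rw [norm_sub_mid_left] at h2
      rw [norm_sub_mid_right] at h3
      refine (norm_add_le_of_le (hz x hx _ h2) (hz y hy _ h3)).trans ?_
      have := Real.rpow_le_rpow_of_exponent_ge' (norm_nonneg _) ht h.pos'.le h.le_one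
      rw [Real.rpow_one] at this
      have h0 : 0 ≤ ‖x - y‖ := norm_nonneg _
      nlinarith
    · refine (norm_add_le_of_le (hz x hx _ (norm_sub_le_of_le (h0 x hx) (h0 m hm)))
        (hz y hy _ (norm_sub_le_of_le (h0 y hy) (h0 m hm)))).trans ?_
      have := Real.one_le_rpow ht h.pos'.le
      nlinarith

lemma tsum [CompleteSpace F] {ι : Type} {f : ι → E → F} {c : ι → ℝ}
    (hf : ∀ i, ZygBound r' r Ω (f i) (c i)) (hc : Summable c) :
    ZygBound r' r Ω (fun x => ∑' i, f i x) (∑' i, c i) := by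
  have hs : ∀ x ∈ Ω, Summable fun i => f i x := fun x hx =>
    Summable.of_norm_bounded hc fun i => (hf i).norm_le x hx
  refine ⟨tsum_nonneg fun i => (hf i).nonneg, ?_, ?_, ?_⟩
  · intro x hx
    exact tsum_of_norm_bounded hc.hasSum fun i => (hf i).norm_le x hx
  · intro x hx y hy
    rw [← (hs x hx).tsum_sub (hs y hy)]
    exact tsum_of_norm_bounded (hc.hasSum.mul_right _) fun i => (hf i).diff_le x hx y hy
  · intro x hx y hy hm
    rw [← (hs x hx).tsum_add (hs y hy), ← ((hs x hx).add (hs y hy)).tsum_const_smul,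
      ← (((hs x hx).add (hs y hy)).const_smul _).tsum_sub (hs _ hm)]
    exact tsum_of_norm_bounded (hc.hasSum.mul_right _) fun i => (hf i).mid_le x hx y hy hm

lemma continuousOn (h : ZygExp r' r) (hf : ZygBound r' r Ω f C) : ContinuousOn f Ω := by
  intro x hx
  rw [ContinuousWithinAt, tendsto_iff_norm_sub_tendsto_zero]
  have h1 : Filter.Tendsto (fun y => C * ‖y - x‖ ^ r') (nhdsWithin x Ω) (nhds 0) := by
    have : ContinuousAt (fun y => C * ‖y - x‖ ^ r') x := by
      refine continuousAt_const.mul (ContinuousAt.rpow_const (by fun_prop) (Or.inr h.pos.le))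
    have h2 := this.tendsto
    simp only [sub_self, norm_zero, Real.zero_rpow h.pos.ne', mul_zero] at h2
    exact h2.mono_left nhdsWithin_le_nhds
  exact squeeze_zero' (.of_forall fun _ => norm_nonneg _)
    (eventually_nhdsWithin_of_forall fun y hy => hf.diff_le y hy x hx) h1

lemma inv (h : ZygExp r' r) {f : E → ℂ} (hf : ZygBound r' r Ω f C) {c : ℝ} (hc : 0 < c)
    (hfc : ∀ x ∈ Ω, c ≤ ‖f x‖) : ∃ D, ZygBound r' r Ω (fun x => (f x)⁻¹) D := by
  have hC := hf.nonneg
  have hi : ∀ x ∈ Ω, ‖(f x)⁻¹‖ ≤ c⁻¹ := fun x hx => by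
    rw [norm_inv]; exact inv_anti₀ hc (hfc x hx)
  have hne : ∀ x ∈ Ω, f x ≠ 0 := fun x hx h0 => by
    have := hfc x hx; rw [h0, norm_zero] at this; linarith
  set d := c⁻¹
  have hd : 0 < d := inv_pos.2 hc
  refine ⟨2 * d + d ^ 2 * C + d ^ 3 * C ^ 2, by positivity, ?_, ?_, ?_⟩
  · intro x hx
    have := hi x hx
    have : 0 ≤ d ^ 2 * C + d ^ 3 * C ^ 2 := by positivity
    linarith
  · intro x hx y hy
    have e : (f x)⁻¹ - (f y)⁻¹ = -((f x)⁻¹ * (f y)⁻¹ * (f x - f y)) := by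
      field_simp [hne x hx, hne y hy]; ring
    rw [e, norm_neg, norm_mul, norm_mul]
    calc _ ≤ d * d * (C * ‖x - y‖ ^ r') := by
          gcongr
          exacts [hi x hx, hi y hy, hf.diff_le x hx y hy]
      _ = (d ^ 2 * C) * ‖x - y‖ ^ r' := by ring
      _ ≤ _ := by
          gcongr
          have : 0 ≤ 2 * d + d ^ 3 * C ^ 2 := by positivity
          linarith
  · intro x hx y hy hm
    set m := (2⁻¹ : ℝ) • (x + y)
    have hs : ∀ w : ℂ, ‖(2⁻¹ : ℝ) • w‖ = 2⁻¹ * ‖w‖ := fun w => by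
      rw [norm_smul, Real.norm_of_nonneg (by norm_num)]
    rcases le_total ‖x - y‖ 1 with ht | ht
    -- Average over the two endpoints of the exact expansion 1/w = 1/c - (w-c)/c² + (w-c)²/(c²w) at
    -- c = f m.
    · have e : (2⁻¹ : ℝ) • ((f x)⁻¹ + (f y)⁻¹) - (f m)⁻¹ =
          (2⁻¹ : ℝ) • ((f m)⁻¹ ^ 2 * ((f x)⁻¹ * (f x - f m) ^ 2)) +
          (2⁻¹ : ℝ) • ((f m)⁻¹ ^ 2 * ((f y)⁻¹ * (f y - f m) ^ 2)) -
          (f m)⁻¹ ^ 2 * ((2⁻¹ : ℝ) • (f x + f y) - f m) := by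
        simp only [Complex.real_smul]
        have := hne x hx
        have := hne y hy
        have := hne m hm
        push_cast
        field_simp
        ring
      have hz : ∀ z ∈ Ω, ‖z - m‖ = ‖x - y‖ / 2 →
          ‖(2⁻¹ : ℝ) • ((f m)⁻¹ ^ 2 * ((f z)⁻¹ * (f z - f m) ^ 2))‖ ≤
            2⁻¹ * (d ^ 3 * C ^ 2 * ‖x - y‖ ^ r) := by
        intro z hz hzm
        rw [hs, norm_mul, norm_mul, norm_pow, norm_pow]
        have h1 := hf.diff_le z hz m hm
        rw [hzm] at h1
        have h3 := h.half_rpow_le (norm_nonneg (x - y))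
        have h4 := h1.trans (mul_le_mul_of_nonneg_left h3 hC)
        have h5 := h.rpow_mul_rpow_le (norm_nonneg (x - y)) ht
        calc _ ≤ 2⁻¹ * (d ^ 2 * (d * (C * ‖x - y‖ ^ r') ^ 2)) := by
              gcongr
              exacts [hi m hm, hi z hz]
          _ = 2⁻¹ * (d ^ 3 * C ^ 2 * (‖x - y‖ ^ r' * ‖x - y‖ ^ r')) := by ring
          _ ≤ _ := by gcongr
      have h3 : ‖(f m)⁻¹ ^ 2 * ((2⁻¹ : ℝ) • (f x + f y) - f m)‖ ≤ d ^ 2 * (C * ‖x - y‖ ^ r) := by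
        rw [norm_mul, norm_pow]
        gcongr
        exacts [hi m hm, hf.mid_le x hx y hy hm]
      rw [e]
      refine (norm_sub_le_of_le (norm_add_le_of_le (hz x hx (norm_sub_mid_left x y))
        (hz y hy (norm_sub_mid_right x y))) h3).trans ?_
      have : 0 ≤ d * ‖x - y‖ ^ r := by positivity
      linarith
    · have h4 : ‖(2⁻¹ : ℝ) • ((f x)⁻¹ + (f y)⁻¹) - (f m)⁻¹‖ ≤ 2⁻¹ * (d + d) + d := by
        refine norm_sub_le_of_le ?_ (hi m hm)
        rw [hs]
        gcongr
        exact norm_add_le_of_le (hi x hx) (hi y hy)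
      have h5 := Real.one_le_rpow ht h.pos'.le
      have h6 : 0 ≤ d ^ 2 * C + d ^ 3 * C ^ 2 := by positivity
      nlinarith

/-- A function which vanishes off a set at distance `δ` from the complement of `Ω` inherits
bounds on the whole space. -/
lemma extend (h : ZygExp r' r) (hf : ZygBound r' r Ω f C) {δ : ℝ} (hδ : 0 < δ)
    (hδ1 : δ ≤ 1)
    (hK : ∀ x, f x ≠ 0 → Metric.ball x δ ⊆ Ω) :
    ZygBound r' r Set.univ f (2 * C / δ) := by
  have hC := hf.nonneg
  have hb : ∀ x, ‖f x‖ ≤ C := by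
    intro x
    by_cases hx : f x = 0
    · rw [hx, norm_zero]; exact hC
    · exact hf.norm_le x (hK x hx (Metric.mem_ball_self hδ))
  have hCd : C ≤ C / δ := le_div_self hC hδ hδ1
  -- Points at distance at least δ are handled by the sup bound, since δ ≤ ‖x - y‖^t for δ, t ≤ 1.
  -- Closer points lie, with their midpoint, in one δ-ball inside Ω as soon as f is nonzero at one
  -- of the three.
  have hbig : ∀ x y : E, ∀ t : ℝ, 0 < t → t ≤ 1 → δ ≤ ‖x - y‖ →
      2 * C ≤ 2 * C / δ * ‖x - y‖ ^ t := by
    intro x y t ht ht1 hxy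
    have h1 : δ ≤ ‖x - y‖ ^ t := by
      calc δ = δ ^ (1 : ℝ) := (Real.rpow_one _).symm
        _ ≤ δ ^ t := Real.rpow_le_rpow_of_exponent_ge hδ hδ1 ht1
        _ ≤ _ := Real.rpow_le_rpow hδ.le hxy ht.le
    calc 2 * C = 2 * C / δ * δ := by field_simp
      _ ≤ _ := by gcongr
  have hbig' : ∀ x y : E, ∀ t : ℝ, C * ‖x - y‖ ^ t ≤ 2 * C / δ * ‖x - y‖ ^ t := by
    intro x y t
    gcongr
    rw [mul_div_assoc]; linarith
  refine ⟨by positivity, fun x _ => (hb x).trans (by rw [mul_div_assoc]; linarith), ?_, ?_⟩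
  · intro x _ y _
    rcases le_or_gt δ ‖x - y‖ with hd | hd
    · refine (norm_sub_le_of_le (hb x) (hb y)).trans ?_
      linarith [hbig x y r' h.pos h.le_one' hd]
    · by_cases hx : f x = 0
      · by_cases hy : f y = 0
        · rw [hx, hy, sub_zero, norm_zero]; positivity
        · exact (hf.diff_le x (hK y hy (by rwa [Metric.mem_ball, dist_eq_norm]))
            y (hK y hy (Metric.mem_ball_self hδ))).trans (hbig' x y r')
      · exact (hf.diff_le x (hK x hx (Metric.mem_ball_self hδ))
            y (hK x hx (by rwa [Metric.mem_ball', dist_eq_norm]))).trans (hbig' x y r')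
  · intro x _ y _ _
    set m := (2⁻¹ : ℝ) • (x + y) with hmdef
    rcases le_or_gt δ ‖x - y‖ with hd | hd
    · have h4 : ‖(2⁻¹ : ℝ) • (f x + f y) - f m‖ ≤ 2⁻¹ * (C + C) + C := by
        refine norm_sub_le_of_le ?_ (hb m)
        rw [norm_smul, Real.norm_of_nonneg (by norm_num)]
        gcongr
        exact norm_add_le_of_le (hb x) (hb y)
      linarith [hbig x y r h.pos' h.le_one hd]
    · have hxm : dist x m < δ := by
        rw [dist_eq_norm, norm_sub_mid_left]; linarith [norm_nonneg (x - y)]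
      have hym : dist y m < δ := by
        rw [dist_eq_norm, norm_sub_mid_right]; linarith [norm_nonneg (x - y)]
      have hxy : dist x y < δ := by rwa [dist_eq_norm]
      by_cases hx : f x = 0
      · by_cases hy : f y = 0
        · by_cases hm : f m = 0
          · rw [hx, hy, hm]; simp; positivity
          · exact (hf.mid_le x (hK m hm hxm) y (hK m hm hym)
              (hK m hm (Metric.mem_ball_self hδ))).trans (hbig' x y r)
        · exact (hf.mid_le x (hK y hy hxy) y (hK y hy (Metric.mem_ball_self hδ))
              (hK y hy (Metric.mem_ball'.2 hym))).trans (hbig' x y r)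
      · exact (hf.mid_le x (hK x hx (Metric.mem_ball_self hδ)) y (hK x hx (Metric.mem_ball'.2 hxy))
              (hK x hx (Metric.mem_ball'.2 hxm))).trans (hbig' x y r)

end ZygBound

end Base

end HolFrob

namespace HolFrob

/-! ### Calculus of bounds on a function and its derivatives up to order k. -/

section HZ

variable {E E' F F₁ F₂ F₃ : Type} [NormedAddCommGroup E] [NormedSpace ℝ E]
  [NormedAddCommGroup E'] [NormedSpace ℝ E']
  [NormedAddCommGroup F] [NormedSpace ℝ F] [NormedAddCommGroup F₁] [NormedSpace ℝ F₁]
  [NormedAddCommGroup F₂] [NormedSpace ℝ F₂] [NormedAddCommGroup F₃] [NormedSpace ℝ F₃]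
  {r' r : ℝ} {Ω Ω' : Set E} {f g : E → F} {C D : ℝ} {k : ℕ}

/-- For fixed t, an increment in s is an increment of the same length in the product, so the bound
passes under the integral. The weight is operator-valued so that the s-derivative of such an
integral is again of this form. -/
lemma ZygBound.intervalIntegral {X S : Type} [NormedAddCommGroup X] [NormedSpace ℝ X]
    [NormedAddCommGroup S] [NormedSpace ℝ S] (h : ZygExp r' r) {U : Set X} {V : Set S}
    {γ : ℝ → X} (hγ : Continuous γ) (hγU : ∀ t, γ t ∈ U) {W : ℝ} {B : ℝ → F →L[ℝ] F₁}
    (hB : Continuous B) (hBW : ∀ t, ‖B t‖ ≤ W) {f : X × S → F}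
    (hf : ZygBound r' r (U ×ˢ V) f C) :
    ZygBound r' r V (fun s => ∫ t in (0 : ℝ)..2 * Real.pi, B t (f (γ t, s)))
      (2 * Real.pi * (W * C)) := by
  have hπ := Real.pi_pos
  have hC := hf.nonneg
  have hW : 0 ≤ W := (B 0).opNorm_nonneg.trans (hBW 0)
  have key : ∀ (u : ℝ → F₁) (c : ℝ), (∀ t, ‖u t‖ ≤ W * c) →
      ‖∫ t in (0 : ℝ)..2 * Real.pi, u t‖ ≤ 2 * Real.pi * (W * c) := by
    intro u c hu
    have := intervalIntegral.norm_integral_le_of_norm_le_const (a := 0) (b := 2 * Real.pi)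
      (f := u) (C := W * c) fun t _ => hu t
    rwa [sub_zero, abs_of_pos (by positivity), mul_comm (W * c)] at this
  have hi : ∀ s ∈ V, IntervalIntegrable (fun t => B t (f (γ t, s))) MeasureTheory.volume
      0 (2 * Real.pi) := by
    intro s hs
    have : Continuous fun t => f (γ t, s) :=
      (hf.continuousOn h).comp_continuous (by fun_prop) fun t => ⟨hγU t, hs⟩
    exact (hB.clm_apply this).intervalIntegrable _ _
  refine ⟨by positivity, fun s hs => key _ _ fun t => (B t).le_of_opNorm_le_of_le (hBW t)
    (hf.norm_le _ ⟨hγU t, hs⟩), ?_, ?_⟩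
  · intro x hx y hy
    rw [← intervalIntegral.integral_sub (hi x hx) (hi y hy), mul_assoc _ (W * C), mul_assoc W]
    refine key _ _ fun t => ?_
    rw [← map_sub]
    refine (B t).le_of_opNorm_le_of_le (hBW t) ?_
    have := hf.diff_le (γ t, x) ⟨hγU t, hx⟩ (γ t, y) ⟨hγU t, hy⟩
    simpa [Prod.norm_def] using this
  · intro x hx y hy hm
    have hs : IntervalIntegrable (fun t => (2⁻¹ : ℝ) • (B t (f (γ t, x)) + B t (f (γ t, y))))
        MeasureTheory.volume 0 (2 * Real.pi) := ((hi x hx).add (hi y hy)).smul _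
    rw [← intervalIntegral.integral_add (hi x hx) (hi y hy), ← intervalIntegral.integral_smul,
      ← intervalIntegral.integral_sub hs (hi _ hm), mul_assoc _ (W * C), mul_assoc W]
    refine key _ _ fun t => ?_
    rw [← map_add, ← map_smul, ← map_sub]
    refine (B t).le_of_opNorm_le_of_le (hBW t) ?_
    have e : (2⁻¹ : ℝ) • ((γ t, x) + (γ t, y)) = (γ t, (2⁻¹ : ℝ) • (x + y)) := by
      ext <;> simp
      module
    have := hf.mid_le (γ t, x) ⟨hγU t, hx⟩ (γ t, y) ⟨hγU t, hy⟩ (by rw [e]; exact ⟨hγU t, hm⟩)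
    rw [e] at this
    simpa [Prod.norm_def] using this

namespace HZBound

lemma zyg {F : Type} [NormedAddCommGroup F] [NormedSpace ℝ F] {f : E → F} {C : ℝ}
    (h : HZBound r' r Ω k f C) : ZygBound r' r Ω f C := by
  cases k with
  | zero => exact h
  | succ k => exact h.1

lemma nonneg (h : HZBound r' r Ω k f C) : 0 ≤ C := h.zyg.nonneg

lemma congr (hΩ : IsOpen Ω) {F : Type} [NormedAddCommGroup F] [NormedSpace ℝ F] {f g : E → F}
    (h : HZBound r' r Ω k f C) (hfg : Set.EqOn g f Ω) : HZBound r' r Ω k g C := by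
  induction k generalizing F with
  | zero => exact ZygBound.congr h hfg
  | succ k ih =>
    refine ⟨h.1.congr hfg, h.2.1.congr hfg, ih h.2.2 fun x hx => ?_⟩
    exact (hfg.eventuallyEq_of_mem (hΩ.mem_nhds hx)).fderiv_eq

lemma of_hasFDerivAt (hΩ : IsOpen Ω) {f' : E → E →L[ℝ] F} (h : ZygBound r' r Ω f C)
    (hf : ∀ x ∈ Ω, HasFDerivAt f (f' x) x) (h' : HZBound r' r Ω k f' C) :
    HZBound r' r Ω (k + 1) f C :=
  ⟨h, fun x hx => (hf x hx).differentiableAt.differentiableWithinAt,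
    h'.congr hΩ fun x hx => (hf x hx).fderiv⟩

lemma hasFDerivAt (hΩ : IsOpen Ω) (h : HZBound r' r Ω (k + 1) f C) {x : E} (hx : x ∈ Ω) :
    HasFDerivAt f (fderiv ℝ f x) x :=
  ((h.2.1 x hx).differentiableAt (hΩ.mem_nhds hx)).hasFDerivAt

lemma mono {F : Type} [NormedAddCommGroup F] [NormedSpace ℝ F] {f : E → F}
    (h : HZBound r' r Ω k f C) (hCD : C ≤ D) : HZBound r' r Ω k f D := by
  induction k generalizing F with
  | zero => exact ZygBound.mono h hCD
  | succ k ih => exact ⟨h.1.mono hCD, h.2.1, ih h.2.2⟩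

lemma subset {F : Type} [NormedAddCommGroup F] [NormedSpace ℝ F] {f : E → F}
    (h : HZBound r' r Ω k f C) (hs : Ω' ⊆ Ω) : HZBound r' r Ω' k f C := by
  induction k generalizing F with
  | zero => exact ZygBound.subset h hs
  | succ k ih => exact ⟨h.1.subset hs, h.2.1.mono hs, ih h.2.2⟩

lemma of_succ {F : Type} [NormedAddCommGroup F] [NormedSpace ℝ F] {f : E → F}
    (h : HZBound r' r Ω (k + 1) f C) : HZBound r' r Ω k f C := by
  induction k generalizing F with
  | zero => exact h.1
  | succ k ih => exact ⟨h.1, h.2.1, ih h.2.2⟩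

lemma continuousOn (he : ZygExp r' r) (h : HZBound r' r Ω k f C) : ContinuousOn f Ω :=
  h.zyg.continuousOn he

lemma const {F : Type} [NormedAddCommGroup F] [NormedSpace ℝ F] (c : F) :
    HZBound r' r Ω k (fun _ => c) ‖c‖ := by
  induction k generalizing F with
  | zero => exact ZygBound.const c
  | succ k ih =>
    refine ⟨ZygBound.const c, differentiableOn_const c, ?_⟩
    have : fderiv ℝ (fun _ : E => c) = fun _ => 0 := by ext; simp
    rw [this]
    exact (ih (0 : E →L[ℝ] F)).mono (by simp)

lemma add (hΩ : IsOpen Ω) {F : Type} [NormedAddCommGroup F] [NormedSpace ℝ F] {f g : E → F}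
    (hf : HZBound r' r Ω k f C) (hg : HZBound r' r Ω k g D) :
    HZBound r' r Ω k (fun x => f x + g x) (C + D) := by
  induction k generalizing F with
  | zero => exact ZygBound.add hf hg
  | succ k ih =>
    exact of_hasFDerivAt hΩ (hf.1.add hg.1)
      (fun x hx => (hf.hasFDerivAt hΩ hx).add (hg.hasFDerivAt hΩ hx)) (ih hf.2.2 hg.2.2)

lemma sum (hΩ : IsOpen Ω) {ι : Type} (s : Finset ι) {f : ι → E → F} {c : ι → ℝ}
    (hf : ∀ i ∈ s, HZBound r' r Ω k (f i) (c i)) :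
    HZBound r' r Ω k (fun x => ∑ i ∈ s, f i x) (∑ i ∈ s, c i) := by
  classical
  induction s using Finset.induction_on with
  | empty => simpa using const (r' := r') (r := r) (Ω := Ω) (k := k) (0 : F)
  | insert a s ha ih =>
    simp only [Finset.sum_insert ha]
    exact (hf a (by simp)).add hΩ (ih fun i hi => hf i (by simp [hi]))

lemma clm_comp (hΩ : IsOpen Ω) {F F₁ : Type} [NormedAddCommGroup F] [NormedSpace ℝ F]
    [NormedAddCommGroup F₁] [NormedSpace ℝ F₁] {f : E → F} (hf : HZBound r' r Ω k f C)
    (B : F →L[ℝ] F₁) {b : ℝ} (hB : ‖B‖ ≤ b) :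
    HZBound r' r Ω k (fun x => B (f x)) (b * C) := by
  have hC := hf.nonneg
  induction k generalizing F F₁ with
  | zero => exact (ZygBound.clm_comp hf B).mono (by gcongr)
  | succ k ih =>
    refine of_hasFDerivAt hΩ ((hf.1.clm_comp B).mono (by gcongr))
      (fun x hx => B.hasFDerivAt.comp x (hf.hasFDerivAt hΩ hx)) ?_
    refine ih (F₁ := E →L[ℝ] F₁) hf.2.2 (ContinuousLinearMap.compL ℝ E F F₁ B) ?_
    refine (ContinuousLinearMap.le_opNorm _ _).trans ?_
    have := ContinuousLinearMap.norm_compL_le ℝ E F F₁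
    have := B.opNorm_nonneg
    nlinarith

/-- Each derivative contributes one factor of the linear part and the Hölder or midpoint quotient of
top order one more, whence the exponent k + 1. -/
lemma comp_affine (he : ZygExp r' r) (hΩ : IsOpen Ω) {F : Type} [NormedAddCommGroup F]
    [NormedSpace ℝ F] {f : E → F}
    (hf : HZBound r' r Ω k f C) (L : E' →L[ℝ] E) (x₀ : E)
    {Λ : ℝ} (hΛ : 1 ≤ Λ) (hL : ‖L‖ ≤ Λ) {O : Set E'} (hOo : IsOpen O)
    (hO : ∀ x ∈ O, x₀ + L x ∈ Ω) :
    HZBound r' r O k (fun x => f (x₀ + L x)) (C * Λ ^ (k + 1)) := by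
  have hC := hf.nonneg
  induction k generalizing F with
  | zero => rw [zero_add, pow_one]; exact ZygBound.comp_affine he hf L x₀ hΛ hL hO
  | succ k ih =>
    refine of_hasFDerivAt hOo ((hf.1.comp_affine he L x₀ hΛ hL hO).mono ?_)
      (fun x hx => (hf.hasFDerivAt hΩ (hO x hx)).comp x (L.hasFDerivAt.const_add x₀)) ?_
    · gcongr
      exact le_self_pow₀ hΛ (by omega)
    · have h1 := (ih hf.2.2).clm_comp hOo
        ((ContinuousLinearMap.compL ℝ E' E F).flip L) (b := Λ) ?_
      · exact h1.mono (by rw [pow_succ _ (k + 1)]; exact le_of_eq (by ring))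
      · refine (ContinuousLinearMap.opNorm_le_bound _ (by linarith) fun x => ?_)
        rw [ContinuousLinearMap.flip_apply, ContinuousLinearMap.compL_apply]
        refine (ContinuousLinearMap.opNorm_comp_le _ _).trans ?_
        rw [mul_comm]
        gcongr

/-- The derivative is a sum of two bilinear expressions of order k, so every order doubles the
constant. General bilinear maps are needed because the derivative involves `precompR` and `precompL`
in place of B. -/
lemma bilin (he : ZygExp r' r) (hΩ : IsOpen Ω) {F₁ F₂ F₃ : Type}
    [NormedAddCommGroup F₁] [NormedSpace ℝ F₁]
    [NormedAddCommGroup F₂] [NormedSpace ℝ F₂] [NormedAddCommGroup F₃] [NormedSpace ℝ F₃]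
    (B : F₁ →L[ℝ] F₂ →L[ℝ] F₃) {b : ℝ} (hB : ‖B‖ ≤ b)
    {f : E → F₁} {g : E → F₂} (hf : HZBound r' r Ω k f C) (hg : HZBound r' r Ω k g D) :
    HZBound r' r Ω k (fun x => B (f x) (g x)) (4 * 2 ^ k * (b * C * D)) := by
  have hC := hf.nonneg
  have hD := hg.nonneg
  have hb : 0 ≤ b := B.opNorm_nonneg.trans hB
  induction k generalizing F₁ F₂ F₃ with
  | zero => rw [pow_zero, mul_one]; exact ZygBound.bilin he B hB hf hg
  | succ k ih =>
    refine of_hasFDerivAt hΩ ((hf.1.bilin he B hB hg.1).mono ?_)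
      (fun x hx => B.hasFDerivAt_of_bilinear (hf.hasFDerivAt hΩ hx) (hg.hasFDerivAt hΩ hx)) ?_
    · have : (1 : ℝ) ≤ 2 ^ (k + 1) := one_le_pow₀ (by norm_num)
      have h0 : 0 ≤ b * C * D := by positivity
      nlinarith
    · have h1 := ih (B.precompR E) ((ContinuousLinearMap.norm_precompR_le E B).trans hB)
        hf.of_succ hg.2.2
      have h2 := ih (B.precompL E) ((ContinuousLinearMap.norm_precompL_le E B).trans hB)
        hf.2.2 hg.of_succ
      exact (h1.add hΩ h2).mono (le_of_eq (by rw [pow_succ]; ring))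

lemma smul (he : ZygExp r' r) (hΩ : IsOpen Ω) [NormedSpace ℂ F] {f : E → ℂ} {g : E → F}
    (hf : HZBound r' r Ω k f C) (hg : HZBound r' r Ω k g D) [IsScalarTower ℝ ℂ F] :
    HZBound r' r Ω k (fun x => f x • g x) (4 * 2 ^ k * (C * D)) := by
  have := hf.bilin he hΩ (ContinuousLinearMap.lsmul ℝ ℂ)
    (ContinuousLinearMap.opNorm_lsmul_le (𝕜 := ℝ) (R := ℂ) (E := F)) hg
  simpa using this

lemma mul (he : ZygExp r' r) (hΩ : IsOpen Ω) {f g : E → ℂ}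
    (hf : HZBound r' r Ω k f C) (hg : HZBound r' r Ω k g D) :
    HZBound r' r Ω k (fun x => f x * g x) (4 * 2 ^ k * (C * D)) :=
  hf.smul he hΩ hg

/-- The derivative of 1/f is -(1/f)² Df, which involves 1/f only to the lower order. -/
lemma inv (he : ZygExp r' r) (hΩ : IsOpen Ω) {f : E → ℂ} (hf : HZBound r' r Ω k f C) {c : ℝ}
    (hc : 0 < c) (hfc : ∀ x ∈ Ω, c ≤ ‖f x‖) :
    ∃ D, HZBound r' r Ω k (fun x => (f x)⁻¹) D := by
  induction k with
  | zero => exact ZygBound.inv he hf hc hfc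
  | succ k ih =>
    obtain ⟨D, hD⟩ := ih hf.of_succ
    obtain ⟨D', hD'⟩ := hf.1.inv he hc hfc
    have h1 := (((const (-1 : ℂ)).mul he hΩ (hD.mul he hΩ hD)).smul he hΩ hf.2.2)
    refine ⟨max D' _, of_hasFDerivAt hΩ (hD'.mono (le_max_left _ _)) (fun x hx => ?_)
      (h1.mono (le_max_right _ _))⟩
    have hne : f x ≠ 0 := fun h0 => by
      have := hfc x hx; rw [h0, norm_zero] at this; linarith
    have h2 := ((hasFDerivAt_inv hne).restrictScalars ℝ).comp x (hf.hasFDerivAt hΩ hx)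
    refine h2.congr_fderiv ?_
    ext v
    simp
    ring

lemma of_contDiff_lipschitz (he : ZygExp r' r) (hΩ : IsOpen Ω) (hc : Convex ℝ Ω) {F : Type}
    [NormedAddCommGroup F] [NormedSpace ℝ F] {f : E → F} (hC : 0 ≤ C)
    (hd : DifferentiableOn ℝ f Ω)
    (h0 : ∀ x ∈ Ω, ‖f x‖ ≤ C) (h1 : ∀ x ∈ Ω, ‖fderiv ℝ f x‖ ≤ C) :
    ZygBound r' r Ω f (2 * C) := by
  refine ZygBound.of_lipschitz he hC h0 fun x hx y hy => ?_
  exact hc.norm_image_sub_le_of_norm_fderiv_le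
    (fun z hz => (hd z hz).differentiableAt (hΩ.mem_nhds hz)) h1 hy hx

/-- One summable majorant serves the terms and all their derivatives. Connectedness is used to
differentiate term by term. -/
lemma tsum (hΩ : IsOpen Ω) (hc : IsPreconnected Ω) {ι : Type} {F : Type}
    [NormedAddCommGroup F] [NormedSpace ℝ F] [CompleteSpace F] {f : ι → E → F} {c : ι → ℝ}
    (hf : ∀ i, HZBound r' r Ω k (f i) (c i)) (hs : Summable c) :
    HZBound r' r Ω k (fun x => ∑' i, f i x) (∑' i, c i) := by
  induction k generalizing F with
  | zero => exact ZygBound.tsum hf hs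
  | succ k ih =>
    refine of_hasFDerivAt hΩ (ZygBound.tsum (fun i => (hf i).1) hs) (fun x hx => ?_)
      (ih fun i => (hf i).2.2)
    exact hasFDerivAt_tsum_of_isPreconnected hs hΩ hc (fun i y hy => (hf i).hasFDerivAt hΩ hy)
      (fun i y hy => (hf i).2.2.zyg.norm_le y hy) hx
      (Summable.of_norm_bounded hs fun i => (hf i).zyg.norm_le x hx) hx

lemma intervalIntegral {X S : Type} [NormedAddCommGroup X] [NormedSpace ℝ X]
    [NormedAddCommGroup S] [NormedSpace ℝ S] (h : ZygExp r' r) {U : Set X} {V : Set S}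
    (hU : IsOpen U) (hV : IsOpen V) {γ : ℝ → X} (hγ : Continuous γ) (hγU : ∀ t, γ t ∈ U) {W : ℝ}
    {F F₁ : Type} [NormedAddCommGroup F] [NormedSpace ℝ F]
    [NormedAddCommGroup F₁] [NormedSpace ℝ F₁] {B : ℝ → F →L[ℝ] F₁}
    (hB : Continuous B) (hBW : ∀ t, ‖B t‖ ≤ W) {f : X × S → F}
    (hf : HZBound r' r (U ×ˢ V) k f C) :
    HZBound r' r V k (fun s => ∫ t in (0 : ℝ)..2 * Real.pi, B t (f (γ t, s)))
      (2 * Real.pi * (W * C)) := by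
  have hW : 0 ≤ W := (B 0).opNorm_nonneg.trans (hBW 0)
  have hcont : ∀ {G H : Type} [NormedAddCommGroup G] [NormedSpace ℝ G] [NormedAddCommGroup H]
      [NormedSpace ℝ H] {A : ℝ → G →L[ℝ] H} {g : X × S → G}, Continuous A →
      ContinuousOn g (U ×ˢ V) → ∀ s ∈ V, Continuous fun t => A t (g (γ t, s)) := by
    intro G H _ _ _ _ A g hA hg s hs
    exact hA.clm_apply (hg.comp_continuous (by fun_prop) fun t => ⟨hγU t, hs⟩)
  induction k generalizing F F₁ with
  | zero => exact ZygBound.intervalIntegral h hγ hγU hB hBW hf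
  | succ k ih =>
    -- The weight for the derivative: it restricts a derivative on X × S to the S directions and
    -- then applies B t. Its norm is again at most W.
    let A : ℝ → ((X × S) →L[ℝ] F) →L[ℝ] (S →L[ℝ] F₁) := fun t =>
      (ContinuousLinearMap.compL ℝ S F F₁ (B t)).comp
        ((ContinuousLinearMap.compL ℝ S (X × S) F).flip (ContinuousLinearMap.inr ℝ X S))
    have hA : Continuous A := by fun_prop
    have hAW : ∀ t, ‖A t‖ ≤ W := fun t => by
      refine ContinuousLinearMap.opNorm_le_bound _ hW fun L => ?_
      refine (ContinuousLinearMap.opNorm_comp_le _ _).trans ?_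
      refine mul_le_mul (hBW t) ?_ (ContinuousLinearMap.opNorm_nonneg _) hW
      refine (ContinuousLinearMap.opNorm_comp_le _ _).trans ?_
      exact mul_le_of_le_one_right (norm_nonneg _) (ContinuousLinearMap.norm_inr_le_one ℝ X S)
    refine of_hasFDerivAt hV (ZygBound.intervalIntegral h hγ hγU hB hBW hf.1) (fun s hs => ?_)
      (ih hA hAW hf.2.2)
    refine intervalIntegral.hasFDerivAt_integral_of_dominated_of_fderiv_le
      (F := fun s t => B t (f (γ t, s))) (F' := fun s t => A t (fderiv ℝ f (γ t, s)))
      (bound := fun _ => W * C) (hV.mem_nhds hs) ?_ ?_ ?_ ?_ ?_ ?_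
    · filter_upwards [hV.mem_nhds hs] with y hy
      exact (hcont hB (hf.continuousOn h) y hy).aestronglyMeasurable
    · exact (hcont hB (hf.continuousOn h) s hs).intervalIntegrable _ _
    · exact (hcont hA (hf.2.2.continuousOn h) s hs).aestronglyMeasurable
    · refine .of_forall fun t _ y hy => ?_
      exact (A t).le_of_opNorm_le_of_le (hAW t) (hf.2.2.zyg.norm_le _ ⟨hγU t, hy⟩)
    · exact intervalIntegrable_const
    · refine .of_forall fun t _ y hy => ?_
      have h1 : HasFDerivAt f (fderiv ℝ f (γ t, y)) (γ t, y) :=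
        hf.hasFDerivAt (hU.prod hV) ⟨hγU t, hy⟩
      exact (B t).hasFDerivAt.comp y (h1.comp y (hasFDerivAt_prodMk_right (γ t) y))

/-- The hypothesis concerns the closed support because that condition is inherited by the
derivative. -/
lemma extend (h : ZygExp r' r) (hΩ : IsOpen Ω) {F : Type} [NormedAddCommGroup F]
    [NormedSpace ℝ F] {f : E → F} (hf : HZBound r' r Ω k f C) {δ : ℝ} (hδ : 0 < δ)
    (hδ1 : δ ≤ 1) (hK : ∀ x ∈ tsupport f, Metric.ball x δ ⊆ Ω) :
    HZBound r' r Set.univ k f (2 * C / δ) := by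
  induction k generalizing F with
  | zero => exact ZygBound.extend h hf hδ hδ1 fun x hx => hK x (subset_tsupport f hx)
  | succ k ih =>
    refine ⟨hf.1.extend h hδ hδ1 fun x hx => hK x (subset_tsupport f hx), fun x _ => ?_,
      ih hf.2.2 fun x hx => hK x (tsupport_fderiv_subset ℝ hx)⟩
    by_cases hx : x ∈ tsupport f
    · exact (hf.hasFDerivAt hΩ (hK x hx (Metric.mem_ball_self hδ))).differentiableAt.differentiableWithinAt
    · have : f =ᶠ[nhds x] fun _ => 0 := notMem_tsupport_iff_eventuallyEq.1 hx
      exact ((differentiableAt_const (0 : F)).congr_of_eventuallyEq this).differentiableWithinAt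

end HZBound

end HZ

end HolFrob

namespace HolFrob

/-! ### Trading one derivative for a factor ‖h‖ in a first difference. -/

section Shift

variable {E F : Type} [NormedAddCommGroup E] [NormedSpace ℝ E]
  [NormedAddCommGroup F] [NormedSpace ℝ F] {r' r : ℝ} {k : ℕ} {M : ℝ}

/-- Mean value inequality for t ↦ ∑ c_i f(p_i + t h). The coefficient vectors (1), (1, -1) and (1/2,
1/2, -1) turn the sup, Hölder and midpoint bounds of Df into those of f(· + h) - f. -/
lemma norm_shift_combination_le {ι : Type} (s : Finset ι) (c : ι → ℝ) (p : ι → E) {f : E → F}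
    (hf : Differentiable ℝ f) (h : E) {K : ℝ}
    (hK : ∀ z : E, ‖∑ i ∈ s, c i • fderiv ℝ f (p i + z)‖ ≤ K) :
    ‖∑ i ∈ s, c i • (f (p i + h) - f (p i))‖ ≤ K * ‖h‖ := by
  have hd : ∀ t : ℝ, HasDerivAt (fun t : ℝ => ∑ i ∈ s, c i • f (p i + t • h))
      (∑ i ∈ s, c i • fderiv ℝ f (p i + t • h) h) t := by
    intro t
    refine HasDerivAt.fun_sum fun i _ => HasDerivAt.const_smul _ ?_
    have h1 : HasDerivAt (fun t : ℝ => p i + t • h) h t := by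
      simpa using ((hasDerivAt_id t).smul_const h).const_add (p i)
    exact (hf _).hasFDerivAt.comp_hasDerivAt t h1
  have := norm_image_sub_le_of_norm_deriv_le_segment_01' (C := K * ‖h‖)
    (fun t _ => (hd t).hasDerivWithinAt) fun t _ => by
      have e : ∑ i ∈ s, c i • fderiv ℝ f (p i + t • h) h =
          (∑ i ∈ s, c i • fderiv ℝ f (p i + t • h)) h := by
        simp [sum_apply]
      rw [e]
      exact ContinuousLinearMap.le_of_opNorm_le _ (hK _) _
  simpa [smul_sub, Finset.sum_sub_distrib] using this

lemma ZygBound.shift_sub {f : E → F} (hd : Differentiable ℝ f)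
    (hf : ZygBound r' r Set.univ (fderiv ℝ f) M) (h : E) :
    ZygBound r' r Set.univ (fun x => f (x + h) - f x) (M * ‖h‖) := by
  have hM := hf.nonneg
  refine ⟨by positivity, fun x _ => ?_, fun x _ y _ => ?_, fun x _ y _ _ => ?_⟩
  · simpa using norm_shift_combination_le (Finset.univ : Finset (Fin 1)) ![1] ![x] hd h
      (K := M) fun z => by simpa using hf.norm_le _ trivial
  · have := norm_shift_combination_le (Finset.univ : Finset (Fin 2)) ![1, -1] ![x, y] hd h
      (K := M * ‖x - y‖ ^ r') fun z => by
        simpa [← sub_eq_add_neg] using hf.diff_le (x + z) trivial (y + z) trivial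
    simp only [Fin.sum_univ_two, Matrix.cons_val_zero, Matrix.cons_val_one, one_smul, neg_smul,
      ← sub_eq_add_neg] at this
    linarith
  · have := norm_shift_combination_le (Finset.univ : Finset (Fin 3)) ![2⁻¹, 2⁻¹, -1]
      ![x, y, (2⁻¹ : ℝ) • (x + y)] hd h (K := M * ‖x - y‖ ^ r) fun z => by
        have e : (2⁻¹ : ℝ) • (x + z + (y + z)) = (2⁻¹ : ℝ) • (x + y) + z := by module
        have := hf.mid_le (x + z) trivial (y + z) trivial trivial
        rw [e] at this
        simpa [Fin.sum_univ_three, ← sub_eq_add_neg, smul_add] using this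
    rw [Fin.sum_univ_three] at this
    change ‖(2⁻¹ : ℝ) • (f (x + h) - f x) + (2⁻¹ : ℝ) • (f (y + h) - f y) + (-1 : ℝ) •
      (f ((2⁻¹ : ℝ) • (x + y) + h) - f ((2⁻¹ : ℝ) • (x + y)))‖ ≤ _ at this
    refine le_trans (le_of_eq ?_) (this.trans (le_of_eq (by ring)))
    congr 1
    module

lemma HZBound.shift_sub {F : Type} [NormedAddCommGroup F] [NormedSpace ℝ F] {f : E → F}
    (hf : HZBound r' r Set.univ (k + 1) f M) (h : E) :
    HZBound r' r Set.univ k (fun x => f (x + h) - f x) (M * ‖h‖) := by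
  have hd : ∀ {F : Type} [NormedAddCommGroup F] [NormedSpace ℝ F] {f : E → F} {k : ℕ},
      HZBound r' r Set.univ (k + 1) f M → Differentiable ℝ f := fun hf x =>
    (hf.hasFDerivAt isOpen_univ (Set.mem_univ x)).differentiableAt
  induction k generalizing F with
  | zero => exact ZygBound.shift_sub (hd hf) hf.2.2 h
  | succ k ih =>
    refine of_hasFDerivAt isOpen_univ (ZygBound.shift_sub (hd hf) hf.2.2.zyg h) (fun x _ => ?_)
      (ih hf.2.2)
    have h1 : HasFDerivAt (fun x => f (x + h)) (fderiv ℝ f (x + h)) x :=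
      (hasFDerivAt_comp_add_right h).2 ((hd hf) (x + h)).hasFDerivAt
    exact h1.sub ((hd hf) x).hasFDerivAt

end Shift

/-! ### Kernels with Fourier transform vanishing near the origin, as second differences. -/

section Decay

open MeasureTheory

variable {E : Type} [NormedAddCommGroup E] [InnerProductSpace ℝ E] [FiniteDimensional ℝ E]
  [MeasurableSpace E] [BorelSpace E]
  {F : Type} [NormedAddCommGroup F] [NormedSpace ℝ F] [NormedSpace ℂ F]
  [IsScalarTower ℝ ℂ F] {r' r : ℝ}

lemma integral_add_sub_smul {G : Type} [NormedAddCommGroup G] [NormedSpace ℝ G]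
    [NormedSpace ℂ G] [IsScalarTower ℝ ℂ G] {f g h : E → G}
    (hf : Integrable f) (hg : Integrable g) (hh : Integrable h) (c : ℂ) :
    ∫ y, (f y + g y - c • h y) = (∫ y, f y) + (∫ y, g y) - c • ∫ y, h y := by
  have h1 : Integrable fun y => f y + g y := hf.add hg
  have h2 : Integrable fun y => c • h y := hh.smul c
  have := IsScalarTower.to_smulCommClass (R := ℝ) (A := ℂ) (M := G)
  rw [integral_sub h1 h2, integral_add hf hg, integral_smul]

/-- A Schwartz function whose Fourier transform vanishes near the origin and off a compact set is
a sum of symmetric second differences of a function of the same type. -/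
lemma exists_second_difference (Θ : 𝓢(E, ℂ)) {b : ℝ} (hb : 0 < b)
    (hΘ : tsupport (𝓕 (Θ : E → ℂ)) ⊆ Metric.ball 0 b \ {0}) :
    ∃ Λ : 𝓢(E, ℂ), tsupport (𝓕 (Λ : E → ℂ)) ⊆ Metric.ball 0 b \ {0} ∧
      ∀ y, Θ y = ∑ i, (Λ (y + b⁻¹ • stdOrthonormalBasis ℝ E i) +
        Λ (y - b⁻¹ • stdOrthonormalBasis ℝ E i) - 2 * Λ y) := by
  set e := stdOrthonormalBasis ℝ E
  -- The Fourier multiplier of the sum of second differences with steps e_i / b.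
  let m : E → ℝ := fun ξ => ∑ i, (2 * Real.cos (2 * Real.pi * inner ℝ ξ (b⁻¹ • e i)) - 2)
  have hm : ContDiff ℝ ∞ m := by
    refine ContDiff.sum fun i _ => ?_
    have : ContDiff ℝ ∞ fun ξ : E => inner ℝ ξ (b⁻¹ • e i) := contDiff_id.inner ℝ contDiff_const
    fun_prop
  -- On the ball of radius b the inner products with e_i / b have modulus below 1, so a cosine
  -- equals 1 only where its inner product vanishes. All of them vanish only at the origin, hence m
  -- < 0 elsewhere.
  have hm0 : ∀ ξ ∈ Metric.ball (0 : E) b \ {0}, m ξ ≠ 0 := by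
    rintro ξ ⟨hξ, hξ0⟩
    refine (Finset.sum_neg' (fun i _ => ?_) ?_).ne
    · linarith [Real.cos_le_one (2 * Real.pi * inner ℝ ξ (b⁻¹ • e i))]
    · obtain ⟨i, hi⟩ : ∃ i, inner ℝ ξ (e i) ≠ 0 := by
        by_contra! hcon
        refine hξ0 (e.repr.injective ?_)
        ext i
        rw [e.repr_apply_apply, real_inner_comm, hcon]
        simp
      refine ⟨i, Finset.mem_univ _, ?_⟩
      have h1 : |inner ℝ ξ (b⁻¹ • e i)| < 1 := by
        refine (abs_real_inner_le_norm _ _).trans_lt ?_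
        rw [norm_smul, e.orthonormal.1 i, mul_one, norm_inv, Real.norm_of_nonneg hb.le]
        rw [mem_ball_zero_iff] at hξ
        rw [← div_eq_mul_inv, div_lt_one hb]; exact hξ
      have h2 : inner ℝ ξ (b⁻¹ • e i) ≠ 0 := by
        rw [inner_smul_right]; exact mul_ne_zero (inv_ne_zero hb.ne') hi
      have h3 : Real.cos (2 * Real.pi * inner ℝ ξ (b⁻¹ • e i)) ≠ 1 := by
        intro h
        rw [abs_lt] at h1
        have hp := Real.pi_pos
        exact h2 (by
          have := (Real.cos_eq_one_iff_of_lt_of_lt (by nlinarith) (by nlinarith)).1 h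
          simpa [hp.ne'] using this)
      have := lt_of_le_of_ne (Real.cos_le_one _) h3
      linarith
  -- The Fourier transform of the required Λ. The quotient is smooth because m has no zero on the
  -- support of the Fourier transform of Θ.
  let X₀ : E → ℂ := fun ξ => 𝓕 (Θ : E → ℂ) ξ * ((m ξ)⁻¹ : ℝ)
  have hts : tsupport X₀ ⊆ tsupport (𝓕 (Θ : E → ℂ)) :=
    tsupport_mul_subset_left
  have hcs : HasCompactSupport X₀ :=
    HasCompactSupport.of_support_subset_isCompact (K := tsupport X₀)
      (Metric.isCompact_of_isClosed_isBounded (isClosed_tsupport _)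
        (Metric.isBounded_ball.subset ((hts.trans hΘ).trans Set.sdiff_subset)))
      (subset_tsupport _)
  have hFs : ContDiff ℝ ∞ (𝓕 (Θ : E → ℂ)) := by
    rw [← SchwartzMap.fourier_coe]; exact (𝓕 Θ).smooth ⊤
  have hsm : ContDiff ℝ ∞ X₀ := by
    rw [contDiff_iff_contDiffAt]
    intro ξ
    by_cases hξ : ξ ∈ tsupport (𝓕 (Θ : E → ℂ))
    · exact hFs.contDiffAt.mul
        (Complex.ofRealCLM.contDiff.contDiffAt.comp ξ (hm.contDiffAt.inv (hm0 ξ (hΘ hξ))))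
    · have : X₀ =ᶠ[nhds ξ] fun _ => 0 := by
        filter_upwards [notMem_tsupport_iff_eventuallyEq.1 hξ] with z hz
        simp only [X₀, hz, Pi.zero_apply, zero_mul]
      exact contDiffAt_const.congr_of_eventuallyEq this
  let X : 𝓢(E, ℂ) := hcs.toSchwartzMap hsm
  have hX : ∀ ξ, X ξ = X₀ ξ := fun _ => rfl
  refine ⟨𝓕⁻ X, ?_, ?_⟩
  · rw [← SchwartzMap.fourier_coe, FourierTransform.fourier_fourierInv_eq]
    exact hts.trans hΘ
  · have hmul : ∀ ξ, 𝓕 (Θ : E → ℂ) ξ = m ξ * X ξ := by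
      intro ξ
      rw [hX]
      by_cases hξ : ξ ∈ tsupport (𝓕 (Θ : E → ℂ))
      · have := hm0 ξ (hΘ hξ)
        simp only [X₀]
        have : (m ξ : ℂ) ≠ 0 := by exact_mod_cast this
        push_cast
        field_simp
      · simp only [X₀, image_eq_zero_of_notMem_tsupport hξ, zero_mul, mul_zero]
    have hint : ∀ y : E, Integrable fun ξ =>
        Complex.exp ((2 * Real.pi * inner ℝ ξ y : ℝ) * Complex.I) • X ξ := by
      intro y
      refine Integrable.bdd_smul (𝕜 := ℂ) X.integrable 1 ?_ (.of_forall fun ξ => ?_)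
      · exact (by fun_prop : Continuous fun ξ : E =>
          Complex.exp ((2 * Real.pi * inner ℝ ξ y : ℝ) * Complex.I)).aestronglyMeasurable
      · rw [Complex.norm_exp_ofReal_mul_I]
    have hL : ∀ y, (𝓕⁻ X : 𝓢(E, ℂ)) y =
        ∫ ξ, Complex.exp ((2 * Real.pi * inner ℝ ξ y : ℝ) * Complex.I) • X ξ := by
      intro y
      rw [SchwartzMap.fourierInv_coe, Real.fourierInv_eq']
    intro y
    have h1 : Θ y = ∫ ξ, Complex.exp ((2 * Real.pi * inner ℝ ξ y : ℝ) * Complex.I) •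
        (m ξ * X ξ) := by
      have : Θ y = (𝓕⁻ (𝓕 Θ) : 𝓢(E, ℂ)) y := by rw [FourierTransform.fourierInv_fourier_eq]
      rw [this, SchwartzMap.fourierInv_coe, Real.fourierInv_eq']
      refine integral_congr_ae (.of_forall fun ξ => ?_)
      simp only
      rw [SchwartzMap.fourier_coe, hmul]
    rw [h1]
    simp only [hL]
    have h2 : ∀ i, (∫ ξ, Complex.exp ((2 * Real.pi * inner ℝ ξ (y + b⁻¹ • e i) : ℝ) *
          Complex.I) • X ξ) + (∫ ξ, Complex.exp ((2 * Real.pi * inner ℝ ξ (y - b⁻¹ • e i) : ℝ) *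
          Complex.I) • X ξ) - 2 * ∫ ξ, Complex.exp ((2 * Real.pi * inner ℝ ξ y : ℝ) *
          Complex.I) • X ξ =
        ∫ ξ, (Complex.exp ((2 * Real.pi * inner ℝ ξ (y + b⁻¹ • e i) : ℝ) * Complex.I) • X ξ +
          Complex.exp ((2 * Real.pi * inner ℝ ξ (y - b⁻¹ • e i) : ℝ) * Complex.I) • X ξ -
          2 * Complex.exp ((2 * Real.pi * inner ℝ ξ y : ℝ) * Complex.I) • X ξ) := by
      intro i
      exact (integral_add_sub_smul (hint _) (hint _) (hint y) 2).symm
    simp only [h2]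
    rw [← integral_finsetSum]
    · refine integral_congr_ae (.of_forall fun ξ => ?_)
      simp only [smul_eq_mul, m]
      push_cast
      rw [Finset.sum_mul, Finset.mul_sum]
      refine Finset.sum_congr rfl fun i _ => ?_
      rw [Complex.two_cos, inner_add_right, inner_sub_right]
      push_cast
      simp only [mul_add, mul_sub, add_mul, sub_mul, Complex.exp_add, Complex.exp_sub, neg_mul,
        Complex.exp_neg]
      ring
    · exact fun i _ => ((hint _).add (hint _)).sub ((hint y).const_mul 2)

lemma norm_integral_schwartz_smul_le (Λ : 𝓢(E, ℂ)) {g : E → F} {c : ℝ} (hg : ∀ y, ‖g y‖ ≤ c) :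
    ‖∫ y, Λ y • g y‖ ≤ c * ∫ y, ‖Λ y‖ := by
  rw [← integral_const_mul]
  refine norm_integral_le_of_norm_le (Λ.integrable.norm.const_mul c) (.of_forall fun y => ?_)
  rw [norm_smul, mul_comm]
  gcongr
  exact hg y

lemma integrable_schwartz_smul (Λ : 𝓢(E, ℂ)) {g : E → F} (hgc : Continuous g) {c : ℝ}
    (hg : ∀ y, ‖g y‖ ≤ c) : Integrable fun y => Λ y • g y :=
  Λ.integrable.smul_bdd c hgc.aestronglyMeasurable (.of_forall hg)

/-- Translation invariance moves the second difference from the kernel to the function, where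
regularity can be used. -/
lemma integral_second_difference (Λ : 𝓢(E, ℂ)) {g : E → F} (hgc : Continuous g) {c : ℝ}
    (hg : ∀ y, ‖g y‖ ≤ c) (h : E) :
    ∫ y, (Λ (y + h) + Λ (y - h) - 2 * Λ y) • g y =
      ∫ y, Λ y • (g (y - h) + g (y + h) - (2 : ℝ) • g y) := by
  have i0 := integrable_schwartz_smul Λ hgc hg
  have i1 := integrable_schwartz_smul Λ (g := fun y => g (y - h)) (by fun_prop) fun y => hg _
  have i2 := integrable_schwartz_smul Λ (g := fun y => g (y + h)) (by fun_prop) fun y => hg _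
  have j1 : Integrable fun y => Λ (y + h) • g y := by
    simpa using i1.comp_add_right h
  have j2 : Integrable fun y => Λ (y - h) • g y := by
    simpa using i2.comp_sub_right h
  have e1 : ∫ y, Λ (y + h) • g y = ∫ y, Λ y • g (y - h) := by
    simpa using integral_add_right_eq_self (μ := volume) (fun y => Λ y • g (y - h)) h
  have e2 : ∫ y, Λ (y - h) • g y = ∫ y, Λ y • g (y + h) := by
    simpa using integral_sub_right_eq_self (μ := volume) (fun y => Λ y • g (y + h)) h
  have l : ∀ y, (Λ (y + h) + Λ (y - h) - 2 * Λ y) • g y =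
      Λ (y + h) • g y + Λ (y - h) • g y - (2 : ℂ) • (Λ y • g y) := fun y => by module
  have l' : ∀ y, Λ y • (g (y - h) + g (y + h) - (2 : ℝ) • g y) =
      Λ y • g (y - h) + Λ y • g (y + h) - (2 : ℂ) • (Λ y • g y) := fun y => by
    rw [two_smul]; module
  simp only [l, l']
  rw [integral_add_sub_smul j1 j2 i0, integral_add_sub_smul i1 i2 i0, e1, e2]

end Decay

end HolFrob

namespace HolFrob

/-! ### Decay of the dyadic blocks of a function of order k + r. -/

section Decay

open MeasureTheory

variable {E : Type} [NormedAddCommGroup E] [InnerProductSpace ℝ E] [FiniteDimensional ℝ E]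
  [MeasurableSpace E] [BorelSpace E]
  (F : Type) [NormedAddCommGroup F] [NormedSpace ℝ F] [NormedSpace ℂ F]
  [IsScalarTower ℝ ℂ F] {r' r : ℝ}

/-- By induction on k. Writing Θ through second differences puts a second difference of step ε / b
on f. For k = 0 the midpoint bound gives ε^r. For larger k the second difference is a difference of
two values of the convolution of Λ with f(· + q) - f. This function has one order less and a bound
proportional to ε (`HZBound.shift_sub`), and Λ is a kernel of the same type. -/
lemma exists_decay_bound (he : ZygExp r' r) {b : ℝ} (hb : 0 < b) (k : ℕ) (Θ : 𝓢(E, ℂ))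
    (hΘ : tsupport (𝓕 (Θ : E → ℂ)) ⊆ Metric.ball 0 b \ {0}) :
    ∃ K : ℝ, 0 ≤ K ∧ ∀ (f : E → F) (M : ℝ), HZBound r' r Set.univ k f M → ∀ ε : ℝ, 0 < ε →
      ∀ x, ‖∫ y, Θ y • f (x - ε • y)‖ ≤ K * M * ε ^ ((k : ℝ) + r) := by
  have hbi : 0 < b⁻¹ := inv_pos.2 hb
  set e := stdOrthonormalBasis ℝ E with he_def
  have hh : ∀ i, ‖b⁻¹ • e i‖ = b⁻¹ := fun i => by
    rw [norm_smul, e.orthonormal.1 i, mul_one, Real.norm_of_nonneg hbi.le]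
  have key : ∀ (Θ Λ : 𝓢(E, ℂ)) (_ : ∀ y, Θ y = ∑ i, (Λ (y + b⁻¹ • e i) + Λ (y - b⁻¹ • e i) -
        2 * Λ y)) (f : E → F) (M : ℝ) (_ : ZygBound r' r Set.univ f M) (ε : ℝ) (x : E) (c : ℝ),
      (∀ i, ‖∫ y, Λ y • (f (x - ε • y + ε • b⁻¹ • e i) + f (x - ε • y - ε • b⁻¹ • e i) -
        (2 : ℝ) • f (x - ε • y))‖ ≤ c) →
      ‖∫ y, Θ y • f (x - ε • y)‖ ≤ Module.finrank ℝ E * c := by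
    intro Θ Λ hΘΛ f M hf ε x c hc
    have hfc : Continuous f := continuousOn_univ.1 (hf.continuousOn he)
    have hgc : Continuous fun y => f (x - ε • y) := by fun_prop
    have hgb : ∀ y, ‖f (x - ε • y)‖ ≤ M := fun y => hf.norm_le _ trivial
    have hi : ∀ i, Integrable fun y =>
        (Λ (y + b⁻¹ • e i) + Λ (y - b⁻¹ • e i) - 2 * Λ y) • f (x - ε • y) := by
      intro i
      have h1 := integrable_schwartz_smul Λ hgc hgb
      have i1 := (Λ.integrable (μ := volume)).comp_add_right (b⁻¹ • e i)
      have i2 := (Λ.integrable (μ := volume)).comp_sub_right (b⁻¹ • e i)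
      exact ((i1.add i2).sub (Λ.integrable.const_mul 2)).smul_bdd M hgc.aestronglyMeasurable
        (.of_forall hgb)
    have h2 : ∫ y, Θ y • f (x - ε • y) = ∑ i, ∫ y, Λ y •
        (f (x - ε • y + ε • b⁻¹ • e i) + f (x - ε • y - ε • b⁻¹ • e i) -
          (2 : ℝ) • f (x - ε • y)) := by
      simp only [hΘΛ, Finset.sum_smul]
      rw [integral_finsetSum _ fun i _ => hi i]
      refine Finset.sum_congr rfl fun i _ => ?_
      rw [integral_second_difference Λ hgc hgb]
      have a1 : ∀ y, x - ε • (y - b⁻¹ • e i) = x - ε • y + ε • b⁻¹ • e i := fun y => by module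
      have a2 : ∀ y, x - ε • (y + b⁻¹ • e i) = x - ε • y - ε • b⁻¹ • e i := fun y => by module
      simp only [a1, a2]
    rw [h2]
    refine (norm_sum_le _ _).trans ((Finset.sum_le_sum fun i _ => hc i).trans ?_)
    simp
  induction k generalizing Θ with
  | zero =>
    obtain ⟨Λ, -, hΘΛ⟩ := exists_second_difference Θ hb hΘ
    refine ⟨Module.finrank ℝ E * (2 * (2 * b⁻¹) ^ r * ∫ y, ‖Λ y‖), ?_, ?_⟩
    · have : 0 ≤ ∫ y, ‖Λ y‖ := integral_nonneg fun _ => norm_nonneg _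
      positivity
    · intro f M hf ε hε x
      refine (key Θ Λ hΘΛ f M hf ε x (2 * M * (ε * (2 * b⁻¹)) ^ r * ∫ y, ‖Λ y‖) fun i => ?_).trans ?_
      · refine norm_integral_schwartz_smul_le Λ fun y => ?_
        set p := x - ε • y
        set q := ε • b⁻¹ • e i
        have hm : (2⁻¹ : ℝ) • (p + q + (p - q)) = p := by module
        have h1 := hf.mid_le (p + q) trivial (p - q) trivial trivial
        rw [hm] at h1
        have h2 : f (p + q) + f (p - q) - (2 : ℝ) • f p =
            (2 : ℝ) • ((2⁻¹ : ℝ) • (f (p + q) + f (p - q)) - f p) := by module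
        have h3 : ‖p + q - (p - q)‖ = ε * (2 * b⁻¹) := by
          have : p + q - (p - q) = (2 * ε) • (b⁻¹ • e i) := by simp only [q]; module
          rw [this, norm_smul, hh, Real.norm_of_nonneg (by positivity)]
          ring
        rw [h2, norm_smul, Real.norm_of_nonneg (by norm_num), mul_assoc]
        rw [h3] at h1
        gcongr
      · rw [Real.mul_rpow hε.le (by positivity)]
        simp only [Nat.cast_zero, zero_add]
        exact le_of_eq (by ring)
  | succ k ih =>
    obtain ⟨Λ, hΛ, hΘΛ⟩ := exists_second_difference Θ hb hΘ
    obtain ⟨K, hK0, hK⟩ := ih Λ hΛ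
    refine ⟨Module.finrank ℝ E * (2 * K * b⁻¹), by positivity, fun f M hf ε hε x => ?_⟩
    refine (key Θ Λ hΘΛ f M hf.zyg ε x (2 * (K * (M * (ε * b⁻¹)) * ε ^ ((k : ℝ) + r)))
      fun i => ?_).trans ?_
    · set q := ε • b⁻¹ • e i with hq
      have hqn : ‖q‖ = ε * b⁻¹ := by
        rw [hq, norm_smul, hh, Real.norm_of_nonneg hε.le]
      have hg := hf.shift_sub q
      rw [hqn] at hg
      have h1 := hK _ _ hg ε hε x
      have h2 := hK _ _ hg ε hε (x - q)
      have hgc : Continuous fun z => f (z + q) - f z := continuousOn_univ.1 (hg.continuousOn he)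
      have hi : ∀ x, Integrable fun y => Λ y • (f (x - ε • y + q) - f (x - ε • y)) := fun x =>
        integrable_schwartz_smul Λ (g := fun y => f (x - ε • y + q) - f (x - ε • y))
          (hgc.comp (by fun_prop : Continuous fun y => x - ε • y))
          fun y => hg.zyg.norm_le _ trivial
      -- The second difference of f is the first difference f(· + q) - f at a point minus the same
      -- at its translate by -q.
      have h3 : ∫ y, Λ y • (f (x - ε • y + q) + f (x - ε • y - q) - (2 : ℝ) • f (x - ε • y)) =
          (∫ y, Λ y • (f (x - ε • y + q) - f (x - ε • y))) -
          ∫ y, Λ y • (f (x - q - ε • y + q) - f (x - q - ε • y)) := by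
        rw [← integral_sub (hi x) (hi (x - q))]
        refine integral_congr_ae (.of_forall fun y => ?_)
        have a1 : x - q - ε • y + q = x - ε • y := by module
        have a2 : x - q - ε • y = x - ε • y - q := by module
        simp only [a1]
        simp only [a2]
        module
      rw [h3, two_mul]
      exact norm_sub_le_of_le h1 h2
    · have : ε ^ (((k + 1 : ℕ) : ℝ) + r) = ε * ε ^ ((k : ℝ) + r) := by
        rw [show ((k + 1 : ℕ) : ℝ) + r = 1 + ((k : ℝ) + r) by push_cast; ring,
          Real.rpow_add hε, Real.rpow_one]
      rw [this]
      exact le_of_eq (by ring)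

/-- The dyadic pieces of a function with `HZBound` of order `k + r` decay like `2 ^ (-j (k + r))`. -/
theorem exists_dyadic_bound (he : ZygExp r' r) (k : ℕ) {φ : ℕ → 𝓢(E, ℝ)}
    (hφ : IsDyadicResolution φ) :
    ∃ K : ℝ, 0 ≤ K ∧ ∀ (f : E → F) (M : ℝ), HZBound r' r Set.univ k f M → ∀ (j : ℕ) (x : E),
      (2 : ℝ) ^ (j * ((k : ℝ) + r)) * ‖∫ t, φ j (x - t) • f t‖ ≤ K * M := by
  set β := (k : ℝ) + r with hβ
  let C : 𝓢(E, ℝ) → 𝓢(E, ℂ) := fun ψ => SchwartzMap.postcompCLM (𝕜 := ℝ) Complex.ofRealCLM ψ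
  have hC : ∀ ψ x, C ψ x = (ψ x : ℂ) := fun _ _ => rfl
  have hCs : ∀ (ψ : 𝓢(E, ℝ)) (x : E) (v : F), C ψ x • v = ψ x • v := fun ψ x v => by
    rw [hC]; exact (algebraMap_smul ℂ (ψ x) v)
  let q := Module.finrank ℝ E
  have hφ1 : ∀ x, φ 1 x = 2 ^ q * φ 0 ((2 : ℝ) • x) - φ 0 x := fun x => by
    simpa using hφ.dilate 0 x
  -- The dilation rule in Fourier space: the transform of φ₁ at ξ is that of φ₀ at ξ/2 minus that of
  -- φ₀ at ξ.
  have hF : ∀ ξ, 𝓕 (C (φ 1) : E → ℂ) ξ = 𝓕 (C (φ 0) : E → ℂ) ((2⁻¹ : ℝ) • ξ) -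
      𝓕 (C (φ 0) : E → ℂ) ξ := by
    intro ξ
    simp only [Real.fourier_eq']
    have hint : ∀ ξ : E, Integrable fun v =>
        Complex.exp ((-2 * Real.pi * inner ℝ v ξ : ℝ) * Complex.I) • C (φ 0) v := by
      intro ξ
      refine Integrable.bdd_smul (𝕜 := ℂ) (C (φ 0)).integrable 1 ?_ (.of_forall fun v => ?_)
      · exact (by fun_prop : Continuous fun v : E =>
          Complex.exp ((-2 * Real.pi * inner ℝ v ξ : ℝ) * Complex.I)).aestronglyMeasurable
      · rw [Complex.norm_exp_ofReal_mul_I]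
    have h1 := Measure.integral_comp_smul (volume : Measure E) (fun v =>
      Complex.exp ((-2 * Real.pi * inner ℝ v ((2⁻¹ : ℝ) • ξ) : ℝ) * Complex.I) • C (φ 0) v) 2
    have h2 : ∀ v : E, inner ℝ ((2 : ℝ) • v) ((2⁻¹ : ℝ) • ξ) = inner ℝ v ξ := fun v => by
      rw [inner_smul_left, inner_smul_right]; simp
    simp only [h2] at h1
    rw [abs_of_pos (by positivity), eq_inv_smul_iff₀ (by positivity)] at h1
    rw [← h1, ← integral_smul, ← integral_sub (((hint ((2⁻¹ : ℝ) • ξ)).comp_smul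
      (two_ne_zero)).smul ((2 : ℝ) ^ q) |>.congr (.of_forall fun v => by simp [h2, q])) (hint ξ)]
    refine integral_congr_ae (.of_forall fun v => ?_)
    simp only [hC, hφ1, Complex.real_smul, smul_eq_mul]
    push_cast
    ring
  -- Any radius above 4 would do: both terms vanish for ‖ξ‖ ≥ 4. Near the origin both are equal to 1
  -- and cancel.
  have hsupp : tsupport (𝓕 (C (φ 1) : E → ℂ)) ⊆ Metric.ball 0 5 \ {0} := by
    have h0 : ∀ ξ : E, 2 ≤ ‖ξ‖ → 𝓕 (C (φ 0) : E → ℂ) ξ = 0 := fun ξ hξ => by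
      refine image_eq_zero_of_notMem_tsupport fun hmem => ?_
      have := hφ.tsupport_subset hmem
      rw [mem_ball_zero_iff] at this
      linarith
    intro ξ hξ
    constructor
    · have : tsupport (𝓕 (C (φ 1) : E → ℂ)) ⊆ Metric.closedBall 0 4 := by
        refine closure_minimal (fun z hz => ?_) Metric.isClosed_closedBall
        rw [mem_closedBall_zero_iff]
        by_contra! hcon
        refine hz ?_
        rw [hF, h0 z (by linarith), h0 _ (by rw [norm_smul]; norm_num; linarith), sub_zero]
      have := this hξ
      rw [mem_closedBall_zero_iff] at this
      rw [mem_ball_zero_iff]; linarith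
    · rintro rfl
      refine (notMem_tsupport_iff_eventuallyEq.2 ?_) hξ
      filter_upwards [Metric.ball_mem_nhds (0 : E) one_pos] with z hz
      have h1 : 𝓕 (C (φ 0) : E → ℂ) z = 1 := hφ.eq_one z hz
      have h2 : 𝓕 (C (φ 0) : E → ℂ) ((2⁻¹ : ℝ) • z) = 1 := hφ.eq_one _ (by
        rw [mem_ball_zero_iff] at hz ⊢
        rw [norm_smul]; norm_num; linarith)
      rw [hF, h1, h2, sub_self, Pi.zero_apply]
  obtain ⟨K, hK0, hK⟩ := exists_decay_bound F he (by norm_num : (0 : ℝ) < 5) k (C (φ 1)) hsupp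
  have hI0 : 0 ≤ ∫ y, ‖C (φ 0) y‖ := integral_nonneg fun _ => norm_nonneg _
  -- The block j = 0 has no cancellation and is bounded by the L¹ norm of φ₀. The block j + 1 is φ₁
  -- rescaled by 2^(-j), so the index shift costs 2^β.
  refine ⟨max (∫ y, ‖C (φ 0) y‖) (2 ^ β * K), le_max_of_le_left hI0, fun f M hf j x => ?_⟩
  have hM := hf.nonneg
  cases j with
  | zero =>
    have h1 : ∫ t, φ 0 (x - t) • f t = ∫ y, C (φ 0) y • f (x - y) := by
      rw [← integral_sub_left_eq_self _ volume x]
      simp [hCs]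
    simp only [Nat.cast_zero, zero_mul, Real.rpow_zero, one_mul]
    rw [h1, mul_comm]
    refine (norm_integral_schwartz_smul_le _ fun y => hf.zyg.norm_le _ trivial).trans ?_
    gcongr
    exact le_max_left _ _
  | succ j =>
    have hφj : ∀ z, φ (j + 1) z = ((2 : ℝ) ^ j) ^ q * φ 1 ((2 : ℝ) ^ j • z) := fun z => by
      rw [hφ.dilate, hφ1, smul_smul, ← pow_succ', ← pow_mul, mul_sub, ← mul_assoc, ← pow_add]
      congr 3
      · simp only [q]; ring
      · simp only [q]; ring
    have h2j : (0 : ℝ) < 2 ^ j := by positivity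
    have h1 : ∫ t, φ (j + 1) (x - t) • f t =
        ∫ y, C (φ 1) y • f (x - ((2 : ℝ) ^ j)⁻¹ • y) := by
      rw [← integral_sub_left_eq_self _ volume x]
      have h3 := Measure.integral_comp_smul (volume : Measure E)
        (fun y => C (φ 1) y • f (x - ((2 : ℝ) ^ j)⁻¹ • y)) (2 ^ j)
      rw [abs_of_pos (by positivity), eq_inv_smul_iff₀ (by positivity)] at h3
      rw [← h3, ← integral_smul]
      refine integral_congr_ae (.of_forall fun y => ?_)
      simp only [hCs, sub_sub_cancel, hφj, smul_smul, inv_mul_cancel₀ h2j.ne', one_smul]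
      rfl
    rw [h1]
    have h4 := hK f M hf ((2 : ℝ) ^ j)⁻¹ (by positivity) x
    have h5 : (2 : ℝ) ^ (((j + 1 : ℕ) : ℝ) * β) * (((2 : ℝ) ^ j)⁻¹) ^ β = 2 ^ β := by
      rw [← Real.rpow_natCast, ← Real.rpow_neg (by norm_num), ← Real.rpow_mul (by norm_num),
        ← Real.rpow_add (by norm_num)]
      congr 1
      push_cast
      ring
    calc _ ≤ (2 : ℝ) ^ (((j + 1 : ℕ) : ℝ) * β) * (K * M * (((2 : ℝ) ^ j)⁻¹) ^ β) := by gcongr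
      _ = ((2 : ℝ) ^ (((j + 1 : ℕ) : ℝ) * β) * (((2 : ℝ) ^ j)⁻¹) ^ β) * K * M := by ring
      _ = 2 ^ β * K * M := by rw [h5]
      _ ≤ _ := by gcongr; exact le_max_right _ _

end Decay

end HolFrob

namespace HolFrob

/-! ### Passing between the `ℝ≥0∞`-valued norms and the bounds with constants. -/

section Conversion

variable {E F F₁ : Type} [NormedAddCommGroup E] [NormedSpace ℝ E]
  [NormedAddCommGroup F] [NormedSpace ℝ F] [NormedAddCommGroup F₁] [NormedSpace ℝ F₁]

/-- The order `k` in `α = k + r`, `0 < r ≤ 1`. -/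
noncomputable def hzOrder (α : ℝ) : ℕ := ⌈α⌉₊ - 1

/-- The remainder `r` in `α = k + r`, `0 < r ≤ 1`. -/
noncomputable def hzRem (α : ℝ) : ℝ := α - (hzOrder α : ℕ)

/-- The Hölder exponent which comes with the remainder `hzRem α`. -/
noncomputable def hzLow (α : ℝ) : ℝ := if hzRem α < 1 then hzRem α else 1 / 2

lemma hzOrder_add_hzRem (α : ℝ) : (hzOrder α : ℝ) + hzRem α = α := by simp [hzRem]

lemma hzRem_pos {α : ℝ} (hα : 0 < α) : 0 < hzRem α := by
  have h1 : 0 < ⌈α⌉₊ := Nat.ceil_pos.2 hα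
  have h2 : ((⌈α⌉₊ - 1 : ℕ) : ℝ) < α := Nat.lt_ceil.1 (by omega)
  simpa [hzRem, hzOrder] using h2

lemma hzRem_le_one (α : ℝ) : hzRem α ≤ 1 := by
  have h2 : α ≤ ⌈α⌉₊ := Nat.le_ceil α
  have h3 : (⌈α⌉₊ : ℝ) ≤ ((⌈α⌉₊ - 1 : ℕ) : ℝ) + 1 := by
    exact_mod_cast (by omega : ⌈α⌉₊ ≤ (⌈α⌉₊ - 1) + 1)
  simp only [hzRem, hzOrder]
  linarith

lemma zygExp_hz {α : ℝ} (hα : 0 < α) : ZygExp (hzLow α) (hzRem α) := by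
  have h1 := hzRem_pos hα
  have h2 := hzRem_le_one α
  unfold hzLow
  split_ifs with h
  · exact ⟨h1, le_rfl, h2, by linarith⟩
  · push Not at h
    exact ⟨by norm_num, by linarith, h2, by linarith⟩

variable {r' r : ℝ} {Ω Ω' : Set E} {C : ℝ} {k : ℕ}

lemma ZygBound.linearIsometry_iff (L : F →ₗᵢ[ℝ] F₁) {f : E → F} :
    ZygBound r' r Ω (fun x => L (f x)) C ↔ ZygBound r' r Ω f C := by
  constructor <;> rintro ⟨h0, h1, h2, h3⟩ <;> refine ⟨h0, ?_, ?_, ?_⟩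
  · simpa using h1
  · simpa [← map_sub] using h2
  · simpa [← map_sub, ← map_add, ← map_smul] using h3
  · simpa using h1
  · simpa [← map_sub] using h2
  · simpa [← map_sub, ← map_add, ← map_smul] using h3

lemma ZygBound.iteratedFDerivWithin_zero_iff {f : E → F} :
    ZygBound r' r Ω' (iteratedFDerivWithin ℝ 0 f Ω) C ↔ ZygBound r' r Ω' f C := by
  rw [iteratedFDerivWithin_zero_eq_comp]
  exact ZygBound.linearIsometry_iff
    (continuousMultilinearCurryFin0 ℝ E F).symm.toLinearIsometry

/-- The two sides differ by the currying isometry. This reconciles the iterated derivatives in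
`hzNorm` with the nested `fderiv` in `HZBound`. -/
lemma ZygBound.iteratedFDerivWithin_succ_iff (hΩ : IsOpen Ω) (hs : Ω' ⊆ Ω) {f : E → F} {i : ℕ} :
    ZygBound r' r Ω' (iteratedFDerivWithin ℝ (i + 1) f Ω) C ↔
      ZygBound r' r Ω' (iteratedFDerivWithin ℝ i (fderiv ℝ f) Ω) C := by
  rw [← ZygBound.linearIsometry_iff
    (continuousMultilinearCurryRightEquiv' ℝ i E F).symm.toLinearIsometry
    (f := iteratedFDerivWithin ℝ i (fderiv ℝ f) Ω)]
  have : Set.EqOn (iteratedFDerivWithin ℝ (i + 1) f Ω) (fun x =>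
      (continuousMultilinearCurryRightEquiv' ℝ i E F).symm.toLinearIsometry
        (iteratedFDerivWithin ℝ i (fderiv ℝ f) Ω x)) Ω' := by
    intro x hx
    rw [iteratedFDerivWithin_succ_eq_comp_right hΩ.uniqueDiffOn (hs hx)]
    have h1 : Set.EqOn (fun y => fderivWithin ℝ f Ω y) (fderiv ℝ f) Ω := fun y hy =>
      fderivWithin_of_isOpen hΩ hy
    simp only [Function.comp_apply]
    rw [iteratedFDerivWithin_congr h1 (hs hx)]
    rfl
  exact ⟨fun h => h.congr this.symm, fun h => h.congr this⟩

lemma HZBound.iteratedFDerivWithin (hΩ : IsOpen Ω) {F : Type} [NormedAddCommGroup F]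
    [NormedSpace ℝ F] {f : E → F} (hf : HZBound r' r Ω k f C) {i : ℕ} (hi : i ≤ k) :
    ZygBound r' r Ω (iteratedFDerivWithin ℝ i f Ω) C := by
  induction i generalizing F k with
  | zero => exact ZygBound.iteratedFDerivWithin_zero_iff.2 hf.zyg
  | succ i ih =>
    obtain ⟨k, rfl⟩ : ∃ l, k = l + 1 := ⟨k - 1, by omega⟩
    exact (ZygBound.iteratedFDerivWithin_succ_iff hΩ subset_rfl).2 (ih hf.2.2 (by omega))

lemma HZBound.of_iteratedFDerivWithin (hΩ : IsOpen Ω) (hs : Ω' ⊆ Ω) {F : Type}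
    [NormedAddCommGroup F] [NormedSpace ℝ F] {f : E → F} (hc : ContDiffOn ℝ k f Ω)
    (hf : ∀ i ≤ k, ZygBound r' r Ω' (_root_.iteratedFDerivWithin ℝ i f Ω) C) :
    HZBound r' r Ω' k f C := by
  induction k generalizing F with
  | zero => exact ZygBound.iteratedFDerivWithin_zero_iff.1 (hf 0 le_rfl)
  | succ k ih =>
    rw [Nat.cast_add, Nat.cast_one, contDiffOn_succ_iff_fderiv_of_isOpen hΩ] at hc
    exact ⟨ZygBound.iteratedFDerivWithin_zero_iff.1 (hf 0 (by omega)), hc.1.mono hs,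
      ih hc.2.2 fun i hi => (ZygBound.iteratedFDerivWithin_succ_iff hΩ hs).1 (hf _ (by omega))⟩

lemma HZBound.contDiffOn (he : ZygExp r' r) (hΩ : IsOpen Ω) {F : Type} [NormedAddCommGroup F]
    [NormedSpace ℝ F] {f : E → F} (hf : HZBound r' r Ω k f C) : ContDiffOn ℝ k f Ω := by
  induction k generalizing F with
  | zero => exact contDiffOn_zero.2 (hf.continuousOn he)
  | succ k ih =>
    rw [Nat.cast_add, Nat.cast_one, contDiffOn_succ_iff_fderiv_of_isOpen hΩ]
    exact ⟨hf.2.1, by simp, ih hf.2.2⟩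

lemma enorm_div_edist_rpow_le {c t : ℝ} {x y : E} {v : F} (hC : 0 ≤ c) (ht : 0 ≤ t)
    (h : ‖v‖ ≤ c * ‖x - y‖ ^ t) : ‖v‖ₑ / edist x y ^ t ≤ ENNReal.ofReal c := by
  refine ENNReal.div_le_of_le_mul ?_
  rw [edist_eq_enorm_sub, ← ofReal_norm, ← ofReal_norm,
    ENNReal.ofReal_rpow_of_nonneg (norm_nonneg _) ht, ← ENNReal.ofReal_mul hC]
  exact ENNReal.ofReal_le_ofReal h

lemma baseNorm_le {α : ℝ} (hα : 0 < α) (hc : Convex ℝ Ω) {f : E → F}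
    (hf : ZygBound (hzLow α) (hzRem α) Ω f C) :
    baseNorm (hzRem α) Ω f ≤ ENNReal.ofReal C + ENNReal.ofReal C := by
  have hr := hzRem_pos hα
  unfold baseNorm
  refine add_le_add ?_ ?_
  · refine iSup₂_le fun x hx => ?_
    rw [← ofReal_norm]
    exact ENNReal.ofReal_le_ofReal (hf.norm_le x hx)
  · split_ifs with h
    · refine iSup₂_le fun x hx => iSup₂_le fun y hy => iSup_le fun _ => ?_
      have := hf.diff_le x hx y hy
      rw [hzLow, if_pos h] at this
      exact enorm_div_edist_rpow_le hf.nonneg hr.le this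
    · refine iSup₂_le fun x hx => iSup₂_le fun y hy => iSup_le fun _ => ?_
      have h1 : hzRem α = 1 := le_antisymm (hzRem_le_one α) (not_lt.1 h)
      have hm : (2⁻¹ : ℝ) • (x + y) ∈ Ω := by
        rw [smul_add]; exact hc hx hy (by norm_num) (by norm_num) (by norm_num)
      have := enorm_div_edist_rpow_le hf.nonneg hr.le (hf.mid_le x hx y hy hm)
      rwa [h1, ENNReal.rpow_one] at this

lemma HZBound.hzNorm_le {α : ℝ} (hα : 0 < α) (hΩ : IsOpen Ω) (hc : Convex ℝ Ω) {f : E → F}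
    (hf : HZBound (hzLow α) (hzRem α) Ω (hzOrder α) f C) :
    hzNorm α Ω f ≤ (hzOrder α + 1 : ℕ) * (ENNReal.ofReal C + ENNReal.ofReal C) := by
  have h := hf.contDiffOn (zygExp_hz hα) hΩ
  unfold hzNorm
  rw [if_pos (by exact_mod_cast h)]
  refine (Finset.sum_le_card_nsmul _ _ (ENNReal.ofReal C + ENNReal.ofReal C) fun i hi => ?_).trans ?_
  · exact baseNorm_le hα hc (hf.iteratedFDerivWithin hΩ (by
      rw [Finset.mem_range] at hi
      simp only [hzOrder]
      omega))
  · rw [Finset.card_range, nsmul_eq_mul]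
    rfl

lemma HZBound.hzNorm_lt_top {α : ℝ} (hα : 0 < α) (hΩ : IsOpen Ω) (hc : Convex ℝ Ω) {f : E → F}
    (hf : HZBound (hzLow α) (hzRem α) Ω (hzOrder α) f C) : hzNorm α Ω f < ⊤ :=
  (hf.hzNorm_le hα hΩ hc).trans_lt (by finiteness)

/-- The difference f(x+h) - f(x) is half of f(x+2h) - f(x) up to a midpoint error. Doubling h until
its length reaches ρ, where the sup bound takes over, multiplies the square root of its length only
by √2 per step, so the halving wins. The radius 3ρ leaves room for x + h with ‖h‖ < 2ρ. -/
lemma holder_half_of_zygmund {p : E} {ρ M H : ℝ} (hρ : 0 < ρ) (hM : 0 ≤ M) (hH : 0 ≤ H)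
    {f : E → F} (h0 : ∀ x ∈ Metric.ball p (3 * ρ), ‖f x‖ ≤ M)
    (h1 : ∀ x ∈ Metric.ball p (3 * ρ), ∀ y ∈ Metric.ball p (3 * ρ),
      ‖(2⁻¹ : ℝ) • (f x + f y) - f ((2⁻¹ : ℝ) • (x + y))‖ ≤ H * ‖x - y‖) :
    ∀ x ∈ Metric.ball p ρ, ∀ y ∈ Metric.ball p ρ,
      ‖f x - f y‖ ≤ (2 * M / √ρ + 8 * H * √ρ) * ‖x - y‖ ^ (1 / 2 : ℝ) := by
  set K := 2 * M / √ρ + 8 * H * √ρ with hK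
  have hsρ : 0 < √ρ := Real.sqrt_pos.2 hρ
  have hK0 : 0 ≤ K := by positivity
  have hmem : ∀ x ∈ Metric.ball p ρ, ∀ h : E, ‖h‖ < 2 * ρ → x + h ∈ Metric.ball p (3 * ρ) := by
    intro x hx h hh
    rw [mem_ball_iff_norm] at hx ⊢
    have : x + h - p = (x - p) + h := by abel
    rw [this]
    linarith [norm_add_le (x - p) h]
  -- N bounds the number of doublings that bring the length of h up to ρ.
  have main : ∀ (N : ℕ), ∀ x ∈ Metric.ball p ρ, ∀ h : E, ‖h‖ < 2 * ρ → ρ / 2 ^ N ≤ ‖h‖ →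
      ‖f (x + h) - f x‖ ≤ K * √‖h‖ := by
    have hbig : ∀ x ∈ Metric.ball p ρ, ∀ h : E, ‖h‖ < 2 * ρ → ρ ≤ ‖h‖ →
        ‖f (x + h) - f x‖ ≤ K * √‖h‖ := by
      intro x hx h hh hρh
      have hx3 : x ∈ Metric.ball p (3 * ρ) := Metric.ball_subset_ball (by linarith) hx
      refine (norm_sub_le_of_le (h0 _ (hmem x hx h hh)) (h0 x hx3)).trans ?_
      calc M + M = 2 * M / √ρ * √ρ := by field_simp; ring
        _ ≤ K * √‖h‖ := by
          gcongr
          rw [hK]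
          have : 0 ≤ 8 * H * √ρ := by positivity
          linarith
    intro N
    induction N with
    | zero => intro x hx h hh hN; exact hbig x hx h hh (by simpa using hN)
    | succ N ih =>
      intro x hx h hh hN
      rcases le_or_gt ρ ‖h‖ with hρh | hρh
      · exact hbig x hx h hh hρh
      · have hx3 : x ∈ Metric.ball p (3 * ρ) := Metric.ball_subset_ball (by linarith) hx
        have n2 : ‖(2 : ℝ) • h‖ = 2 * ‖h‖ := by rw [norm_smul]; norm_num
        have h2 := ih x hx ((2 : ℝ) • h) (by rw [n2]; linarith) (by
          rw [n2]
          rw [pow_succ, ← div_div] at hN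
          linarith)
        have h3 := h1 x hx3 (x + (2 : ℝ) • h) (hmem x hx _ (by rw [n2]; linarith))
        have e1 : (2⁻¹ : ℝ) • (x + (x + (2 : ℝ) • h)) = x + h := by module
        have e2 : x - (x + (2 : ℝ) • h) = -((2 : ℝ) • h) := by abel
        rw [e1, e2, norm_neg, n2] at h3
        rw [n2, Real.sqrt_mul (by norm_num)] at h2
        have e3 : f (x + h) - f x = (2⁻¹ : ℝ) • (f (x + (2 : ℝ) • h) - f x) -
            ((2⁻¹ : ℝ) • (f x + f (x + (2 : ℝ) • h)) - f (x + h)) := by module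
        rw [e3]
        have h4 : ‖(2⁻¹ : ℝ) • (f (x + (2 : ℝ) • h) - f x)‖ ≤ 2⁻¹ * (K * (√2 * √‖h‖)) := by
          rw [norm_smul, Real.norm_of_nonneg (by norm_num)]
          gcongr
        refine (norm_sub_le_of_le h4 h3).trans ?_
        -- The main term uses at most (1/2)(3/2) = 3/4 of K. The remaining K/4 absorbs the midpoint
        -- error 2H‖h‖, which explains the summand 8H√ρ in K.
        have h5 : √2 ≤ 3 / 2 := by
          rw [Real.sqrt_le_left (by norm_num)]; norm_num
        have h6 : ‖h‖ = √‖h‖ * √‖h‖ := (Real.mul_self_sqrt (norm_nonneg _)).symm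
        have h7 : √‖h‖ ≤ √ρ := Real.sqrt_le_sqrt hρh.le
        have h8 : 8 * H * √‖h‖ ≤ K := by
          have : 0 ≤ 2 * M / √ρ := by positivity
          have : 8 * H * √‖h‖ ≤ 8 * H * √ρ := by gcongr
          linarith
        have h9 : H * (2 * ‖h‖) ≤ K / 4 * √‖h‖ := by
          calc H * (2 * ‖h‖) = (8 * H * √‖h‖) / 4 * √‖h‖ := by
                nth_rewrite 1 [h6]; ring
            _ ≤ K / 4 * √‖h‖ := by gcongr
        have h10 : K * (√2 * √‖h‖) ≤ K * (3 / 2 * √‖h‖) := by gcongr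
        linarith
  intro x hx y hy
  rw [← Real.sqrt_eq_rpow]
  rcases eq_or_ne x y with rfl | hxy
  · simp
  have hn : 0 < ‖x - y‖ := norm_pos_iff.2 (sub_ne_zero.2 hxy)
  obtain ⟨N, hN⟩ := exists_nat_gt (ρ / ‖x - y‖)
  have h2 : ‖x - y‖ < 2 * ρ := by
    rw [mem_ball_iff_norm] at hx hy
    have : x - y = (x - p) - (y - p) := by abel
    rw [this]
    linarith [norm_sub_le (x - p) (y - p)]
  have := main N y hy (x - y) h2 (by
    rw [div_le_iff₀ (by positivity)]
    rw [div_lt_iff₀ hn] at hN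
    have h3 : (N : ℝ) ≤ 2 ^ N := by exact_mod_cast Nat.lt_two_pow_self.le
    nlinarith)
  simpa using this

lemma norm_le_mul_of_enorm_div_le {v : F} {t : ℝ} {x y : E} (hxy : x ≠ y)
    {S : ℝ≥0∞} (hS : S ≠ ⊤) (h : ‖v‖ₑ / edist x y ^ t ≤ S) :
    ‖v‖ ≤ S.toReal * ‖x - y‖ ^ t := by
  have hn : 0 < ‖x - y‖ := norm_pos_iff.2 (sub_ne_zero.2 hxy)
  rw [edist_eq_enorm_sub, ← ofReal_norm, ← ofReal_norm,
    ENNReal.ofReal_rpow_of_pos hn, ← ENNReal.ofReal_div_of_pos (by positivity),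
    ENNReal.ofReal_le_iff_le_toReal hS, div_le_iff₀ (by positivity)] at h
  exact h

/-- For r < 1 the midpoint bound follows from the Hölder bound through the two half-increments. For
r = 1 the exponent 1/2 has to be recovered from the midpoint quotient, and this is why the ball
shrinks by the factor 3. -/
lemma exists_zygBound_of_baseNorm {α : ℝ} (hα : 0 < α) {p : E} {ρ : ℝ} (hρ : 0 < ρ)
    (hs : Metric.ball p (3 * ρ) ⊆ Ω) {f : E → F} (hf : baseNorm (hzRem α) Ω f < ⊤) :
    ∃ C, ZygBound (hzLow α) (hzRem α) (Metric.ball p ρ) f C := by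
  have he := zygExp_hz hα
  have hr := hzRem_pos hα
  unfold baseNorm at hf
  rw [ENNReal.add_lt_top] at hf
  obtain ⟨hf0, hf1⟩ := hf
  set M := (⨆ x ∈ Ω, ‖f x‖ₑ)
  have h0 : ∀ x ∈ Ω, ‖f x‖ ≤ M.toReal := by
    intro x hx
    have := le_iSup₂ (f := fun (x : E) (_ : x ∈ Ω) => ‖f x‖ₑ) x hx
    rw [← toReal_enorm]
    exact ENNReal.toReal_mono hf0.ne this
  have hM : 0 ≤ M.toReal := ENNReal.toReal_nonneg
  have hs' : Metric.ball p ρ ⊆ Ω := (Metric.ball_subset_ball (by linarith)).trans hs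
  split_ifs at hf1 with h
  · set S := ⨆ x ∈ Ω, ⨆ y ∈ Ω, ⨆ (_ : x ≠ y), ‖f x - f y‖ₑ / edist x y ^ hzRem α with hS
    have h1 : ∀ x ∈ Ω, ∀ y ∈ Ω, ‖f x - f y‖ ≤ S.toReal * ‖x - y‖ ^ hzRem α := by
      intro x hx y hy
      rcases eq_or_ne x y with rfl | hxy
      · rw [sub_self, norm_zero]; positivity
      · refine norm_le_mul_of_enorm_div_le hxy hf1.ne ?_
        exact le_iSup₂_of_le x hx (le_iSup₂_of_le y hy (le_iSup_of_le hxy le_rfl))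
    have hlow : hzLow α = hzRem α := by rw [hzLow, if_pos h]
    refine ⟨M.toReal + S.toReal, by positivity, fun x hx => ?_, fun x hx y hy => ?_,
      fun x hx y hy hm => ?_⟩
    · linarith [h0 x (hs' hx), @ENNReal.toReal_nonneg S]
    · rw [hlow]
      refine (h1 x (hs' hx) y (hs' hy)).trans ?_
      gcongr
      linarith
    · set m := (2⁻¹ : ℝ) • (x + y)
      have hz : ∀ z ∈ Metric.ball p ρ, ‖z - m‖ = ‖x - y‖ / 2 →
          ‖(2⁻¹ : ℝ) • (f z - f m)‖ ≤ 2⁻¹ * (S.toReal * ‖x - y‖ ^ hzRem α) := by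
        intro z hz hzm
        rw [norm_smul, Real.norm_of_nonneg (by norm_num)]
        have h2 := h1 z (hs' hz) m (hs' hm)
        rw [hzm] at h2
        have h3 : (‖x - y‖ / 2) ^ hzRem α ≤ ‖x - y‖ ^ hzRem α :=
          Real.rpow_le_rpow (by positivity) (by linarith [norm_nonneg (x - y)]) hr.le
        have h4 : S.toReal * (‖x - y‖ / 2) ^ hzRem α ≤ S.toReal * ‖x - y‖ ^ hzRem α := by gcongr
        linarith
      have e : (2⁻¹ : ℝ) • (f x + f y) - f m =
        (2⁻¹ : ℝ) • (f x - f m) + (2⁻¹ : ℝ) • (f y - f m) := by module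
      rw [e]
      refine (norm_add_le_of_le (hz x hx (norm_sub_mid_left x y))
        (hz y hy (norm_sub_mid_right x y))).trans ?_
      have : 0 ≤ M.toReal * ‖x - y‖ ^ hzRem α := by positivity
      linarith
  · have hr1 : hzRem α = 1 := le_antisymm (hzRem_le_one α) (not_lt.1 h)
    set S := ⨆ x ∈ Ω, ⨆ y ∈ Ω, ⨆ (_ : x ≠ y),
        ‖(2⁻¹ : ℝ) • (f x + f y) - f ((2⁻¹ : ℝ) • (x + y))‖ₑ / edist x y with hS
    have hlow : hzLow α = 1 / 2 := by rw [hzLow, if_neg h]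
    have h1 : ∀ x ∈ Ω, ∀ y ∈ Ω,
        ‖(2⁻¹ : ℝ) • (f x + f y) - f ((2⁻¹ : ℝ) • (x + y))‖ ≤ S.toReal * ‖x - y‖ := by
      intro x hx y hy
      rcases eq_or_ne x y with rfl | hxy
      · have : (2⁻¹ : ℝ) • (f x + f x) - f ((2⁻¹ : ℝ) • (x + x)) = 0 := by
          have : (2⁻¹ : ℝ) • (x + x) = x := by module
          rw [this]; module
        rw [this, norm_zero]; positivity
      · have := norm_le_mul_of_enorm_div_le (t := 1) (S := S)
          (v := (2⁻¹ : ℝ) • (f x + f y) - f ((2⁻¹ : ℝ) • (x + y))) hxy hf1.ne ?_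
        · rwa [Real.rpow_one] at this
        · rw [ENNReal.rpow_one]
          exact le_iSup₂_of_le x hx (le_iSup₂_of_le y hy (le_iSup_of_le hxy le_rfl))
    have hS0 : 0 ≤ S.toReal := ENNReal.toReal_nonneg
    have h2 := holder_half_of_zygmund hρ hM hS0 (fun x hx => h0 x (hs hx))
      fun x hx y hy => h1 x (hs hx) y (hs hy)
    set K := 2 * M.toReal / √ρ + 8 * S.toReal * √ρ
    have hK : 0 ≤ K := by positivity
    refine ⟨M.toReal + S.toReal + K, by positivity, fun x hx => ?_, fun x hx y hy => ?_,
      fun x hx y hy hm => ?_⟩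
    · linarith [h0 x (hs' hx)]
    · rw [hlow]
      refine (h2 x hx y hy).trans ?_
      gcongr
      linarith
    · rw [hr1, Real.rpow_one]
      refine (h1 x (hs' hx) y (hs' hy)).trans ?_
      gcongr
      linarith

lemma exists_hzBound_of_hzNorm {α : ℝ} (hα : 0 < α) (hΩ : IsOpen Ω) {p : E} {ρ : ℝ} (hρ : 0 < ρ)
    (hs : Metric.ball p (3 * ρ) ⊆ Ω) {f : E → F} (hf : hzNorm α Ω f < ⊤) :
    ∃ C, HZBound (hzLow α) (hzRem α) (Metric.ball p ρ) (hzOrder α) f C := by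
  unfold hzNorm at hf
  split_ifs at hf with hc
  · rw [ENNReal.sum_lt_top] at hf
    have h1 : ∀ i, ∃ C, i ≤ hzOrder α → ZygBound (hzLow α) (hzRem α) (Metric.ball p ρ)
        (iteratedFDerivWithin ℝ i f Ω) C := by
      intro i
      by_cases hi : i ≤ hzOrder α
      · obtain ⟨C, hC⟩ := exists_zygBound_of_baseNorm hα hρ hs
          (hf i (Finset.mem_range.2 (Nat.lt_succ_of_le hi)))
        exact ⟨C, fun _ => hC⟩
      · exact ⟨0, fun h => absurd h hi⟩
    choose C hC using h1
    have hC0 : ∀ i ≤ hzOrder α, 0 ≤ C i := fun i hi => (hC i hi).nonneg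
    refine ⟨∑ i ∈ Finset.range (hzOrder α + 1), C i,
      HZBound.of_iteratedFDerivWithin hΩ
        ((Metric.ball_subset_ball (by linarith)).trans hs) (by exact_mod_cast hc) fun i hi => ?_⟩
    refine (hC i hi).mono ?_
    exact Finset.single_le_sum (f := C)
      (fun j hj => hC0 j (Nat.lt_succ_iff.1 (Finset.mem_range.1 hj)))
      (Finset.mem_range.2 (Nat.lt_succ_of_le hi))
  · simp at hf

end Conversion

end HolFrob

namespace HolFrob

/-! ### Cauchy expansions in several variables with a parameter of class 𝒞^β. -/

section Cauchy

lemma summable_fin_prod_pow {n : ℕ} {q : Fin n → ℝ} (h0 : ∀ i, 0 ≤ q i) (h1 : ∀ i, q i < 1) :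
    Summable fun α : Fin n → ℕ => ∏ i, q i ^ α i := by
  induction n with
  | zero => exact Summable.of_finite
  | succ n ih =>
    rw [← (Fin.consEquiv fun _ => ℕ).summable_iff]
    have h2 := ih (q := Fin.tail q) (fun i => h0 _) (fun i => h1 _)
    have h3 := summable_geometric_of_lt_one (h0 0) (h1 0)
    refine (h3.mul_of_nonneg h2 (fun a => pow_nonneg (h0 0) a)
      fun α => Finset.prod_nonneg fun i _ => pow_nonneg (h0 _) _).congr fun p => ?_
    simp [Fin.consEquiv, Fin.prod_univ_succ, Fin.tail]

/-- The weight in the Cauchy integral for the `a`-th Taylor coefficient. -/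
noncomputable def cauchyWeight (R : ℝ) (a : ℕ) (t : ℝ) : ℂ :=
  ((2 * Real.pi : ℝ) : ℂ)⁻¹ * ((circleMap 0 R t)⁻¹) ^ a

lemma continuous_cauchyWeight {R : ℝ} (hR : 0 < R) (a : ℕ) : Continuous (cauchyWeight R a) := by
  unfold cauchyWeight
  exact continuous_const.mul (((continuous_circleMap 0 R).inv₀
    fun t => circleMap_ne_center hR.ne').pow a)

lemma norm_cauchyWeight {R : ℝ} (hR : 0 < R) (a : ℕ) (t : ℝ) :
    ‖cauchyWeight R a t‖ = (2 * Real.pi)⁻¹ * R⁻¹ ^ a := by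
  have : ‖circleMap 0 R t‖ = R := by rw [norm_circleMap_zero, abs_of_pos hR]
  rw [cauchyWeight, norm_mul, norm_inv, norm_pow, norm_inv, this, Complex.norm_real,
    Real.norm_of_nonneg (by positivity)]

/-- The one-variable Cauchy series with the circle parametrised by t: the factor i z in dz cancels
the i of 2πi and one power of z. -/
lemma hasSum_cauchyWeight {R R' : ℝ} (hR : 0 < R) (hRR : R < R') {g : ℂ → ℂ}
    (hg : DifferentiableOn ℂ g (Metric.ball 0 R')) {z : ℂ} (hz : z ∈ Metric.ball (0 : ℂ) R) :
    HasSum (fun a : ℕ => z ^ a * ∫ t in (0 : ℝ)..2 * Real.pi,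
      cauchyWeight R a t * g (circleMap 0 R t)) (g z) := by
  lift R to NNReal using hR.le
  have h1 := (hg.mono (Metric.closedBall_subset_ball hRR)).hasFPowerSeriesOnBall
    (R := R) (by exact_mod_cast hR)
  have h2 := h1.hasSum (y := z) (by
    rw [Metric.mem_eball, edist_dist, ENNReal.ofReal_lt_coe_iff dist_nonneg]; exact hz)
  rw [zero_add] at h2
  refine (congrArg (fun F => HasSum F (g z)) (funext fun a => ?_)).mpr h2
  rw [cauchyPowerSeries_apply, circleIntegral]
  simp only [cauchyWeight, deriv_circleMap, sub_zero, smul_eq_mul]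
  rw [← intervalIntegral.integral_const_mul, ← intervalIntegral.integral_const_mul]
  refine intervalIntegral.integral_congr fun t _ => ?_
  have h3 : circleMap 0 (R : ℝ) t ≠ 0 := circleMap_ne_center (by exact_mod_cast hR.ne')
  have h4 : (Real.pi : ℂ) ≠ 0 := by exact_mod_cast Real.pi_ne_zero
  have h5 := Complex.I_ne_zero
  push_cast
  rw [div_pow, inv_pow]
  field_simp

/-- The iterated Cauchy integral for the Taylor coefficient of multi-index `α`. -/
noncomputable def cauchyCoeff (R : ℝ) : (n : ℕ) → (Fin n → ℕ) → ((Fin n → ℂ) → ℂ) → ℂ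
  | 0, _, f => f 0
  | n + 1, α, f => ∫ t in (0 : ℝ)..2 * Real.pi, cauchyWeight R (α 0) t *
      cauchyCoeff R n (Fin.tail α) fun ζ => f (Fin.cons (circleMap 0 R t) ζ)

variable {S : Type} [NormedAddCommGroup S] [NormedSpace ℝ S] {r' r : ℝ} {k : ℕ}

/-- The first variable of a function on a polydisc is turned into a parameter. -/
noncomputable def consParam (n : ℕ) : (Fin n → ℂ) × (ℂ × S) →L[ℝ] (Fin (n + 1) → ℂ) × S :=
  (ContinuousLinearMap.pi (Fin.cons
    ((ContinuousLinearMap.fst ℝ ℂ S).comp (ContinuousLinearMap.snd ℝ (Fin n → ℂ) (ℂ × S)))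
    fun i => (ContinuousLinearMap.proj i).comp
      (ContinuousLinearMap.fst ℝ (Fin n → ℂ) (ℂ × S)))).prod
    ((ContinuousLinearMap.snd ℝ ℂ S).comp (ContinuousLinearMap.snd ℝ (Fin n → ℂ) (ℂ × S)))

lemma consParam_apply (n : ℕ) (ζ : Fin n → ℂ) (x : ℂ) (s : S) :
    consParam n (ζ, (x, s)) = (Fin.cons x ζ, s) := by
  refine Prod.ext (funext fun i => ?_) rfl
  refine Fin.cases ?_ (fun j => ?_) i <;> simp [consParam]

lemma consParam_apply' (n : ℕ) (ζ : Fin n → ℂ) (p : ℂ × S) :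
    consParam n (ζ, p) = (Fin.cons p.1 ζ, p.2) := consParam_apply n ζ p.1 p.2

lemma norm_cons_lt {n : ℕ} {ζ : Fin n → ℂ} {x : ℂ} {R : ℝ} (hx : ‖x‖ < R) (hζ : ‖ζ‖ < R) :
    ‖(Fin.cons x ζ : Fin (n + 1) → ℂ)‖ < R := by
  have hR : 0 < R := (norm_nonneg _).trans_lt hx
  rw [pi_norm_lt_iff hR] at hζ ⊢
  exact Fin.cases hx hζ

lemma norm_consParam_le (n : ℕ) : ‖consParam (S := S) n‖ ≤ 1 := by
  refine ContinuousLinearMap.opNorm_le_bound _ zero_le_one ?_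
  rintro ⟨ζ, x, s⟩
  rw [consParam_apply, one_mul]
  simp only [Prod.norm_def]
  refine max_le ?_ ((le_max_right _ _).trans (le_max_right _ _))
  rw [pi_norm_le_iff_of_nonneg (by positivity)]
  refine Fin.cases ?_ fun i => ?_
  · exact (le_max_left _ _).trans (le_max_right _ _)
  · exact (norm_le_pi_norm ζ i).trans (le_max_left _ _)

lemma HZBound.consParam (he : ZygExp r' r) {n : ℕ} {V : Set S} (hV : IsOpen V) {R : ℝ}
    {f : (Fin (n + 1) → ℂ) × S → ℂ} {C : ℝ}
    (hf : HZBound r' r (Metric.ball 0 R ×ˢ V) k f C) :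
    HZBound r' r (Metric.ball (0 : Fin n → ℂ) R ×ˢ (Metric.ball (0 : ℂ) R ×ˢ V)) k
      (fun p => f (HolFrob.consParam n p)) C := by
  have := hf.comp_affine he (Metric.isOpen_ball.prod hV) (HolFrob.consParam n) 0 le_rfl
    (norm_consParam_le n) (Metric.isOpen_ball.prod (Metric.isOpen_ball.prod hV))
    (O := Metric.ball (0 : Fin n → ℂ) R ×ˢ (Metric.ball (0 : ℂ) R ×ˢ V)) ?_
  · simpa using this
  · rintro ⟨ζ, x, s⟩ ⟨hζ, hx, hs⟩
    rw [zero_add, consParam_apply]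
    refine ⟨?_, hs⟩
    rw [mem_ball_zero_iff] at *
    exact norm_cons_lt hx hζ

lemma circleMap_mem_ball {R R' : ℝ} (hR : 0 < R) (hRR : R < R') (t : ℝ) :
    circleMap 0 R t ∈ Metric.ball (0 : ℂ) R' := by
  rw [mem_ball_zero_iff, norm_circleMap_zero, abs_of_pos hR]; exact hRR

/-- By induction on the number of variables, with the first variable moved into the parameter space:
the inner coefficient is then regular jointly in that variable and s, and one circle integral is
left. The length 2π cancels the factor 1/(2π) of the weight, so no constant accumulates. -/
lemma HZBound.cauchyCoeff (he : ZygExp r' r) {R R' : ℝ} (hR : 0 < R) (hRR : R < R') {n : ℕ}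
    (α : Fin n → ℕ) {S : Type} [NormedAddCommGroup S] [NormedSpace ℝ S] {V : Set S}
    (hV : IsOpen V) {f : (Fin n → ℂ) × S → ℂ} {C : ℝ}
    (hf : HZBound r' r (Metric.ball 0 R' ×ˢ V) k f C) :
    HZBound r' r V k (fun s => HolFrob.cauchyCoeff R n α fun ζ => f (ζ, s))
      (C * ∏ i, R⁻¹ ^ α i) := by
  induction n generalizing S with
  | zero =>
    have := hf.comp_affine he (Metric.isOpen_ball.prod hV) (ContinuousLinearMap.inr ℝ (Fin 0 → ℂ) S)
      0 le_rfl (ContinuousLinearMap.norm_inr_le_one ℝ (Fin 0 → ℂ) S) hV fun s hs => by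
        simpa using ⟨hR.trans hRR, hs⟩
    simpa [HolFrob.cauchyCoeff] using this
  | succ n ih =>
    have h1 := ih (Fin.tail α) (Metric.isOpen_ball.prod hV) (hf.consParam he hV)
    let B : ℝ → ℂ →L[ℝ] ℂ := fun t =>
      ContinuousLinearMap.lsmul ℝ ℂ (cauchyWeight R (α 0) t)
    have hB : Continuous B :=
      (ContinuousLinearMap.lsmul ℝ ℂ).continuous.comp (continuous_cauchyWeight hR _)
    have hBW : ∀ t, ‖B t‖ ≤ (2 * Real.pi)⁻¹ * R⁻¹ ^ α 0 := fun t => by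
      rw [← norm_cauchyWeight hR (α 0) t]
      exact ContinuousLinearMap.opNorm_lsmul_apply_le _
    have h2 := h1.intervalIntegral he Metric.isOpen_ball hV (continuous_circleMap 0 R)
      (circleMap_mem_ball hR hRR) hB hBW
    have h3 := Real.pi_pos
    refine (h2.congr hV fun s _ => ?_).mono (le_of_eq ?_)
    · simp only [HolFrob.cauchyCoeff, consParam_apply, B]
      rfl
    · rw [Fin.prod_univ_succ]
      simp only [Fin.tail]
      field_simp

/-- The function is expanded in all variables but the first, uniformly for the first one on the
circle. Integrating this expansion gives the coefficients of the one-variable series in the first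
variable. -/
lemma hasSum_cauchyCoeff (he : ZygExp r' r) {R R' : ℝ} (hR : 0 < R) (hRR : R < R') {n : ℕ}
    {S : Type} [NormedAddCommGroup S] [NormedSpace ℝ S] {V : Set S}
    (hV : IsOpen V) {f : (Fin n → ℂ) × S → ℂ} {C : ℝ}
    (hf : HZBound r' r (Metric.ball 0 R' ×ˢ V) k f C)
    (hd : ∀ s ∈ V, DifferentiableOn ℂ (fun ζ => f (ζ, s)) (Metric.ball 0 R')) {s : S} (hs : s ∈ V)
    {ζ : Fin n → ℂ} (hζ : ζ ∈ Metric.ball 0 R) :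
    HasSum (fun α : Fin n → ℕ => (∏ i, ζ i ^ α i) * cauchyCoeff R n α fun ζ => f (ζ, s))
      (f (ζ, s)) := by
  induction n generalizing S with
  | zero =>
    rw [Subsingleton.elim ζ 0]
    convert hasSum_unique (fun α : Fin 0 → ℕ => (∏ i, (0 : Fin 0 → ℂ) i ^ α i) *
      cauchyCoeff R 0 α fun ζ => f (ζ, s)) using 1
    rw [Finset.univ_eq_empty, Finset.prod_empty, one_mul]
    rfl
  | succ n ih =>
    have hC := hf.nonneg
    have hπ := Real.pi_pos
    set z := ζ 0
    set w := Fin.tail ζ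
    have hζc : Fin.cons z w = ζ := Fin.cons_self_tail ζ
    rw [mem_ball_zero_iff, pi_norm_lt_iff hR] at hζ
    have hz : z ∈ Metric.ball (0 : ℂ) R := by rw [mem_ball_zero_iff]; exact hζ 0
    have hw : w ∈ Metric.ball (0 : Fin n → ℂ) R := by
      rw [mem_ball_zero_iff, pi_norm_lt_iff hR]; exact fun i => hζ _
    have hw' : w ∈ Metric.ball (0 : Fin n → ℂ) R' := Metric.ball_subset_ball hRR.le hw
    have hf' := hf.consParam he hV
    have hV' : IsOpen (Metric.ball (0 : ℂ) R' ×ˢ V) := Metric.isOpen_ball.prod hV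
    -- the expansion in the remaining variables
    have h1 : ∀ x ∈ Metric.ball (0 : ℂ) R', HasSum (fun α : Fin n → ℕ => (∏ i, w i ^ α i) *
        cauchyCoeff R n α fun ζ => f (Fin.cons x ζ, s)) (f (Fin.cons x w, s)) := by
      intro x hx
      have := ih hV' hf' (fun p hp => ?_) (s := (x, s)) ⟨hx, hs⟩ hw
      · simpa only [consParam_apply] using this
      · simp only [consParam_apply']
        refine (hd p.2 hp.2).comp (f := fun ζ : Fin n → ℂ => (Fin.cons p.1 ζ : Fin (n + 1) → ℂ))
          ?_ fun ζ hζ => ?_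
        · refine differentiableOn_pi.2 (Fin.cases ?_ fun i => ?_)
          · simp
          · simpa using (differentiable_apply i).differentiableOn
        · have h2 := hp.1
          rw [mem_ball_zero_iff] at *
          exact norm_cons_lt h2 hζ
    have hcoef := fun α : Fin n → ℕ => HZBound.cauchyCoeff he hR hRR α hV' hf'
    simp only [consParam_apply'] at hcoef
    have hcont : ∀ α : Fin n → ℕ, Continuous fun t =>
        cauchyCoeff R n α fun ζ => f (Fin.cons (circleMap 0 R t) ζ, s) := fun α =>
      ((hcoef α).continuousOn he).comp_continuous
        (f := fun t => (circleMap 0 R t, s)) (by fun_prop)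
        fun t => ⟨circleMap_mem_ball hR hRR t, hs⟩
    have hbd : ∀ (α : Fin n → ℕ) (t : ℝ), ‖cauchyCoeff R n α fun ζ =>
        f (Fin.cons (circleMap 0 R t) ζ, s)‖ ≤ C * ∏ i, R⁻¹ ^ α i := fun α t =>
      (hcoef α).zyg.norm_le (circleMap 0 R t, s) ⟨circleMap_mem_ball hR hRR t, hs⟩
    have hq1 : ∀ i, ‖w i‖ * R⁻¹ < 1 := fun i => by
      rw [← div_eq_mul_inv, div_lt_one hR]; exact hζ _
    have hq0 : ∀ i, 0 ≤ ‖w i‖ * R⁻¹ := fun i => by positivity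
    have hsw := summable_fin_prod_pow hq0 hq1
    have hbd' : ∀ (a : ℕ) (α : Fin n → ℕ) (t : ℝ), ‖cauchyWeight R a t * ((∏ i, w i ^ α i) *
        cauchyCoeff R n α fun ζ => f (Fin.cons (circleMap 0 R t) ζ, s))‖ ≤
        ((2 * Real.pi)⁻¹ * R⁻¹ ^ a * C) * ∏ i, (‖w i‖ * R⁻¹) ^ α i := by
      intro a α t
      rw [norm_mul, norm_mul, norm_cauchyWeight hR, norm_prod]
      simp only [norm_pow, mul_pow, Finset.prod_mul_distrib]
      calc _ ≤ (2 * Real.pi)⁻¹ * R⁻¹ ^ a * ((∏ i, ‖w i‖ ^ α i) * (C * ∏ i, R⁻¹ ^ α i)) := by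
            gcongr
            exact hbd α t
        _ = _ := by ring
    -- integration of the expansion over the circle
    have h2 : ∀ a : ℕ, HasSum (fun α : Fin n → ℕ => ∫ t in (0 : ℝ)..2 * Real.pi,
        cauchyWeight R a t * ((∏ i, w i ^ α i) *
          cauchyCoeff R n α fun ζ => f (Fin.cons (circleMap 0 R t) ζ, s)))
        (∫ t in (0 : ℝ)..2 * Real.pi, cauchyWeight R a t * f (Fin.cons (circleMap 0 R t) w, s)) := by
      intro a
      refine intervalIntegral.hasSum_integral_of_dominated_convergence
        (fun α _ => ((2 * Real.pi)⁻¹ * R⁻¹ ^ a * C) * ∏ i, (‖w i‖ * R⁻¹) ^ α i)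
        (fun α => ?_) (fun α => .of_forall fun t _ => hbd' a α t) (.of_forall fun _ _ => ?_) ?_
        (.of_forall fun t _ => (h1 _ (circleMap_mem_ball hR hRR t)).mul_left _)
      · exact ((continuous_cauchyWeight hR a).mul
          (continuous_const.mul (hcont α))).aestronglyMeasurable
      · exact hsw.mul_left _
      · exact intervalIntegrable_const
    rw [← (Fin.consEquiv fun _ => ℕ).hasSum_iff]
    have hF : ∀ p : ℕ × (Fin n → ℕ), ((fun α : Fin (n + 1) → ℕ => (∏ i, ζ i ^ α i) *
        cauchyCoeff R (n + 1) α fun ζ => f (ζ, s)) ∘ (Fin.consEquiv fun _ => ℕ)) p =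
        z ^ p.1 * ∫ t in (0 : ℝ)..2 * Real.pi, cauchyWeight R p.1 t * ((∏ i, w i ^ p.2 i) *
          cauchyCoeff R n p.2 fun ζ => f (Fin.cons (circleMap 0 R t) ζ, s)) := by
      rintro ⟨a, α⟩
      simp only [Function.comp_apply, Fin.consEquiv, Equiv.coe_fn_mk, Fin.prod_univ_succ,
        Fin.cons_zero, Fin.cons_succ, cauchyCoeff, Fin.tail_cons]
      rw [mul_assoc, ← intervalIntegral.integral_const_mul]
      congr 2
      ext t
      simp only [w, Fin.tail]
      ring
    have hsum : Summable fun p : ℕ × (Fin n → ℕ) => z ^ p.1 * ∫ t in (0 : ℝ)..2 * Real.pi,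
        cauchyWeight R p.1 t * ((∏ i, w i ^ p.2 i) *
          cauchyCoeff R n p.2 fun ζ => f (Fin.cons (circleMap 0 R t) ζ, s)) := by
      have hz1 : ‖z‖ * R⁻¹ < 1 := by rw [← div_eq_mul_inv, div_lt_one hR]; exact hζ 0
      have h3 := ((summable_geometric_of_lt_one (by positivity) hz1).mul_of_nonneg hsw
        (fun a => by positivity)
        (fun α => Finset.prod_nonneg fun i _ => pow_nonneg (hq0 i) _)).mul_left C
      refine Summable.of_norm_bounded h3 fun p => ?_
      have h4 := intervalIntegral.norm_integral_le_of_norm_le_const (a := 0) (b := 2 * Real.pi)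
        fun t _ => hbd' p.1 p.2 t
      rw [sub_zero, abs_of_pos (by positivity)] at h4
      rw [norm_mul, norm_pow]
      calc _ ≤ ‖z‖ ^ p.1 * ((2 * Real.pi)⁻¹ * R⁻¹ ^ p.1 * C * (∏ i, (‖w i‖ * R⁻¹) ^ p.2 i) *
            (2 * Real.pi)) := by gcongr
        _ = _ := by rw [mul_pow]; field_simp
    have h5 : DifferentiableOn ℂ (fun x => f (Fin.cons x w, s)) (Metric.ball 0 R') := by
      refine (hd s hs).comp (f := fun x : ℂ => (Fin.cons x w : Fin (n + 1) → ℂ)) ?_ fun x hx => ?_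
      · refine differentiableOn_pi.2 (Fin.cases ?_ fun i => ?_)
        · exact differentiableOn_id
        · simp
      · rw [mem_ball_zero_iff] at *
        exact norm_cons_lt hx hw'
    have h6 := hasSum_cauchyWeight hR hRR h5 hz
    have h7 := hsum.hasSum
    -- Absolute summability allows the double sum to be computed fibre by fibre, and the
    -- one-variable Cauchy series identifies its value.
    have h8 := (h7.prod_fiberwise fun a => (h2 a).mul_left (z ^ a)).unique h6
    rw [h8, hζc] at h7
    exact (congrArg (fun F => HasSum F (f (ζ, s))) (funext hF)).mpr h7

/-- A function of class `𝒞^β`, holomorphic in the first variable, has a power series expansion with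
respect to that variable whose coefficients are of class `𝒞^β`. -/
theorem HZBound.exists_expansion (he : ZygExp r' r) {R R' : ℝ} (hR : 0 < R) (hRR : R < R')
    {σ : Type} [Fintype σ] {V : Set S} (hV : IsOpen V) {f : (σ → ℂ) × S → ℂ} {C : ℝ}
    (hf : HZBound r' r (Metric.ball 0 R' ×ˢ V) k f C)
    (hd : ∀ s ∈ V, DifferentiableOn ℂ (fun ζ => f (ζ, s)) (Metric.ball 0 R')) :
    ∃ c : (σ →₀ ℕ) → S → ℂ, (∀ α, HZBound r' r V k (c α) (C * R⁻¹ ^ α.degree)) ∧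
      ∀ s ∈ V, ∀ x ∈ Metric.ball (0 : σ → ℂ) R,
        HasSum (fun α : σ →₀ ℕ => (∏ i, x i ^ α i) * c α s) (f (x, s)) := by
  classical
  obtain ⟨n, ⟨e⟩⟩ : ∃ n, Nonempty (σ ≃ Fin n) := ⟨_, ⟨Fintype.equivFin σ⟩⟩
  let L : (Fin n → ℂ) →L[ℂ] (σ → ℂ) := ContinuousLinearMap.pi fun i => .proj (e i)
  have hL : ∀ ζ : Fin n → ℂ, ‖L ζ‖ ≤ ‖ζ‖ := fun ζ =>
    (pi_norm_le_iff_of_nonneg (norm_nonneg _)).2 fun i => norm_le_pi_norm ζ (e i)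
  let M : (Fin n → ℂ) × S →L[ℝ] (σ → ℂ) × S :=
    (L.restrictScalars ℝ).prodMap (ContinuousLinearMap.id ℝ S)
  have hM : ‖M‖ ≤ 1 := ContinuousLinearMap.opNorm_le_bound _ zero_le_one fun p => by
    rw [one_mul]
    exact max_le_max (hL p.1) le_rfl
  have hmem : ∀ ζ ∈ Metric.ball (0 : Fin n → ℂ) R', L ζ ∈ Metric.ball (0 : σ → ℂ) R' := by
    intro ζ hζ
    rw [mem_ball_zero_iff] at *
    exact (hL ζ).trans_lt hζ
  have hf' : HZBound r' r (Metric.ball (0 : Fin n → ℂ) R' ×ˢ V) k (fun p => f (L p.1, p.2)) C := by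
    have := hf.comp_affine he (Metric.isOpen_ball.prod hV) M 0 le_rfl hM
      (O := Metric.ball (0 : Fin n → ℂ) R' ×ˢ V) (Metric.isOpen_ball.prod hV) fun p hp => by
        rw [zero_add]
        exact ⟨hmem _ hp.1, hp.2⟩
    rw [one_pow, mul_one] at this
    exact this.congr (Metric.isOpen_ball.prod hV) fun p _ => by simp only [zero_add]; rfl
  have hd' : ∀ s ∈ V, DifferentiableOn ℂ (fun ζ => f (L ζ, s)) (Metric.ball 0 R') := fun s hs =>
    (hd s hs).comp L.differentiable.differentiableOn hmem
  let E : (σ →₀ ℕ) ≃ (Fin n → ℕ) := Finsupp.equivFunOnFinite.trans (e.arrowCongr (Equiv.refl ℕ))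
  have hE : ∀ (α : σ →₀ ℕ) (i : σ), E α (e i) = α i := fun α i => by simp [E]
  refine ⟨fun α s => HolFrob.cauchyCoeff R n (E α) fun ζ => f (L ζ, s), fun α => ?_,
    fun s hs x hx => ?_⟩
  · refine (HZBound.cauchyCoeff he hR hRR (E α) hV hf').mono (le_of_eq ?_)
    rw [Finset.prod_pow_eq_pow_sum, Finsupp.degree_eq_sum, ← e.sum_comp]
    simp only [hE]
  · have hx' : (fun j => x (e.symm j)) ∈ Metric.ball (0 : Fin n → ℂ) R := by
      rw [mem_ball_zero_iff, pi_norm_lt_iff hR] at *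
      exact fun j => hx _
    have h1 := hasSum_cauchyCoeff he hR hRR hV hf' hd' hs hx'
    have h2 : L (fun j => x (e.symm j)) = x := by ext i; simp [L]
    rw [← E.hasSum_iff] at h1
    simp only [h2] at h1
    refine (congrArg (fun F => HasSum F (f (x, s))) (funext fun α => ?_)).mpr h1
    rw [Function.comp_apply, ← e.prod_comp]
    simp only [hE, Equiv.symm_apply_apply]

end Cauchy

end HolFrob

namespace HolFrob

set_option linter.unusedSectionVars false

/-! ### Formal Frobenius theorem for fields in graph form. -/

section Formal

open MvPowerSeries Finsupp

variable {σ ι κ 𝓡 : Type} [Fintype ι] [Fintype κ] [CommRing 𝓡]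

lemma coeff_X_mul_eq_ite (i : σ) (F : MvPowerSeries σ 𝓡) (α : σ →₀ ℕ) :
    coeff α (X i * F) = if single i 1 ≤ α then coeff (α - single i 1) F else 0 := by
  rw [X_def, coeff_monomial_mul]
  simp only [one_mul]

/-- The Euler operator is diagonal on monomials, so the radial equation can be read coefficient by
coefficient. -/
lemma coeff_X_mul_pderiv (i : σ) (F : MvPowerSeries σ 𝓡) (α : σ →₀ ℕ) :
    coeff α (X i * pderiv 𝓡 i F) = (α i : 𝓡) * coeff α F := by
  rw [coeff_X_mul_eq_ite]
  split_ifs with h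
  · rw [coeff_pderiv, tsub_add_cancel_of_le h, mul_comm]
    congr 1
    have : 1 ≤ α i := by simpa using h i
    rw [Finsupp.tsub_apply, single_eq_same, Nat.cast_sub this]
    simp
  · have : α i = 0 := by
      by_contra h0
      exact h (Finsupp.single_le_iff.2 (Nat.one_le_iff_ne_zero.2 h0))
    simp [this]

lemma pderiv_comm (i j : σ) (F : MvPowerSeries σ 𝓡) :
    pderiv 𝓡 i (pderiv 𝓡 j F) = pderiv 𝓡 j (pderiv 𝓡 i F) := by
  classical
  ext α
  simp only [coeff_pderiv]
  rw [add_right_comm]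
  by_cases h : i = j
  · rw [h]
  · simp only [Finsupp.add_apply, single_eq_of_ne h, single_eq_of_ne (Ne.symm h), add_zero]
    ring

/-- The total degree of a multi-index in the variables of the first group. -/
def leftDegree (α : ι ⊕ κ →₀ ℕ) : ℕ := ∑ j, α (.inl j)

/-- The total degree of a multi-index in the variables of the second group. -/
def rightDegree (α : ι ⊕ κ →₀ ℕ) : ℕ := ∑ k, α (.inr k)

lemma degree_eq_left_add_right (α : ι ⊕ κ →₀ ℕ) : α.degree = leftDegree α + rightDegree α := by
  rw [Finsupp.degree_eq_sum, Fintype.sum_sum_type]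
  rfl

lemma leftDegree_add (α β : ι ⊕ κ →₀ ℕ) : leftDegree (α + β) = leftDegree α + leftDegree β := by
  simp [leftDegree, Finset.sum_add_distrib]

lemma rightDegree_add (α β : ι ⊕ κ →₀ ℕ) :
    rightDegree (α + β) = rightDegree α + rightDegree β := by
  simp [rightDegree, Finset.sum_add_distrib]

lemma leftDegree_single_inl (j : ι) (a : ℕ) :
    leftDegree (single (.inl j) a : ι ⊕ κ →₀ ℕ) = a := by
  classical
  simp [leftDegree, single_apply]

lemma leftDegree_single_inr (k : κ) (a : ℕ) :
    leftDegree (single (.inr k) a : ι ⊕ κ →₀ ℕ) = 0 := by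
  simp [leftDegree]

lemma rightDegree_single_inl (j : ι) (a : ℕ) :
    rightDegree (single (.inl j) a : ι ⊕ κ →₀ ℕ) = 0 := by
  simp [rightDegree]

lemma rightDegree_single_inr (k : κ) (a : ℕ) :
    rightDegree (single (.inr k) a : ι ⊕ κ →₀ ℕ) = a := by
  classical
  simp [rightDegree, single_apply]

/-- All coefficients of degree `< d` in the first group of variables vanish. -/
def LeftVanish (d : ℕ) (F : MvPowerSeries (ι ⊕ κ) 𝓡) : Prop :=
  ∀ α, leftDegree α < d → coeff α F = 0

lemma LeftVanish.eq_zero {F : MvPowerSeries (ι ⊕ κ) 𝓡} (h : ∀ d, LeftVanish d F) : F = 0 := by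
  ext α
  exact h (leftDegree α + 1) α (Nat.lt_succ_self _)

lemma LeftVanish.sum {d : ℕ} {τ : Type} (s : Finset τ) {F : τ → MvPowerSeries (ι ⊕ κ) 𝓡}
    (h : ∀ i ∈ s, LeftVanish d (F i)) : LeftVanish d (∑ i ∈ s, F i) := by
  intro α hα
  rw [map_sum]
  exact Finset.sum_eq_zero fun i hi => h i hi α hα

lemma LeftVanish.mul_left {d : ℕ} (A : MvPowerSeries (ι ⊕ κ) 𝓡) {F : MvPowerSeries (ι ⊕ κ) 𝓡}
    (h : LeftVanish d F) : LeftVanish d (A * F) := by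
  classical
  intro α hα
  rw [coeff_mul]
  refine Finset.sum_eq_zero fun p hp => ?_
  rw [Finset.HasAntidiagonal.mem_antidiagonal] at hp
  rw [h p.2 (by rw [← hp, leftDegree_add] at hα; omega), mul_zero]

lemma LeftVanish.pderiv_inr {d : ℕ} (k : κ) {F : MvPowerSeries (ι ⊕ κ) 𝓡}
    (h : LeftVanish d F) : LeftVanish d (pderiv 𝓡 (.inr k) F) := by
  intro α hα
  rw [coeff_pderiv, h _ (by rwa [leftDegree_add, leftDegree_single_inr]), zero_mul]

lemma LeftVanish.X_mul {d : ℕ} (j : ι) {F : MvPowerSeries (ι ⊕ κ) 𝓡}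
    (h : LeftVanish d F) : LeftVanish (d + 1) (X (.inl j) * F) := by
  intro α hα
  rw [coeff_X_mul_eq_ite]
  split_ifs with h1
  · refine h _ ?_
    have h2 := congrArg leftDegree (tsub_add_cancel_of_le h1)
    rw [leftDegree_add, leftDegree_single_inl] at h2
    omega
  · rfl

/-- The vector field `∂/∂z_j + ∑_k a_j^k ∂/∂w_k` as a derivation of formal power series. -/
noncomputable def graphField (a : ι → κ → MvPowerSeries (ι ⊕ κ) 𝓡) (j : ι)
    (F : MvPowerSeries (ι ⊕ κ) 𝓡) : MvPowerSeries (ι ⊕ κ) 𝓡 :=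
  pderiv 𝓡 (.inl j) F + ∑ k, a j k * pderiv 𝓡 (.inr k) F

/-- The operator `∑_{j,k} z_j a_j^k ∂/∂w_k`. -/
noncomputable def slopeField (a : ι → κ → MvPowerSeries (ι ⊕ κ) 𝓡)
    (F : MvPowerSeries (ι ⊕ κ) 𝓡) : MvPowerSeries (ι ⊕ κ) 𝓡 :=
  ∑ j, X (.inl j) * ∑ k, a j k * pderiv 𝓡 (.inr k) F

variable {a : ι → κ → MvPowerSeries (ι ⊕ κ) 𝓡}

lemma slopeField_sub (F H : MvPowerSeries (ι ⊕ κ) 𝓡) :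
    slopeField a (F - H) = slopeField a F - slopeField a H := by
  simp only [slopeField, map_sub, mul_sub, Finset.sum_sub_distrib]

/-- The operator differentiates only in w and multiplies by some z_j, so it raises the order in z.
This makes the radial equation triangular. -/
lemma LeftVanish.slopeField {d : ℕ} {F : MvPowerSeries (ι ⊕ κ) 𝓡} (h : LeftVanish d F) :
    LeftVanish (d + 1) (slopeField a F) :=
  LeftVanish.sum _ fun _ _ => LeftVanish.X_mul _ <| LeftVanish.sum _ fun k _ =>
    (h.pderiv_inr k).mul_left _

lemma coeff_sum_X_mul_graphField (F : MvPowerSeries (ι ⊕ κ) 𝓡) (α : ι ⊕ κ →₀ ℕ) :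
    coeff α (∑ j, X (.inl j) * graphField a j F) =
      (leftDegree α : 𝓡) * coeff α F + coeff α (slopeField a F) := by
  simp only [graphField, mul_add, Finset.sum_add_distrib, map_add, slopeField, map_sum,
    coeff_X_mul_pderiv, leftDegree, Nat.cast_sum, Finset.sum_mul]

lemma graphField_mul (j : ι) (F H : MvPowerSeries (ι ⊕ κ) 𝓡) :
    graphField a j (F * H) = F * graphField a j H + H * graphField a j F := by
  simp only [graphField, Derivation.leibniz, smul_eq_mul, mul_add, Finset.mul_sum,
    Finset.sum_add_distrib]
  simp only [mul_left_comm]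
  ring

lemma graphField_sum {τ : Type} (s : Finset τ) (j : ι) (F : τ → MvPowerSeries (ι ⊕ κ) 𝓡) :
    graphField a j (∑ i ∈ s, F i) = ∑ i ∈ s, graphField a j (F i) := by
  simp only [graphField, map_sum, Finset.sum_add_distrib, Finset.mul_sum]
  rw [Finset.sum_comm]

lemma graphField_zero (j : ι) : graphField a j 0 = 0 := by simp [graphField]

lemma graphField_X_inl [DecidableEq ι] (i j : ι) :
    graphField a j (X (.inl i)) = if i = j then 1 else 0 := by
  have h1 : ∀ k, pderiv 𝓡 (.inr k) (X (.inl i) : MvPowerSeries (ι ⊕ κ) 𝓡) = 0 := fun k =>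
    pderiv_X_of_ne (by simp)
  simp only [graphField, h1, mul_zero, Finset.sum_const_zero, add_zero]
  split_ifs with h
  · rw [h, pderiv_X_self]
  · exact pderiv_X_of_ne (by simpa using h)

/-- The bracket of two graph fields has no z-component, and its w-components are the differences
that `hcomm` makes zero. The second-order terms are symmetric because partial derivatives commute.
-/
lemma graphField_comm (hcomm : ∀ i j k, graphField a i (a j k) = graphField a j (a i k)) (i j : ι)
    (F : MvPowerSeries (ι ⊕ κ) 𝓡) :
    graphField a i (graphField a j F) = graphField a j (graphField a i F) := by
  have key : ∀ i j : ι, graphField a i (graphField a j F) =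
      pderiv 𝓡 (.inl i) (pderiv 𝓡 (.inl j) F) +
      ∑ k, a i k * pderiv 𝓡 (.inr k) (pderiv 𝓡 (.inl j) F) +
      ∑ k, a j k * pderiv 𝓡 (.inr k) (pderiv 𝓡 (.inl i) F) +
      ∑ k, ∑ l, a i l * (a j k * pderiv 𝓡 (.inr l) (pderiv 𝓡 (.inr k) F)) +
      ∑ k, pderiv 𝓡 (.inr k) F * graphField a i (a j k) := by
    intro i j
    have h0 : graphField a i (graphField a j F) = graphField a i (pderiv 𝓡 (.inl j) F) +
        graphField a i (∑ k, a j k * pderiv 𝓡 (.inr k) F) := by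
      conv_lhs => rw [graphField.eq_def a j F]
      simp only [graphField, map_add, mul_add, Finset.sum_add_distrib]
      ring
    have h1 : ∀ k, graphField a i (pderiv 𝓡 (.inr k) F) =
        pderiv 𝓡 (.inr k) (pderiv 𝓡 (.inl i) F) +
          ∑ l, a i l * pderiv 𝓡 (.inr l) (pderiv 𝓡 (.inr k) F) := fun k => by
      rw [graphField, pderiv_comm]
    rw [h0, graphField_sum]
    simp only [graphField_mul, h1]
    rw [graphField.eq_def a i (pderiv 𝓡 (.inl j) F)]
    simp only [mul_add, Finset.sum_add_distrib, Finset.mul_sum]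
    simp only [mul_left_comm]
    ring
  rw [key i j, key j i, pderiv_comm (Sum.inl i : ι ⊕ κ) (.inl j)]
  simp only [hcomm i j]
  have h2 : ∑ k, ∑ l, a i l * (a j k * pderiv 𝓡 (.inr l) (pderiv 𝓡 (.inr k) F)) =
      ∑ k, ∑ l, a j l * (a i k * pderiv 𝓡 (.inr l) (pderiv 𝓡 (.inr k) F)) := by
    rw [Finset.sum_comm]
    refine Finset.sum_congr rfl fun k _ => Finset.sum_congr rfl fun l _ => ?_
    rw [pderiv_comm, mul_left_comm]
  rw [h2]
  ring

/-- A formal solution of the radial equation is annihilated by the commuting fields. -/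
lemma graphField_eq_zero [Algebra ℚ 𝓡]
    (hcomm : ∀ i j k, graphField a i (a j k) = graphField a j (a i k))
    {F : MvPowerSeries (ι ⊕ κ) 𝓡} (hF : ∑ j, X (.inl j) * graphField a j F = 0) (j : ι) :
    graphField a j F = 0 := by
  classical
  -- Z_j is applied to the radial equation. Since Z_j z_i = δ_ij and the fields commute, u = Z_j F
  -- is an eigenvector of the radial operator with eigenvalue -1.
  have h1 : ∑ i, X (.inl i) * graphField a i (graphField a j F) = - graphField a j F := by
    have h2 := congrArg (graphField a j) hF
    rw [graphField_zero, graphField_sum] at h2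
    simp only [graphField_mul, graphField_X_inl, mul_ite, mul_one, mul_zero,
      Finset.sum_add_distrib, Finset.sum_ite_eq', Finset.mem_univ, if_true] at h2
    simp only [graphField_comm hcomm _ j]
    exact eq_neg_of_add_eq_zero_left h2
  refine LeftVanish.eq_zero fun d => ?_
  induction d with
  | zero => exact fun α hα => absurd hα (Nat.not_lt_zero _)
  | succ d ih =>
    intro α hα
    have h3 := congrArg (coeff α) h1
    rw [coeff_sum_X_mul_graphField, ih.slopeField α hα, add_zero, map_neg] at h3
    -- The factor d + 1 is cancelled through the ℚ-module structure, as 𝓡 need not be a domain.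
    have h4 : ((leftDegree α + 1 : ℕ) : ℚ) • coeff α (graphField a j F) = 0 := by
      rw [Nat.cast_smul_eq_nsmul, nsmul_eq_mul]
      push_cast
      linear_combination h3
    exact (smul_eq_zero_iff_right (by positivity)).1 h4

/-- Division of the coefficients by the degree in the first group of variables. -/
noncomputable def divLeftDegree [Algebra ℚ 𝓡] (F : MvPowerSeries (ι ⊕ κ) 𝓡) :
    MvPowerSeries (ι ⊕ κ) 𝓡 := fun α => ((leftDegree α : ℚ)⁻¹) • coeff α F

lemma coeff_divLeftDegree [Algebra ℚ 𝓡] (F : MvPowerSeries (ι ⊕ κ) 𝓡) (α : ι ⊕ κ →₀ ℕ) :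
    coeff α (divLeftDegree F) = ((leftDegree α : ℚ)⁻¹) • coeff α F := rfl

/-- Existence of a formal solution of the radial equation with initial value `w_l`. -/
lemma exists_formal_radial [Algebra ℚ 𝓡] (a : ι → κ → MvPowerSeries (ι ⊕ κ) 𝓡)
    (F₀ : MvPowerSeries (ι ⊕ κ) 𝓡) :
    ∃ F : MvPowerSeries (ι ⊕ κ) 𝓡, F = F₀ - divLeftDegree (slopeField a F) := by
  -- T gains one order in z, so it is a contraction for the filtration by left degree and its
  -- iterates stabilise coefficientwise.
  let T : MvPowerSeries (ι ⊕ κ) 𝓡 → MvPowerSeries (ι ⊕ κ) 𝓡 := fun F =>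
    F₀ - divLeftDegree (slopeField a F)
  have hT : ∀ {d F H}, LeftVanish d (F - H) → LeftVanish (d + 1) (T F - T H) := by
    intro d F H h α hα
    have h1 := h.slopeField (a := a) α hα
    rw [slopeField_sub, map_sub, sub_eq_zero] at h1
    simp only [T, map_sub, coeff_divLeftDegree, h1, sub_self]
  have hn : ∀ n, LeftVanish n (T^[n + 1] 0 - T^[n] 0) := by
    intro n
    induction n with
    | zero => exact fun α hα => absurd hα (Nat.not_lt_zero _)
    | succ n ih =>
      rw [Function.iterate_succ_apply', Function.iterate_succ_apply' (n := n)]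
      rw [Function.iterate_succ_apply'] at ih
      exact hT ih
  have hm : ∀ α : ι ⊕ κ →₀ ℕ, ∀ n, leftDegree α < n →
      coeff α (T^[n] 0) = coeff α (T^[leftDegree α + 1] 0) := by
    intro α n hα
    induction n, Nat.succ_le_of_lt hα using Nat.le_induction with
    | base => rfl
    | succ n hn' ih =>
      rw [← ih hn', ← sub_eq_zero, ← map_sub]
      exact hn n α hn'
  -- A coefficient of left degree d no longer changes after d + 1 iterations; the fixed point is
  -- read off there.
  let F : MvPowerSeries (ι ⊕ κ) 𝓡 := fun α => coeff α (T^[leftDegree α + 1] 0)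
  have hF : ∀ n, LeftVanish n (F - T^[n] 0) := fun n α hα => by
    rw [map_sub, hm α n hα, sub_eq_zero]
    rfl
  refine ⟨F, ?_⟩
  change F = T F
  rw [← sub_eq_zero]
  refine LeftVanish.eq_zero fun d => ?_
  cases d with
  | zero => exact fun α hα => absurd hα (Nat.not_lt_zero _)
  | succ d =>
    intro α hα
    have h1 := hF (d + 1) α hα
    have h2 := hT (hF d) α hα
    rw [Function.iterate_succ_apply'] at h1
    rw [map_sub, sub_eq_zero] at h1 h2 ⊢
    rw [h1, h2]

end Formal

end HolFrob

/-! ### Majorants for the formal solution. -/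

namespace HolFrob

lemma summable_pow_degree {σ : Type} [Finite σ] {q : ℝ} (h0 : 0 ≤ q) (h1 : q < 1) :
    Summable fun α : σ →₀ ℕ => q ^ α.degree := by
  classical
  have := Fintype.ofFinite σ
  let E : (σ →₀ ℕ) ≃ (Fin (Fintype.card σ) → ℕ) :=
    Finsupp.equivFunOnFinite.trans ((Fintype.equivFin σ).arrowCongr (Equiv.refl ℕ))
  have h2 := (E.summable_iff).2 (summable_fin_prod_pow (q := fun _ => q) (fun _ => h0) fun _ => h1)
  refine h2.congr fun α => ?_
  rw [Function.comp_apply, Finset.prod_pow_eq_pow_sum, Finsupp.degree_eq_sum,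
    ← (Fintype.equivFin σ).sum_comp]
  simp [E]

/-- A splitting of α is determined by its first part, so each such sum is a partial sum of one
convergent series. Convolutions thus cost a constant independent of α. -/
lemma exists_sum_antidiagonal_le (σ : Type) [Finite σ] [DecidableEq σ] : ∃ S₀ : ℝ, 0 ≤ S₀ ∧
    ∀ α : σ →₀ ℕ, ∑ p ∈ Finset.HasAntidiagonal.antidiagonal α, (2⁻¹ : ℝ) ^ p.1.degree ≤ S₀ := by
  have hs := summable_pow_degree (σ := σ) (q := 2⁻¹) (by norm_num) (by norm_num)
  refine ⟨∑' α : σ →₀ ℕ, (2⁻¹ : ℝ) ^ α.degree, tsum_nonneg fun α => by positivity, fun α => ?_⟩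
  have hinj : Set.InjOn Prod.fst
      (Finset.HasAntidiagonal.antidiagonal α : Set ((σ →₀ ℕ) × (σ →₀ ℕ))) := by
    intro p hp p' hp' h
    rw [Finset.mem_coe, Finset.HasAntidiagonal.mem_antidiagonal] at hp hp'
    refine Prod.ext h ?_
    rw [← hp', h] at hp
    exact add_left_cancel hp
  rw [← Finset.sum_image (f := fun β : σ →₀ ℕ => (2⁻¹ : ℝ) ^ β.degree) hinj]
  exact hs.sum_le_tsum _ fun β _ => by positivity

section FormalBound

open MvPowerSeries Finsupp

/-- With (e''+1) binom(d''+e''+1, d'') = (d''+e''+1) binom(d''+e'', d''), monotonicity of the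
binomials and the analogous identity for (d+1, e), the factor g + 1 from a w-derivative becomes d +
1. The division by the left degree removes the latter. -/
lemma succ_mul_choose_le {d'' e'' g d e : ℕ} (hd : d'' ≤ d) (he : e'' ≤ e) (hg : g ≤ e'') :
    (g + 1) * (d'' + (e'' + 1)).choose d'' ≤ (d + 1) * (d + 1 + e).choose (d + 1) := by
  have h1 : (d'' + (e'' + 1)).choose d'' * (e'' + 1) = (d'' + e'' + 1) * (d'' + e'').choose d'' := by
    have := Nat.choose_mul_succ_eq (d'' + e'') d''
    rw [show d'' + e'' + 1 - d'' = e'' + 1 by omega] at this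
    rw [← add_assoc, ← this, mul_comm]
  have h2 : (d + e + 1) * (d + e).choose d = (d + 1 + e).choose (d + 1) * (d + 1) := by
    rw [Nat.add_one_mul_choose_eq, add_right_comm]
  have h3 : (d'' + e'').choose d'' ≤ (d + e).choose d := by
    calc (d'' + e'').choose d'' ≤ (d'' + e).choose d'' := Nat.choose_le_choose _ (by omega)
      _ = (d'' + e).choose e := Nat.choose_symm_add
      _ ≤ (d + e).choose e := Nat.choose_le_choose _ (by omega)
      _ = (d + e).choose d := Nat.choose_symm_add.symm
  calc (g + 1) * (d'' + (e'' + 1)).choose d'' ≤ (e'' + 1) * (d'' + (e'' + 1)).choose d'' := by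
        gcongr
    _ = (d'' + e'' + 1) * (d'' + e'').choose d'' := by rw [mul_comm, h1]
    _ ≤ (d + e + 1) * (d + e).choose d := by gcongr
    _ = _ := by rw [h2, mul_comm]

/-- One summand of the recursion: writing Q = (2Q)·(1/2) splits off the weight 2^(-|β|) that makes
the sum over splittings converge. -/
lemma majorant_term_le {d'' e'' g b₁ b₂ d e : ℕ} (hd : b₁ + d'' = d) (he : b₂ + e'' = e)
    (hg : g ≤ e'') {Q K : ℝ} (hQ : 1 ≤ Q) (hK : 2 * Q ≤ K) :
    Q ^ (b₁ + b₂) * ((g + 1 : ℕ) * (K ^ d'' * (2 * Q) ^ (e'' + 1) * (d'' + (e'' + 1)).choose d'')) ≤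
      K ^ d * (2 * Q) ^ (e + 1) * ((d + 1 : ℕ) * (d + 1 + e).choose (d + 1)) *
        (2⁻¹ : ℝ) ^ (b₁ + b₂) := by
  have h1 : ((g + 1 : ℕ) : ℝ) * (d'' + (e'' + 1)).choose d'' ≤
      (d + 1 : ℕ) * (d + 1 + e).choose (d + 1) := by
    exact_mod_cast succ_mul_choose_le (by omega) (by omega) hg
  have hQ0 : 0 < Q := by linarith
  have h2 : Q ^ (b₁ + b₂) = (2 * Q) ^ b₁ * (2 * Q) ^ b₂ * (2⁻¹ : ℝ) ^ (b₁ + b₂) := by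
    rw [← pow_add, ← mul_pow]
    congr 1
    ring
  calc _ = (2 * Q) ^ b₁ * K ^ d'' * ((2 * Q) ^ b₂ * (2 * Q) ^ (e'' + 1)) *
        ((g + 1 : ℕ) * (d'' + (e'' + 1)).choose d'') * (2⁻¹ : ℝ) ^ (b₁ + b₂) := by
        rw [h2]; ring
    _ ≤ K ^ b₁ * K ^ d'' * ((2 * Q) ^ b₂ * (2 * Q) ^ (e'' + 1)) *
        ((d + 1 : ℕ) * (d + 1 + e).choose (d + 1)) * (2⁻¹ : ℝ) ^ (b₁ + b₂) := by
        have : 0 < K := by linarith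
        gcongr
    _ = _ := by rw [← pow_add, ← pow_add, hd, ← add_assoc, he]

variable {ι κ 𝓡 : Type} [Fintype ι] [Fintype κ] [CommRing 𝓡] [Algebra ℚ 𝓡]

/-- An abstract size predicate on a `ℚ`-algebra, behaving like `‖x‖ ≤ C`. -/
structure SizeBound (P : 𝓡 → ℝ → Prop) (K₀ : ℝ) : Prop where
  nonneg : 0 ≤ K₀
  zero : P 0 0
  add : ∀ {x y C D}, P x C → P y D → P (x + y) (C + D)
  mul : ∀ {x y C D}, P x C → P y D → P (x * y) (K₀ * (C * D))
  smul : ∀ (c : ℚ) {x C}, P x C → P (c • x) (|(c : ℝ)| * C)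
  mono : ∀ {x C D}, P x C → C ≤ D → P x D

lemma SizeBound.sum {P : 𝓡 → ℝ → Prop} {K₀ : ℝ} (h : SizeBound P K₀) {τ : Type} (s : Finset τ)
    {x : τ → 𝓡} {C : τ → ℝ} (hx : ∀ i ∈ s, P (x i) (C i)) : P (∑ i ∈ s, x i) (∑ i ∈ s, C i) := by
  classical
  induction s using Finset.induction_on with
  | empty => simpa using h.zero
  | insert i s hi ih =>
    rw [Finset.sum_insert hi, Finset.sum_insert hi]
    exact h.add (hx i (Finset.mem_insert_self _ _)) (ih fun j hj => hx j (Finset.mem_insert_of_mem hj))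

lemma coeff_slopeField (a : ι → κ → MvPowerSeries (ι ⊕ κ) 𝓡) (F : MvPowerSeries (ι ⊕ κ) 𝓡)
    (α : ι ⊕ κ →₀ ℕ) [DecidableEq (ι ⊕ κ)] :
    coeff α (slopeField a F) = ∑ j, if single (.inl j) 1 ≤ α then
      ∑ k, ∑ p ∈ Finset.HasAntidiagonal.antidiagonal (α - single (.inl j) 1), coeff p.1 (a j k) *
        (((p.2 (.inr k) + 1 : ℕ) : ℚ) • coeff (p.2 + single (.inr k) 1) F) else 0 := by
  rw [slopeField, map_sum]
  refine Finset.sum_congr rfl fun j _ => ?_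
  rw [coeff_X_mul_eq_ite, map_sum]
  simp only [coeff_mul, coeff_pderiv, Nat.cast_smul_eq_nsmul, nsmul_eq_mul]
  push_cast
  simp only [mul_comm]

/-- The solutions of the radial equation obey Cauchy estimates. -/
lemma radial_bound {P : 𝓡 → ℝ → Prop} {K₀ : ℝ} (hP : SizeBound P K₀) {C₁ : ℝ} (h1 : P 1 C₁)
    (hC₁ : 0 ≤ C₁)
    {a : ι → κ → MvPowerSeries (ι ⊕ κ) 𝓡} {M Q : ℝ} (hM : 0 ≤ M) (hQ : 1 ≤ Q)
    (ha : ∀ j k α, P (coeff α (a j k)) (M * Q ^ α.degree)) {l : κ}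
    {F : MvPowerSeries (ι ⊕ κ) 𝓡} (hF : F = X (.inr l) - divLeftDegree (slopeField a F)) :
    ∃ K : ℝ, 1 ≤ K ∧ ∀ α, P (coeff α F) (C₁ * K ^ α.degree) := by
  classical
  obtain ⟨L, hL⟩ : ∃ L, L = 2 * Q := ⟨_, rfl⟩
  obtain ⟨S₀, hS0, hS₀⟩ := exists_sum_antidiagonal_le (ι ⊕ κ)
  -- The cost of one step of the recursion: the product constant, the size of the a_j^k, the sum
  -- over splittings and the number of pairs (j, k).
  set A : ℝ := K₀ * M * S₀ * Fintype.card κ * Fintype.card ι with hA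
  have hK0 := hP.nonneg
  have hA0 : 0 ≤ A := by positivity
  -- A step costs A and also one factor L, because the w-derivative raises the right degree by one.
  -- This K pays for L · A.
  obtain ⟨K, hK⟩ : ∃ K, K = L * (1 + A) := ⟨_, rfl⟩
  have hL2 : 2 ≤ L := by linarith
  have hKL : L ≤ K := by rw [hK]; nlinarith
  have hL0 : 0 < L := by linarith
  have hKpos : 0 < K := by linarith
  -- A plain geometric bound is not stable under the recursion because of the derivative in w; the
  -- binomial factor makes it so.
  have key : ∀ d, ∀ α : ι ⊕ κ →₀ ℕ, leftDegree α = d → P (coeff α F)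
      (C₁ * (K ^ d * L ^ rightDegree α * (d + rightDegree α).choose d)) := by
    intro d
    induction d using Nat.strong_induction_on with
    | _ d ih =>
    intro α hα
    rw [hF, map_sub, coeff_divLeftDegree]
    rcases d with _ | d
    -- In left degree 0 the convention `0⁻¹ = 0` removes the slope term and leaves the initial value
    -- w_l.
    · rw [hα, Nat.cast_zero, inv_zero, zero_smul, sub_zero, coeff_X]
      split_ifs with h
      · refine hP.mono h1 ?_
        rw [h, rightDegree_single_inr]
        simp only [pow_zero, pow_one, one_mul, zero_add, Nat.choose_zero_right, Nat.cast_one,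
          mul_one]
        nlinarith
      · exact hP.mono hP.zero (by positivity)
    · have h0 : coeff α (X (.inr l) : MvPowerSeries (ι ⊕ κ) 𝓡) = 0 := by
        rw [coeff_X, if_neg]
        rintro rfl
        rw [leftDegree_single_inr] at hα
        omega
      set B : ℝ := C₁ * (K ^ d * L ^ (rightDegree α + 1) *
        ((d + 1 : ℕ) * (d + 1 + rightDegree α).choose (d + 1))) with hB
      have h2 : P (coeff α (slopeField a F)) (∑ _j : ι, ∑ _k : κ, K₀ * M * B * S₀) := by
        rw [coeff_slopeField]
        refine hP.sum _ fun j _ => ?_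
        split_ifs with hj
        · refine hP.sum _ fun k _ => ?_
          refine hP.mono (hP.sum (C := fun p => K₀ * M * B * (2⁻¹ : ℝ) ^ p.1.degree) _
            fun p hp => ?_) ?_
          · rw [Finset.HasAntidiagonal.mem_antidiagonal] at hp
            have h3 : p.1 + p.2 + single (.inl j) 1 = α := by rw [hp, tsub_add_cancel_of_le hj]
            have h4 := congrArg leftDegree h3
            have h5 := congrArg rightDegree h3
            simp only [leftDegree_add, rightDegree_add, leftDegree_single_inl,
              rightDegree_single_inl, hα, add_zero] at h4 h5
            have h6 := ih (leftDegree p.2) (by omega) (p.2 + single (.inr k) 1) (by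
              rw [leftDegree_add, leftDegree_single_inr, add_zero])
            rw [rightDegree_add, rightDegree_single_inr] at h6
            have h7 : p.2 (.inr k) ≤ rightDegree p.2 :=
              Finset.single_le_sum (f := fun k => p.2 (.inr k)) (fun _ _ => Nat.zero_le _)
                (Finset.mem_univ k)
            refine hP.mono (hP.mul (ha j k p.1) (hP.smul _ h6)) ?_
            have h8 := majorant_term_le (K := K) (Q := Q) (b₁ := leftDegree p.1)
              (d'' := leftDegree p.2) (d := d) (by omega) h5 h7 hQ (hL ▸ hKL)
            rw [degree_eq_left_add_right p.1, Rat.cast_natCast, Nat.abs_cast]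
            calc _ = K₀ * M * C₁ * (Q ^ (leftDegree p.1 + rightDegree p.1) *
                  ((p.2 (.inr k) + 1 : ℕ) * (K ^ leftDegree p.2 * (2 * Q) ^ (rightDegree p.2 + 1) *
                    (leftDegree p.2 + (rightDegree p.2 + 1)).choose (leftDegree p.2)))) := by
                  rw [hL]; ring
              _ ≤ K₀ * M * C₁ * _ := mul_le_mul_of_nonneg_left h8 (by positivity)
              _ = _ := by rw [hB, hL]; ring
          · rw [← Finset.mul_sum]
            exact mul_le_mul_of_nonneg_left (hS₀ _) (by positivity)
        · exact hP.mono hP.zero (by positivity)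
      rw [h0, zero_sub, ← neg_smul]
      refine hP.mono (hP.smul _ h2) ?_
      simp only [Finset.sum_const, Finset.card_univ, nsmul_eq_mul]
      have h9 : |((-((leftDegree α : ℚ)⁻¹) : ℚ) : ℝ)| = ((d + 1 : ℕ) : ℝ)⁻¹ := by
        rw [hα]
        push_cast
        rw [abs_neg, abs_of_pos (by positivity)]
      rw [h9]
      have h10 : ((d + 1 : ℕ) : ℝ) ≠ 0 := by positivity
      calc _ = C₁ * K ^ d * L ^ rightDegree α * (d + 1 + rightDegree α).choose (d + 1) *
            (L * A) := by rw [hB, hA]; field_simp; ring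
        _ ≤ C₁ * K ^ d * L ^ rightDegree α * (d + 1 + rightDegree α).choose (d + 1) * K := by
            gcongr
            linarith [mul_one_add L A]
        _ = _ := by ring
  -- The factor 2 absorbs the binomial, since L ≤ K and binom(d+e, d) ≤ 2^(d+e).
  refine ⟨2 * K, by linarith, fun α => hP.mono (key _ α rfl) ?_⟩
  rw [degree_eq_left_add_right]
  have h3 : (((leftDegree α + rightDegree α).choose (leftDegree α) : ℕ) : ℝ) ≤
      2 ^ (leftDegree α + rightDegree α) := by exact_mod_cast Nat.choose_le_two_pow _ _
  calc _ ≤ C₁ * (K ^ leftDegree α * K ^ rightDegree α * 2 ^ (leftDegree α + rightDegree α)) := by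
        gcongr
    _ = _ := by rw [mul_pow, ← pow_add]; ring

/-- Formal Frobenius theorem with estimates for commuting fields in graph form. -/
theorem exists_formal_first_integral {P : 𝓡 → ℝ → Prop} {K₀ : ℝ} (hP : SizeBound P K₀) {C₁ : ℝ}
    (h1 : P 1 C₁) (hC₁ : 0 ≤ C₁) {a : ι → κ → MvPowerSeries (ι ⊕ κ) 𝓡} {M Q : ℝ} (hM : 0 ≤ M)
    (hQ : 1 ≤ Q) (ha : ∀ j k α, P (coeff α (a j k)) (M * Q ^ α.degree))
    (hcomm : ∀ i j k, graphField a i (a j k) = graphField a j (a i k)) (l : κ) :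
    ∃ (F : MvPowerSeries (ι ⊕ κ) 𝓡) (K : ℝ), 1 ≤ K ∧ (∀ α, P (coeff α F) (C₁ * K ^ α.degree)) ∧
      (∀ j, graphField a j F = 0) ∧ coeff 0 F = 0 ∧
      ∀ k, coeff (single (.inr k) 1) F = coeff (single (.inr k) 1) (X (Sum.inr l) : MvPowerSeries (ι ⊕ κ) 𝓡) := by
  classical
  obtain ⟨F, hF⟩ := exists_formal_radial a (X (.inr l) : MvPowerSeries (ι ⊕ κ) 𝓡)
  obtain ⟨K, hK, hb⟩ := radial_bound hP h1 hC₁ hM hQ ha hF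
  -- Because `0⁻¹ = 0`, the fixed-point equation also encodes the initial condition F = w_l on z =
  -- 0.
  have h0 : ∀ α, leftDegree α = 0 → coeff α F = coeff α (X (.inr l)) := fun α hα => by
    rw [hF, map_sub, coeff_divLeftDegree, hα, Nat.cast_zero, inv_zero, zero_smul, sub_zero]
  refine ⟨F, K, hK, hb, graphField_eq_zero hcomm ?_, ?_, fun k => h0 _ (leftDegree_single_inr k 1)⟩
  · ext α
    rw [coeff_sum_X_mul_graphField, map_zero]
    by_cases hα : leftDegree α = 0
    · have h2 : LeftVanish 1 (slopeField a F) :=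
        LeftVanish.slopeField fun β hβ => absurd hβ (Nat.not_lt_zero _)
      rw [hα, h2 α (by omega), Nat.cast_zero, zero_mul, add_zero]
    · have h2 : coeff α F = - ((leftDegree α : ℚ)⁻¹ • coeff α (slopeField a F)) := by
        conv_lhs => rw [hF, map_sub, coeff_divLeftDegree]
        rw [coeff_X, if_neg, zero_sub]
        rintro rfl
        exact hα (leftDegree_single_inr l 1)
      rw [h2, ← nsmul_eq_mul, smul_neg, ← Nat.cast_smul_eq_nsmul ℚ, smul_smul,
        mul_inv_cancel₀ (by exact_mod_cast hα), one_smul, neg_add_cancel]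
  · rw [h0 0 (by simp [leftDegree]), coeff_zero_X]

end FormalBound

end HolFrob

namespace HolFrob

set_option linter.unusedSectionVars false

/-! ### Convergent power series: termwise differentiation and uniqueness. -/

section Evaluation

open Finsupp

lemma summable_degree_pow_mul_pow {σ : Type} [Finite σ] (j : ℕ) {q : ℝ} (h0 : 0 ≤ q) (h1 : q < 1) :
    Summable fun α : σ →₀ ℕ => ((α.degree : ℝ) + 1) ^ j * q ^ α.degree := by
  obtain ⟨q', hq, hq1⟩ := exists_between h1
  obtain ⟨p, hp, hp1⟩ := exists_between hq1
  have hq0 : 0 < q' := h0.trans_lt hq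
  have hp0 : 0 < p := hq0.trans hp
  have h2 : Summable fun n : ℕ => ((n : ℝ) + 1) ^ j * (q' / p) ^ n := by
    have h3 : ‖q' / p‖ < 1 := by
      rw [Real.norm_of_nonneg (by positivity)]
      exact (div_lt_one hp0).2 hp
    have h4 := (summable_nat_add_iff (f := fun n : ℕ => (n : ℝ) ^ j * (q' / p) ^ n) 1).2
      (summable_pow_mul_geometric_of_norm_lt_one j h3)
    refine (h4.mul_left (p / q')).congr fun n => ?_
    rw [pow_succ]
    push_cast
    field_simp
  obtain ⟨B, hB⟩ : ∃ B, ∀ n : ℕ, ((n : ℝ) + 1) ^ j * (q' / p) ^ n ≤ B :=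
    ⟨_, fun n => h2.le_tsum n fun m _ => by positivity⟩
  refine Summable.of_nonneg_of_le (fun α => by positivity) (fun α => ?_)
    ((summable_pow_degree (σ := σ) hp0.le hp1).mul_left B)
  calc _ ≤ ((α.degree : ℝ) + 1) ^ j * q' ^ α.degree := by gcongr
    _ = (((α.degree : ℝ) + 1) ^ j * (q' / p) ^ α.degree) * p ^ α.degree := by
        rw [mul_assoc, ← mul_pow, div_mul_cancel₀ _ hp0.ne']
    _ ≤ _ := by gcongr; exact hB _

variable {σ : Type} [Fintype σ]

/-- The monomial `x^α`. -/
noncomputable def mono (α : σ →₀ ℕ) (x : σ → ℂ) : ℂ := ∏ i, x i ^ α i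

lemma mono_zero (x : σ → ℂ) : mono 0 x = 1 := by simp [mono]

lemma mono_add (α β : σ →₀ ℕ) (x : σ → ℂ) : mono (α + β) x = mono α x * mono β x := by
  simp [mono, pow_add, Finset.prod_mul_distrib]

lemma mono_apply_zero {α : σ →₀ ℕ} (h : α ≠ 0) : mono α 0 = 0 := by
  obtain ⟨i, hi⟩ := Finsupp.ne_iff.1 h
  exact Finset.prod_eq_zero (Finset.mem_univ i) (by simpa using hi)

lemma norm_mono_le (α : σ →₀ ℕ) {x : σ → ℂ} {ρ : ℝ} (hx : ‖x‖ ≤ ρ) :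
    ‖mono α x‖ ≤ ρ ^ α.degree := by
  rw [mono, norm_prod, Finsupp.degree_eq_sum, ← Finset.prod_pow_eq_pow_sum]
  refine Finset.prod_le_prod (fun _ _ => norm_nonneg _) fun i _ => ?_
  rw [norm_pow]
  exact pow_le_pow_left₀ (norm_nonneg _) ((norm_le_pi_norm x i).trans hx) _

lemma mono_sub_single (α : σ →₀ ℕ) (i : σ) (x : σ → ℂ) [DecidableEq σ] :
    mono (α - single i 1) x = (∏ j ∈ Finset.univ.erase i, x j ^ α j) * x i ^ (α i - 1) := by
  rw [mono, ← Finset.prod_erase_mul _ _ (Finset.mem_univ i)]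
  congr 1
  · refine Finset.prod_congr rfl fun j hj => ?_
    rw [tsub_apply, single_eq_of_ne (Finset.ne_of_mem_erase hj), tsub_zero]
  · rw [tsub_apply, single_eq_same]

lemma hasFDerivAt_mono (α : σ →₀ ℕ) (x : σ → ℂ) :
    HasFDerivAt (mono α)
      (∑ i, ((α i : ℂ) * mono (α - single i 1) x) • (ContinuousLinearMap.proj i : (σ → ℂ) →L[ℂ] ℂ))
      x := by
  classical
  have h := HasFDerivAt.finsetProd (u := Finset.univ) (x := x)
    (g := fun i (x : σ → ℂ) => x i ^ α i) fun i _ => (hasFDerivAt_apply (𝕜 := ℂ) i x).pow (α i)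
  refine h.congr_fderiv (Finset.sum_congr rfl fun i _ => ?_)
  rw [mono_sub_single, smul_smul]
  congr 1
  simp only [nsmul_eq_mul]
  ring

lemma degree_sub_single_add_one {α : σ →₀ ℕ} {i : σ} (h : α i ≠ 0) :
    (α - single i 1).degree + 1 = α.degree := by
  have h1 : single i 1 ≤ α := Finsupp.single_le_iff.2 (Nat.one_le_iff_ne_zero.2 h)
  conv_rhs => rw [← tsub_add_cancel_of_le h1, map_add, degree_single]

lemma mul_pow_degree_sub_single_le (α : σ →₀ ℕ) (i : σ) {ρ : ℝ} (hρ : 0 < ρ) (j : ℕ) :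
    (α i : ℝ) * (((α - single i 1).degree + 1) ^ j * ρ ^ (α - single i 1).degree) ≤
      (α i : ℝ) * ((α.degree + 1) ^ j * (ρ ^ α.degree / ρ)) := by
  by_cases h : α i = 0
  · simp [h]
  · have h1 := degree_sub_single_add_one h
    have h2 : ρ ^ α.degree / ρ = ρ ^ (α - single i 1).degree := by
      rw [← h1, pow_succ, mul_div_cancel_right₀ _ hρ.ne']
    rw [h2]
    have h3 : ((α - single i 1).degree : ℝ) ≤ α.degree := by exact_mod_cast (by omega)
    gcongr

lemma sum_natCast_eq_degree (α : σ →₀ ℕ) : ∑ i, (α i : ℝ) = α.degree := by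
  rw [Finsupp.degree_eq_sum]; push_cast; rfl

variable {F : Type} [NormedAddCommGroup F] [NormedSpace ℂ F]

/-- The formal partial derivative of a power series with vector coefficients. -/
noncomputable def shiftDeriv (i : σ) (g : (σ →₀ ℕ) → F) (α : σ →₀ ℕ) : F :=
  ((α i : ℂ) + 1) • g (α + single i 1)

/-- The sum of a power series. -/
noncomputable def evalSeries (g : (σ →₀ ℕ) → F) (x : σ → ℂ) : F := ∑' α, mono α x • g α

variable {g : (σ →₀ ℕ) → F} {C K ρ : ℝ}

/-- The rate is doubled so that 2^|α| can absorb the linear factor α_i + 1. -/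
lemma norm_shiftDeriv_le (hg : ∀ α, ‖g α‖ ≤ C * K ^ α.degree) (i : σ)
    (α : σ →₀ ℕ) : ‖shiftDeriv i g α‖ ≤ C * K * (2 * K) ^ α.degree := by
  have h1 : α i ≤ α.degree := by
    rw [Finsupp.degree_eq_sum]
    exact Finset.single_le_sum (f := fun i => α i) (fun _ _ => Nat.zero_le _) (Finset.mem_univ i)
  have h2 : α.degree + 1 ≤ 2 ^ α.degree := Nat.lt_two_pow_self
  have h3 : ((α i : ℝ) + 1) ≤ 2 ^ α.degree := by
    exact_mod_cast (by omega : α i + 1 ≤ 2 ^ α.degree)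
  have h4 : ‖(α i : ℂ) + 1‖ = (α i : ℝ) + 1 := by
    have : ((α i : ℂ) + 1) = (((α i : ℝ) + 1 : ℝ) : ℂ) := by push_cast; rfl
    rw [this, Complex.norm_real, Real.norm_of_nonneg (by positivity)]
  rw [shiftDeriv, norm_smul, h4]
  calc _ ≤ 2 ^ α.degree * (C * K ^ (α.degree + 1)) := by
        gcongr
        refine (hg _).trans_eq ?_
        rw [map_add, degree_single]
    _ = _ := by rw [mul_pow]; ring

lemma norm_mono_smul_le (hg : ∀ α, ‖g α‖ ≤ C * K ^ α.degree) {x : σ → ℂ}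
    (hx : ‖x‖ ≤ ρ) (α : σ →₀ ℕ) : ‖mono α x • g α‖ ≤ C * (K * ρ) ^ α.degree := by
  have hρ := (norm_nonneg x).trans hx
  rw [norm_smul, mul_pow]
  calc _ ≤ ρ ^ α.degree * (C * K ^ α.degree) := by
        gcongr
        · exact norm_mono_le α hx
        · exact hg α
    _ = _ := by ring

lemma summable_norm_mono_smul (hK : 0 ≤ K) (hg : ∀ α, ‖g α‖ ≤ C * K ^ α.degree) {x : σ → ℂ}
    (hx : K * ‖x‖ < 1) : Summable fun α => ‖mono α x • g α‖ :=
  Summable.of_nonneg_of_le (fun _ => norm_nonneg _) (norm_mono_smul_le hg le_rfl)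
    ((summable_pow_degree (by positivity) hx).mul_left C)

variable [CompleteSpace F]

lemma hasSum_evalSeries (hK : 0 ≤ K) (hg : ∀ α, ‖g α‖ ≤ C * K ^ α.degree) {x : σ → ℂ}
    (hx : K * ‖x‖ < 1) : HasSum (fun α => mono α x • g α) (evalSeries g x) :=
  (summable_norm_mono_smul hK hg hx).of_norm.hasSum

lemma evalSeries_zero (g : (σ →₀ ℕ) → F) : evalSeries g 0 = g 0 := by
  rw [evalSeries, tsum_eq_single 0 fun α hα => by rw [mono_apply_zero hα, zero_smul], mono_zero,
    one_smul]

lemma evalSeries_shiftDeriv (i : σ) (x : σ → ℂ) :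
    evalSeries (shiftDeriv i g) x = ∑' α, ((α i : ℂ) * mono (α - single i 1) x) • g α := by
  have hinj : Function.Injective fun α : σ →₀ ℕ => α + single i 1 := add_left_injective _
  rw [← hinj.tsum_eq]
  · refine tsum_congr fun α => ?_
    rw [add_tsub_cancel_right, shiftDeriv, smul_smul, mul_comm]
    simp
  · intro α hα
    have h1 : α i ≠ 0 := fun h => hα (by simp [h])
    exact ⟨α - single i 1, tsub_add_cancel_of_le
      (Finsupp.single_le_iff.2 (Nat.one_le_iff_ne_zero.2 h1))⟩

/-- On a ball of radius q/K with K‖x‖ < q < 1 the differentiated terms are dominated by degree times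
q^degree, which is summable. -/
lemma hasFDerivAt_evalSeries (hC : 0 ≤ C) (hK : 0 < K) (hg : ∀ α, ‖g α‖ ≤ C * K ^ α.degree)
    {x : σ → ℂ} (hx : K * ‖x‖ < 1) :
    HasFDerivAt (evalSeries g) (∑ i, (ContinuousLinearMap.proj i : (σ → ℂ) →L[ℂ] ℂ).smulRight
      (evalSeries (shiftDeriv i g) x)) x := by
  obtain ⟨q, hq, hq1⟩ := exists_between hx
  have hq0 : 0 < q := (by positivity : 0 ≤ K * ‖x‖).trans_lt hq
  set ρ := q / K with hρ
  have hρ0 : 0 < ρ := by positivity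
  have hKρ : K * ρ = q := by rw [hρ]; field_simp
  have hxρ : x ∈ Metric.ball (0 : σ → ℂ) ρ := by
    rw [mem_ball_zero_iff, hρ, lt_div_iff₀ hK, mul_comm]; exact hq
  let D : (σ →₀ ℕ) → (σ → ℂ) → (σ → ℂ) →L[ℂ] F := fun α y =>
    ∑ i, (ContinuousLinearMap.proj i : (σ → ℂ) →L[ℂ] ℂ).smulRight
      (((α i : ℂ) * mono (α - single i 1) y) • g α)
  have hterm : ∀ i α, ∀ y ∈ Metric.ball (0 : σ → ℂ) ρ,
      ‖((α i : ℂ) * mono (α - single i 1) y) • g α‖ ≤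
        C / ρ * ((α i : ℝ) * q ^ α.degree) := by
    intro i α y hy
    have h1 := norm_mono_le (α - single i 1) (mem_ball_zero_iff.1 hy).le
    have h2 := mul_pow_degree_sub_single_le α i hρ0 0
    simp only [pow_zero, one_mul] at h2
    rw [norm_smul, norm_mul, Complex.norm_natCast]
    calc _ ≤ (α i : ℝ) * ρ ^ (α - single i 1).degree * (C * K ^ α.degree) := by
          gcongr
          exact hg α
      _ ≤ (α i : ℝ) * (ρ ^ α.degree / ρ) * (C * K ^ α.degree) := by gcongr
      _ = _ := by rw [← hKρ, mul_pow]; ring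
  have hle : ∀ (α : σ →₀ ℕ) i, (α i : ℝ) * q ^ α.degree ≤ (α.degree + 1) ^ 1 * q ^ α.degree := by
    intro α i
    rw [← sum_natCast_eq_degree]
    gcongr
    have := Finset.single_le_sum (f := fun i => (α i : ℝ)) (fun _ _ => Nat.cast_nonneg _)
      (Finset.mem_univ i)
    linarith
  have hsum := summable_degree_pow_mul_pow (σ := σ) 1 hq0.le hq1
  have hs : ∀ i, ∀ y ∈ Metric.ball (0 : σ → ℂ) ρ, Summable fun α : σ →₀ ℕ =>
      ((α i : ℂ) * mono (α - single i 1) y) • g α := fun i y hy =>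
    Summable.of_norm_bounded (hsum.mul_left (C / ρ)) fun α =>
      (hterm i α y hy).trans (mul_le_mul_of_nonneg_left (hle α i) (by positivity))
  have h := hasFDerivAt_tsum_of_isPreconnected (𝕜 := ℂ) (f := fun α y => mono α y • g α) (f' := D)
    (hsum.mul_left (C / ρ)) Metric.isOpen_ball (convex_ball (0 : σ → ℂ) ρ).isPreconnected
    (fun α y _ => ?_) (fun α y hy => ?_) (Metric.mem_ball_self hρ0)
    (hasSum_evalSeries hK.le hg (by simp)).summable hxρ
  · refine h.congr_fderiv ?_
    simp only [evalSeries_shiftDeriv]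
    have h4 : ∀ i : σ, Summable fun α => (ContinuousLinearMap.proj i : (σ → ℂ) →L[ℂ] ℂ).smulRight
        (((α i : ℂ) * mono (α - single i 1) x) • g α) := fun i =>
      (ContinuousLinearMap.smulRightL ℂ (σ → ℂ) F (.proj i)).summable (hs i x hxρ)
    rw [Summable.tsum_finsetSum fun i _ => h4 i]
    refine Finset.sum_congr rfl fun i _ => ?_
    exact ((ContinuousLinearMap.smulRightL ℂ (σ → ℂ) F (.proj i)).map_tsum (hs i x hxρ)).symm
  · refine ((hasFDerivAt_mono α y).smul_const (g α)).congr_fderiv ?_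
    ext v
    simp [D, Finset.sum_smul, smul_smul, mul_comm]
  · refine (norm_sum_le _ _).trans ?_
    calc _ ≤ ∑ i, C / ρ * ((α i : ℝ) * q ^ α.degree) := by
          refine Finset.sum_le_sum fun i _ => ?_
          rw [ContinuousLinearMap.norm_smulRight_apply]
          refine (mul_le_of_le_one_left (norm_nonneg _) ?_).trans (hterm i α y hy)
          refine ContinuousLinearMap.opNorm_le_bound _ zero_le_one fun v => ?_
          rw [one_mul]
          exact norm_le_pi_norm v i
      _ = C / ρ * (α.degree * q ^ α.degree) := by
          rw [← Finset.mul_sum, ← Finset.sum_mul, sum_natCast_eq_degree]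
      _ ≤ _ := by
          rw [pow_one]
          gcongr
          linarith

/-- Uniqueness of the power series expansion. -/
lemma eq_zero_of_evalSeries_eq_zero (hC : 0 ≤ C) (hK : 0 < K) (hg : ∀ α, ‖g α‖ ≤ C * K ^ α.degree)
    (h0 : ∀ᶠ x in nhds 0, evalSeries g x = 0) : g = 0 := by
  -- Induction on the degree: partial derivatives of a function vanishing near 0 vanish near 0, and
  -- a coefficient of degree n + 1 is, up to a nonzero integer, one of degree n of a derivative. The
  -- constants vary since differentiation doubles the rate.
  have key : ∀ (n : ℕ) (g : (σ →₀ ℕ) → F) (C K : ℝ), 0 ≤ C → 0 < K →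
      (∀ α, ‖g α‖ ≤ C * K ^ α.degree) → (∀ᶠ x in nhds 0, evalSeries g x = 0) →
      ∀ α, α.degree = n → g α = 0 := by
    intro n
    induction n with
    | zero =>
      intro g C K hC hK hg h0 α hα
      rw [(Finsupp.degree_eq_zero_iff α).1 hα, ← evalSeries_zero g]
      exact h0.self_of_nhds
    | succ n ih =>
      intro g C K hC hK hg h0 α hα
      obtain ⟨i, hi⟩ : ∃ i, α i ≠ 0 := by
        by_contra! h
        rw [show α = 0 from Finsupp.ext h, map_zero] at hα
        omega
      have h1 : single i 1 ≤ α := Finsupp.single_le_iff.2 (Nat.one_le_iff_ne_zero.2 hi)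
      have h2 : ∀ᶠ x in nhds (0 : σ → ℂ), K * ‖x‖ < 1 := by
        have : Continuous fun x : σ → ℂ => K * ‖x‖ := by fun_prop
        exact this.continuousAt.eventually_lt continuousAt_const (by simp)
      have h3 : ∀ᶠ x in nhds 0, evalSeries (shiftDeriv i g) x = 0 := by
        filter_upwards [h2, h0.eventually_nhds] with x hx hx0
        classical
        have h4 := (hasFDerivAt_evalSeries hC hK hg hx).unique
          ((hasFDerivAt_const (0 : F) x).congr_of_eventuallyEq hx0)
        have h5 := congrArg (fun L : (σ → ℂ) →L[ℂ] F => L (Pi.single i 1)) h4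
        simpa [Pi.single_apply] using h5
      have h6 := ih (shiftDeriv i g) (C * K) (2 * K) (by positivity) (by positivity)
        (norm_shiftDeriv_le hg i) h3 (α - single i 1)
        (by have := degree_sub_single_add_one hi; omega)
      rw [shiftDeriv, tsub_add_cancel_of_le h1, smul_eq_zero] at h6
      exact h6.resolve_left (Nat.cast_add_one_ne_zero _)
  exact funext fun α => key _ g C K hC hK hg h0 α rfl

end Evaluation

end HolFrob

namespace HolFrob

set_option linter.unusedSectionVars false

/-! ### Algebra and analyticity of convergent power series. -/

section Evaluation

open Finsupp MvPowerSeries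

variable {σ : Type} [Fintype σ] {F : Type} [NormedAddCommGroup F] [NormedSpace ℂ F]

/-- The coefficients satisfy Cauchy estimates with rate `K`. -/
def CoeffBound (K : ℝ) (g : (σ →₀ ℕ) → F) : Prop :=
  ∃ C, 0 ≤ C ∧ ∀ α, ‖g α‖ ≤ C * K ^ α.degree

namespace CoeffBound

variable {K K' : ℝ} {g h : (σ →₀ ℕ) → F}

lemma mono (hK : 0 ≤ K) (hg : CoeffBound K g) (hKK : K ≤ K') : CoeffBound K' g := by
  obtain ⟨C, hC, hg⟩ := hg
  exact ⟨C, hC, fun α => (hg α).trans (by gcongr)⟩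

lemma shiftDeriv (hK : 0 ≤ K) (hg : CoeffBound K g) (i : σ) :
    CoeffBound (2 * K) (shiftDeriv i g) := by
  obtain ⟨C, hC, hg⟩ := hg
  exact ⟨C * K, by positivity, norm_shiftDeriv_le hg i⟩

lemma add (hg : CoeffBound K g) (hh : CoeffBound K h) : CoeffBound K fun α => g α + h α := by
  obtain ⟨C, hC, hg⟩ := hg
  obtain ⟨D, hD, hh⟩ := hh
  exact ⟨C + D, by positivity, fun α => (norm_add_le _ _).trans (by
    rw [add_mul]; exact add_le_add (hg α) (hh α))⟩

lemma sum {τ : Type} (s : Finset τ) {g : τ → (σ →₀ ℕ) → F}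
    (hg : ∀ i ∈ s, CoeffBound K (g i)) : CoeffBound K fun α => ∑ i ∈ s, g i α := by
  classical
  induction s using Finset.induction_on with
  | empty => exact ⟨0, le_rfl, by simp⟩
  | insert i s hi ih =>
    simp only [Finset.sum_insert hi]
    exact (hg i (Finset.mem_insert_self _ _)).add (ih fun j hj => hg j (Finset.mem_insert_of_mem hj))

lemma neg (hg : CoeffBound K g) : CoeffBound K fun α => -g α := by
  obtain ⟨C, hC, hg⟩ := hg
  exact ⟨C, hC, fun α => by rw [norm_neg]; exact hg α⟩

/-- Doubling the rate leaves a weight 2^(-|p.1|), so the number of terms in the convolution does not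
enter. -/
lemma mul (hK : 0 ≤ K) {f g : MvPowerSeries σ ℂ} (hf : CoeffBound K fun α => coeff α f)
    (hg : CoeffBound K fun α => coeff α g) : CoeffBound (2 * K) fun α => coeff α (f * g) := by
  classical
  obtain ⟨C, hC, hf⟩ := hf
  obtain ⟨D, hD, hg⟩ := hg
  obtain ⟨S₀, hS0, hS₀⟩ := exists_sum_antidiagonal_le σ
  refine ⟨C * D * S₀, by positivity, fun α => ?_⟩
  change ‖coeff α (f * g)‖ ≤ _
  rw [coeff_mul]
  calc _ ≤ ∑ p ∈ Finset.HasAntidiagonal.antidiagonal α,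
        C * D * (2 * K) ^ α.degree * (2⁻¹ : ℝ) ^ p.1.degree := by
        refine (norm_sum_le _ _).trans (Finset.sum_le_sum fun p hp => ?_)
        rw [Finset.HasAntidiagonal.mem_antidiagonal] at hp
        have h1 : α.degree = p.1.degree + p.2.degree := by rw [← hp, map_add]
        have h2 : (1 : ℝ) ≤ 2 ^ p.2.degree := one_le_pow₀ (by norm_num)
        rw [norm_mul]
        calc _ ≤ (C * K ^ p.1.degree) * (D * K ^ p.2.degree) :=
              mul_le_mul (hf _) (hg _) (norm_nonneg _) (by positivity)
          _ ≤ (C * K ^ p.1.degree) * (D * K ^ p.2.degree) * 2 ^ p.2.degree :=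
              le_mul_of_one_le_right (by positivity) h2
          _ = C * D * K ^ α.degree * (2 ^ p.2.degree * (2 * 2⁻¹) ^ p.1.degree) := by
              rw [mul_inv_cancel₀ two_ne_zero, one_pow, h1, pow_add]; ring
          _ = _ := by rw [h1, mul_pow, mul_pow, pow_add, pow_add]; ring
    _ = C * D * (2 * K) ^ α.degree * ∑ p ∈ Finset.HasAntidiagonal.antidiagonal α,
        (2⁻¹ : ℝ) ^ p.1.degree := by rw [Finset.mul_sum]
    _ ≤ C * D * (2 * K) ^ α.degree * S₀ := by gcongr; exact hS₀ α
    _ = _ := by ring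

lemma pderiv (hK : 0 ≤ K) {f : MvPowerSeries σ ℂ} (hf : CoeffBound K fun α => coeff α f) (i : σ) :
    CoeffBound (2 * K) fun α => coeff α (MvPowerSeries.pderiv ℂ i f) := by
  refine (hf.shiftDeriv hK i).imp fun C hC => ⟨hC.1, fun α => ?_⟩
  change ‖coeff α (MvPowerSeries.pderiv ℂ i f)‖ ≤ _
  rw [coeff_pderiv, mul_comm]
  exact hC.2 α

end CoeffBound

variable {K : ℝ}

lemma evalSeries_add [CompleteSpace F] {g h : (σ →₀ ℕ) → F} (hK : 0 ≤ K) (hg : CoeffBound K g)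
    (hh : CoeffBound K h) {x : σ → ℂ} (hx : K * ‖x‖ < 1) :
    evalSeries (fun α => g α + h α) x = evalSeries g x + evalSeries h x := by
  obtain ⟨C, _, hg⟩ := hg
  obtain ⟨D, _, hh⟩ := hh
  simp only [evalSeries, smul_add]
  exact (hasSum_evalSeries hK hg hx).summable.tsum_add (hasSum_evalSeries hK hh hx).summable

lemma evalSeries_neg {g : (σ →₀ ℕ) → F} {x : σ → ℂ} :
    evalSeries (fun α => -g α) x = -evalSeries g x := by
  simp only [evalSeries, smul_neg, tsum_neg]

lemma evalSeries_sum [CompleteSpace F] {τ : Type} (s : Finset τ) {g : τ → (σ →₀ ℕ) → F} (hK : 0 ≤ K)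
    (hg : ∀ i ∈ s, CoeffBound K (g i)) {x : σ → ℂ} (hx : K * ‖x‖ < 1) :
    evalSeries (fun α => ∑ i ∈ s, g i α) x = ∑ i ∈ s, evalSeries (g i) x := by
  simp only [evalSeries, Finset.smul_sum]
  refine Summable.tsum_finsetSum fun i hi => ?_
  obtain ⟨C, _, hg⟩ := hg i hi
  exact (hasSum_evalSeries hK hg hx).summable

lemma tsum_mul_tsum_eq_tsum_antidiagonal [DecidableEq σ] {f g : (σ →₀ ℕ) → ℂ}
    (hf : Summable fun α => ‖f α‖) (hg : Summable fun α => ‖g α‖) :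
    (∑' α, f α) * ∑' α, g α =
      ∑' α, ∑ p ∈ Finset.HasAntidiagonal.antidiagonal α, f p.1 * g p.2 :=
  hf.of_norm.tsum_mul_tsum_eq_tsum_sum_antidiagonal hg.of_norm
    (summable_mul_of_summable_norm hf hg)

lemma evalSeries_mul {f g : MvPowerSeries σ ℂ} (hK : 0 ≤ K) (hf : CoeffBound K fun α => coeff α f)
    (hg : CoeffBound K fun α => coeff α g) {x : σ → ℂ} (hx : K * ‖x‖ < 1) :
    evalSeries (fun α => coeff α (f * g)) x =
      evalSeries (fun α => coeff α f) x * evalSeries (fun α => coeff α g) x := by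
  classical
  obtain ⟨C, _, hf⟩ := hf
  obtain ⟨D, _, hg⟩ := hg
  have hf' : Summable fun α => ‖HolFrob.mono α x * coeff α f‖ := summable_norm_mono_smul hK hf hx
  have hg' : Summable fun α => ‖HolFrob.mono α x * coeff α g‖ := summable_norm_mono_smul hK hg hx
  refine Eq.trans ?_ (tsum_mul_tsum_eq_tsum_antidiagonal hf' hg').symm
  refine tsum_congr fun α => ?_
  beta_reduce
  rw [coeff_mul, Finset.smul_sum]
  refine Finset.sum_congr rfl fun p hp => ?_
  rw [Finset.HasAntidiagonal.mem_antidiagonal] at hp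
  rw [← hp, mono_add, smul_eq_mul, mul_mul_mul_comm]

lemma evalSeries_pderiv (f : MvPowerSeries σ ℂ) (i : σ) (x : σ → ℂ) :
    evalSeries (fun α => coeff α (MvPowerSeries.pderiv ℂ i f)) x =
      evalSeries (shiftDeriv i fun α => coeff α f) x := by
  congr 1
  ext α
  rw [coeff_pderiv, mul_comm]
  rfl

lemma mono_single (i : σ) (x : σ → ℂ) : HolFrob.mono (single i 1) x = x i := by
  classical
  rw [HolFrob.mono, Finset.prod_eq_single i]
  · simp
  · intro j _ hj
    rw [single_eq_of_ne hj, pow_zero]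
  · simp

/-- The monomials as multilinear maps on the diagonal. -/
lemma exists_multilinear_mono (n : ℕ) (α : σ →₀ ℕ) :
    ∃ M : ContinuousMultilinearMap ℂ (fun _ : Fin n => σ → ℂ) ℂ, ‖M‖ ≤ 1 ∧
      (α.degree = n → ∀ x, M (fun _ => x) = HolFrob.mono α x) := by
  classical
  by_cases hα : α.degree = n
  · obtain ⟨L, hL⟩ : ∃ L : Fin n → σ, ∀ x : σ → ℂ, ∏ j, x (L j) = HolFrob.mono α x := by
      induction n generalizing α with
      | zero =>
        rw [(Finsupp.degree_eq_zero_iff α).1 hα]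
        exact ⟨Fin.elim0, fun x => by simp [mono_zero]⟩
      | succ n ih =>
        obtain ⟨i, hi⟩ : ∃ i, α i ≠ 0 := by
          by_contra! h
          rw [show α = 0 from Finsupp.ext h, map_zero] at hα
          omega
        obtain ⟨L, hL⟩ := ih (α - single i 1)
          (by have := degree_sub_single_add_one hi; omega)
        refine ⟨Fin.cons i L, fun x => ?_⟩
        have h1 : single i 1 ≤ α := Finsupp.single_le_iff.2 (Nat.one_le_iff_ne_zero.2 hi)
        rw [Fin.prod_univ_succ]
        simp only [Fin.cons_zero, Fin.cons_succ, hL]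
        conv_rhs => rw [← tsub_add_cancel_of_le h1, mono_add, mono_single, mul_comm]
    refine ⟨(ContinuousMultilinearMap.mkPiAlgebra ℂ (Fin n) ℂ).compContinuousLinearMap
      fun j => .proj (L j), ?_, fun _ x => ?_⟩
    · refine (ContinuousMultilinearMap.norm_compContinuousLinearMap_le _ _).trans ?_
      rw [ContinuousMultilinearMap.norm_mkPiAlgebra, one_mul]
      refine Finset.prod_le_one (fun _ _ => norm_nonneg _) fun j _ => ?_
      refine ContinuousLinearMap.opNorm_le_bound _ zero_le_one fun v => ?_
      rw [one_mul]
      exact norm_le_pi_norm v _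
    · simpa using hL x
  · exact ⟨0, by simp, fun h => absurd h hα⟩

/-- Grouping the monomials by total degree gives homogeneous polynomials, hence a
`FormalMultilinearSeries`. Absolute convergence justifies the regrouping. -/
lemma analyticAt_evalSeries [CompleteSpace F] {g : (σ →₀ ℕ) → F} (hK : 0 < K)
    (hg : CoeffBound K g) {x : σ → ℂ} (hx : K * ‖x‖ < 1) : AnalyticAt ℂ (evalSeries g) x := by
  classical
  obtain ⟨C, hC, hg⟩ := hg
  obtain ⟨q, hq, hq1⟩ := exists_between hx
  have hq0 : 0 < q := (by positivity : 0 ≤ K * ‖x‖).trans_lt hq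
  choose M hM1 hM using exists_multilinear_mono (σ := σ)
  let s : ℕ → Finset (σ →₀ ℕ) := fun n => Finset.univ.finsuppAntidiag n
  have hs : ∀ n α, α ∈ s n ↔ α.degree = n := fun n α => by
    simp [s, Finset.mem_finsuppAntidiag, Finsupp.degree_eq_sum]
  let p : FormalMultilinearSeries ℂ (σ → ℂ) F := fun n => ∑ α ∈ s n, (M n α).smulRight (g α)
  have hsum := summable_pow_degree (σ := σ) hq0.le hq1
  have hρ0 : 0 < q / K := by positivity
  lift q / K to NNReal using hρ0.le with ρ hρ
  have hKρ : K * ρ = q := by rw [hρ]; field_simp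
  have hp : HasFPowerSeriesOnBall (evalSeries g) p 0 ρ := by
    refine ⟨p.le_radius_of_bound (C * ∑' α : σ →₀ ℕ, q ^ α.degree) fun n => ?_,
      by exact_mod_cast hρ0, fun {y} hy => ?_⟩
    · calc _ ≤ (∑ α ∈ s n, C * K ^ n) * (ρ : ℝ) ^ n := by
            gcongr
            refine (norm_sum_le _ _).trans (Finset.sum_le_sum fun α hα => ?_)
            have h1 := hg α
            rw [(hs n α).1 hα] at h1
            refine (ContinuousMultilinearMap.opNorm_le_bound (by positivity) fun m => ?_).trans h1
            rw [ContinuousMultilinearMap.smulRight_apply, norm_smul, mul_comm]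
            gcongr
            exact ((M n α).le_opNorm m).trans (mul_le_of_le_one_left (by positivity) (hM1 n α))
        _ = C * ∑ α ∈ s n, q ^ α.degree := by
            rw [Finset.sum_mul, Finset.mul_sum]
            refine Finset.sum_congr rfl fun α hα => ?_
            rw [(hs n α).1 hα, ← hKρ, mul_pow]
            ring
        _ ≤ _ := by
            gcongr
            exact hsum.sum_le_tsum _ fun α _ => by positivity
    · rw [zero_add]
      have hy' : K * ‖y‖ < 1 := by
        rw [Metric.mem_eball, edist_zero_right, ← ofReal_norm, ENNReal.ofReal_lt_coe_iff
          (norm_nonneg _)] at hy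
        calc K * ‖y‖ < K * ρ := by gcongr
          _ < 1 := by rwa [hKρ]
      have h2 := (hasSum_evalSeries hK.le hg hy').tsum_fiberwise Finsupp.degree
      refine (congrArg (fun f => HasSum f (evalSeries g y)) (funext fun n => ?_)).mp h2
      have h3 : (Finsupp.degree ⁻¹' {n} : Set (σ →₀ ℕ)) = s n := by
        ext α
        simp [hs]
      rw [h3, Finset.tsum_subtype' (s n) fun α => HolFrob.mono α y • g α]
      simp only [p, _root_.sum_apply,
        ContinuousMultilinearMap.smulRight_apply]
      exact Finset.sum_congr rfl fun α hα => by rw [hM n α ((hs n α).1 hα)]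
  refine hp.analyticAt_of_mem ?_
  rw [Metric.mem_eball, edist_zero_right, ← ofReal_norm, ENNReal.ofReal_lt_coe_iff (norm_nonneg _),
    hρ, lt_div_iff₀ hK, mul_comm]
  exact hq

end Evaluation

end HolFrob

namespace HolFrob

set_option linter.unusedSectionVars false

/-! ### First integrals of graph fields with parameter. -/

section GraphFrobenius

open Finsupp MvPowerSeries

variable {ι κ : Type} [Fintype ι] [Fintype κ]

lemma map_pderiv {σ R R' : Type} [CommRing R] [CommRing R'] (φ : R →+* R') (i : σ)
    (F : MvPowerSeries σ R) :
    MvPowerSeries.map φ (pderiv R i F) = pderiv R' i (MvPowerSeries.map φ F) := by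
  ext α
  simp [coeff_pderiv]

lemma map_graphField {R R' : Type} [CommRing R] [CommRing R'] (φ : R →+* R')
    (a : ι → κ → MvPowerSeries (ι ⊕ κ) R) (j : ι) (F : MvPowerSeries (ι ⊕ κ) R) :
    MvPowerSeries.map φ (graphField a j F) =
      graphField (fun i k => MvPowerSeries.map φ (a i k)) j (MvPowerSeries.map φ F) := by
  simp only [graphField, map_add, map_sum, map_mul, map_pderiv]

/-- The vector `e_j + ∑_k c_k e_k` spanning a graph. -/
noncomputable def graphVec [DecidableEq ι] [DecidableEq κ] (j : ι) (c : κ → ℂ) : ι ⊕ κ → ℂ :=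
  Sum.elim (Pi.single j 1) c

variable [DecidableEq ι] [DecidableEq κ] {K : ℝ}

lemma CoeffBound.graphField (hK : 0 ≤ K) {a : ι → κ → MvPowerSeries (ι ⊕ κ) ℂ}
    (ha : ∀ j k, CoeffBound K fun α => coeff α (a j k)) {F : MvPowerSeries (ι ⊕ κ) ℂ}
    (hF : CoeffBound K fun α => coeff α F) (j : ι) :
    CoeffBound (4 * K) fun α => coeff α (graphField a j F) := by
  simp only [HolFrob.graphField, map_add, map_sum]
  refine ((hF.pderiv hK _).mono (by positivity) (by linarith)).add (.sum _ fun k _ => ?_)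
  rw [show 4 * K = 2 * (2 * K) by ring]
  exact .mul (by positivity) ((ha j k).mono hK (by linarith)) (hF.pderiv hK _)

lemma fderiv_evalSeries_apply {σ F : Type} [Fintype σ] [NormedAddCommGroup F] [NormedSpace ℂ F]
    [CompleteSpace F] {g : (σ →₀ ℕ) → F} (hK : 0 < K) (hg : CoeffBound K g) {x : σ → ℂ}
    (hx : K * ‖x‖ < 1) (v : σ → ℂ) :
    fderiv ℂ (evalSeries g) x v = ∑ i, v i • evalSeries (shiftDeriv i g) x := by
  obtain ⟨C, hC, hg⟩ := hg
  rw [(hasFDerivAt_evalSeries hC hK hg hx).fderiv]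
  simp [_root_.sum_apply]

/-- Evaluation intertwines the formal field with the actual one. The factor 4 is 2 for the
derivative times 2 for the product. -/
lemma evalSeries_graphField (hK : 0 < K) {a : ι → κ → MvPowerSeries (ι ⊕ κ) ℂ}
    (ha : ∀ j k, CoeffBound K fun α => coeff α (a j k)) {F : MvPowerSeries (ι ⊕ κ) ℂ}
    (hF : CoeffBound K fun α => coeff α F) (j : ι) {x : ι ⊕ κ → ℂ} (hx : 4 * K * ‖x‖ < 1) :
    evalSeries (fun α => coeff α (graphField a j F)) x =
      fderiv ℂ (evalSeries fun α => coeff α F) x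
        (graphVec j fun k => evalSeries (fun α => coeff α (a j k)) x) := by
  have hx2 : 2 * K * ‖x‖ < 1 := by nlinarith [norm_nonneg x]
  have hx1 : K * ‖x‖ < 1 := by nlinarith [norm_nonneg x]
  have h4 : ∀ k, CoeffBound (4 * K) fun α => coeff α (a j k * pderiv ℂ (.inr k) F) := fun k => by
    rw [show 4 * K = 2 * (2 * K) by ring]
    exact .mul (by positivity) ((ha j k).mono hK.le (by linarith)) (hF.pderiv hK.le _)
  have h5 := hF.pderiv hK.le (.inl j)
  simp only [HolFrob.graphField, map_add, map_sum]
  rw [evalSeries_add (by positivity) (h5.mono (by positivity) (by linarith))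
    (.sum _ fun k _ => h4 k) hx, evalSeries_sum _ (by positivity) (fun k _ => h4 k) hx]
  rw [fderiv_evalSeries_apply hK hF hx1, Fintype.sum_sum_type]
  simp only [graphVec, Sum.elim_inl, Sum.elim_inr, smul_eq_mul, Pi.single_apply, ite_mul, one_mul,
    zero_mul, Finset.sum_ite_eq', Finset.mem_univ, if_true, evalSeries_pderiv]
  congr 1
  refine Finset.sum_congr rfl fun k _ => ?_
  rw [evalSeries_mul (K := 2 * K) (by positivity) ((ha j k).mono hK.le (by linarith))
    (hF.pderiv hK.le _) hx2, evalSeries_pderiv]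

variable {S : Type} [NormedAddCommGroup S] [NormedSpace ℝ S] {r' r : ℝ} {k : ℕ}

/-- With this size the formal estimates control, in one stroke, the 𝒞^β regularity in s of every
coefficient. -/
lemma sizeBound_hzBound (he : ZygExp r' r) {V : Set S} (hV : IsOpen V) (k : ℕ) :
    SizeBound (fun f : S → ℂ => HZBound r' r V k f) (4 * 2 ^ k) where
  nonneg := by positivity
  zero := (HZBound.const (0 : ℂ)).mono norm_zero.le
  add := fun hx hy => hx.add hV hy
  mul := fun hx hy => hx.mul he hV hy
  smul := fun c x C hx => by
    have h := hx.clm_comp hV ((c : ℝ) • ContinuousLinearMap.id ℝ ℂ) (b := |(c : ℝ)|) (by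
      rw [norm_smul, ContinuousLinearMap.norm_id, mul_one, Real.norm_eq_abs])
    refine h.congr hV fun s _ => ?_
    simp [Rat.smul_def]
  mono := fun hx h => hx.mono h

/-- The Frobenius theorem for commuting fields in graph form, with first integrals given by power
series whose coefficients depend on the parameter. -/
theorem exists_first_integrals_of_graph (he : ZygExp r' r) {V : Set S} (hV : IsOpen V) {R : ℝ}
    (hR : 0 < R) {a : ι → κ → (ι ⊕ κ → ℂ) × S → ℂ} {M : ℝ}
    (ha : ∀ j l, HZBound r' r (Metric.ball 0 R ×ˢ V) k (a j l) M)
    (hd : ∀ j l, ∀ s ∈ V, DifferentiableOn ℂ (fun x => a j l (x, s)) (Metric.ball 0 R))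
    (hcomm : ∀ i j l, ∀ s ∈ V, ∀ x ∈ Metric.ball (0 : ι ⊕ κ → ℂ) R,
      fderiv ℂ (fun x => a j l (x, s)) x (graphVec i fun l => a i l (x, s)) =
        fderiv ℂ (fun x => a i l (x, s)) x (graphVec j fun l => a j l (x, s))) :
    ∃ (g : κ → (ι ⊕ κ →₀ ℕ) → S → ℂ) (K : ℝ), 1 ≤ K ∧ 1 ≤ K * R ∧
      (∀ l α, HZBound r' r V k (g l α) (K ^ α.degree)) ∧
      ∀ s ∈ V, (∀ l, g l 0 s = 0) ∧
        (∀ l l', g l (single (.inr l') 1) s = if l' = l then 1 else 0) ∧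
        ∀ x : ι ⊕ κ → ℂ, K * ‖x‖ < 1 → ∀ l j,
          fderiv ℂ (evalSeries fun α => g l α s) x (graphVec j fun l' => a j l' (x, s)) = 0 := by
  classical
  choose c hcb hcs using fun j l => HZBound.exists_expansion he (half_pos hR) (half_lt_self hR) hV
    (ha j l) (hd j l)
  set Q : ℝ := max 1 (R / 2)⁻¹ with hQ
  have hQ1 : 1 ≤ Q := le_max_left _ _
  obtain ⟨M', hM'0, hM'⟩ : ∃ M', 0 ≤ M' ∧ M ≤ M' := ⟨max 0 M, le_max_left _ _, le_max_right _ _⟩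
  -- The coefficient ring consists of functions on all of S, so identities have to hold off V too;
  -- setting the coefficients to zero there makes them trivial.
  have hcM : ∀ j l α, HZBound r' r V k (V.indicator (c j l α)) (M' * Q ^ α.degree) := fun j l α =>
    ((hcb j l α).congr hV (Set.eqOn_indicator)).mono (by gcongr; exact le_max_right _ _)
  let A : ι → κ → MvPowerSeries (ι ⊕ κ) (S → ℂ) := fun j l α => V.indicator (c j l α)
  have hA : ∀ j l α, coeff α (A j l) = V.indicator (c j l α) := fun _ _ _ => rfl
  let φ : S → (S → ℂ) →+* ℂ := fun s => Pi.evalRingHom _ s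
  have hφ : ∀ s x, φ s x = x s := fun _ _ => rfl
  let A' : S → ι → κ → MvPowerSeries (ι ⊕ κ) ℂ := fun s j l => MvPowerSeries.map (φ s) (A j l)
  have hA' : ∀ s ∈ V, ∀ j l α, coeff α (A' s j l) = c j l α s := fun s hs j l α => by
    simp only [A', coeff_map, hA, hφ, Set.indicator_of_mem hs]
  have hA'b : ∀ s ∈ V, ∀ j l, CoeffBound Q fun α => coeff α (A' s j l) := fun s hs j l =>
    ⟨M', hM'0, fun α => by
      have h1 := (hcM j l α).zyg.norm_le s hs
      rwa [Set.indicator_of_mem hs, ← hA' s hs] at h1⟩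
  have hsmall : ∀ {x : ι ⊕ κ → ℂ}, Q * ‖x‖ < 1 → x ∈ Metric.ball 0 (R / 2) := fun {x} hx => by
    have h1 : (R / 2)⁻¹ * ‖x‖ < 1 :=
      (mul_le_mul_of_nonneg_right (le_max_right _ _) (norm_nonneg _)).trans_lt hx
    rw [mem_ball_zero_iff]
    rwa [inv_mul_eq_div, div_lt_one (half_pos hR)] at h1
  have heval : ∀ s ∈ V, ∀ j l x, Q * ‖x‖ < 1 →
      evalSeries (fun α => coeff α (A' s j l)) x = a j l (x, s) := fun s hs j l x hx => by
    simp only [hA' s hs]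
    exact (hcs j l s hs x (hsmall hx)).tsum_eq
  have hopen : ∀ K : ℝ, IsOpen {x : ι ⊕ κ → ℂ | K * ‖x‖ < 1} := fun K =>
    isOpen_lt (by fun_prop) continuous_const
  -- Formal commutation is checked at each s. For s in V both sides evaluate to the given
  -- derivatives near 0, and uniqueness of expansions applies.
  have hcommA : ∀ i j l, graphField A i (A j l) = graphField A j (A i l) := by
    intro i j l
    suffices h : ∀ s, graphField (A' s) i (A' s j l) = graphField (A' s) j (A' s i l) by
      ext α s
      have h1 := congrArg (coeff α) (h s)
      rwa [← map_graphField, ← map_graphField, coeff_map, coeff_map, hφ, hφ] at h1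
    intro s
    by_cases hs : s ∈ V
    · have hQ0 : 0 < Q := by linarith
      have hb := fun i j => (CoeffBound.graphField hQ0.le (hA'b s hs) (hA'b s hs j l) i)
      obtain ⟨C, hC, hCb⟩ := (hb i j).add (hb j i).neg
      have h0 := eq_zero_of_evalSeries_eq_zero hC (by positivity) hCb (by
        filter_upwards [(hopen (4 * Q)).mem_nhds (by simp)] with x hx
        have hxQ : Q * ‖x‖ < 1 := by
          have : 4 * Q * ‖x‖ < 1 := hx
          nlinarith [norm_nonneg x]
        rw [evalSeries_add (by positivity) (hb i j) (hb j i).neg hx, evalSeries_neg,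
          evalSeries_graphField hQ0 (hA'b s hs) (hA'b s hs j l) i hx,
          evalSeries_graphField hQ0 (hA'b s hs) (hA'b s hs i l) j hx]
        have hfd : ∀ j, fderiv ℂ (evalSeries fun α => coeff α (A' s j l)) x =
            fderiv ℂ (fun x => a j l (x, s)) x := fun j => by
          refine Filter.EventuallyEq.fderiv_eq ?_
          filter_upwards [(hopen Q).mem_nhds hxQ] with y hy
          exact heval s hs j l y hy
        rw [hfd, hfd]
        simp only [heval s hs _ _ x hxQ]
        rw [hcomm i j l s hs x (Metric.ball_subset_ball (by linarith) (hsmall hxQ)),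
          add_neg_cancel])
      ext α
      exact add_neg_eq_zero.1 (congrFun h0 α)
    · have h0 : ∀ j l, A' s j l = 0 := fun j l => by
        ext α
        simp [A', hA, hφ, hs]
      rw [h0, h0, graphField_zero, graphField_zero]
  choose F K hK1 hFb hF0 hFc hFs using fun l => exists_formal_first_integral (a := A)
    (sizeBound_hzBound he hV k) (HZBound.const (1 : ℂ)) (norm_nonneg _) hM'0 hQ1 hcM hcommA l
  have hK0 : ∀ l, 0 ≤ K l := fun l => zero_le_one.trans (hK1 l)
  -- A common rate for the data and all solutions. The final rate 4K' is what evaluating the field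
  -- on a solution requires.
  set K' : ℝ := Q + ∑ l, K l with hK'
  have hKle : ∀ l, K l ≤ K' := fun l => by
    have := Finset.single_le_sum (f := K) (fun l _ => hK0 l) (Finset.mem_univ l)
    linarith
  have hQle : Q ≤ K' := by
    have := Finset.sum_nonneg fun l (_ : l ∈ Finset.univ) => hK0 l
    linarith
  have hK'0 : 0 < K' := by linarith
  have hFb' : ∀ l α, HZBound r' r V k (coeff α (F l)) ((4 * K') ^ α.degree) := fun l α =>
    (hFb l α).mono (by
      rw [norm_one, one_mul]
      exact pow_le_pow_left₀ (hK0 l) (by linarith [hKle l]) _)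
  refine ⟨fun l α => coeff α (F l), 4 * K', by linarith, ?_, hFb', fun s hs => ⟨fun l => ?_,
    fun l l' => ?_, fun x hx l j => ?_⟩⟩
  · have h1 : (R / 2)⁻¹ ≤ K' := (le_max_right _ _).trans hQle
    have h2 := mul_le_mul_of_nonneg_right h1 (half_pos hR).le
    rw [inv_mul_cancel₀ (half_pos hR).ne'] at h2
    linarith
  · exact congrFun (hFc l) s
  · beta_reduce
    rw [hFs, coeff_X]
    by_cases h : l' = l
    · simp [h]
    · rw [if_neg h, if_neg]
      · rfl
      · intro h'
        exact h (Sum.inr_injective (Finsupp.single_left_injective one_ne_zero h'))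
  · have hxQ : Q * ‖x‖ < 1 := by nlinarith [norm_nonneg x]
    have hb : CoeffBound K' fun α => coeff α (MvPowerSeries.map (φ s) (F l)) := by
      refine ⟨1, zero_le_one, fun α => ?_⟩
      beta_reduce
      rw [coeff_map, hφ]
      refine ((hFb l α).zyg.norm_le s hs).trans ?_
      rw [norm_one, one_mul, one_mul]
      exact pow_le_pow_left₀ (hK0 l) (hKle l) _
    have h1 := evalSeries_graphField hK'0
      (fun j l => (hA'b s hs j l).mono (by linarith) hQle) hb j hx
    rw [← map_graphField, hF0] at h1
    simp only [map_zero, heval s hs _ _ x hxQ, coeff_map, hφ] at h1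
    rw [← h1, evalSeries]
    simp

end GraphFrobenius

end HolFrob

namespace HolFrob

set_option linter.unusedSectionVars false

/-! ### Regularity of series of monomials in ζ with coefficients in s. -/

section TensorSeries

open Finsupp

variable {σ : Type} [Fintype σ] {r' r : ℝ}

/-- Every derivative, and likewise the Lipschitz bound at top order, costs a factor (|α| + 1)/ρ. The
growth is polynomial in |α|, so the bounds are summable against K^|α| once Kρ < 1. -/
lemma HZBound.mono_ball (he : ZygExp r' r) {ρ : ℝ} (hρ : 0 < ρ) (hρ1 : ρ ≤ 1) (k : ℕ)
    (α : σ →₀ ℕ) : HZBound r' r (Metric.ball 0 ρ) k (HolFrob.mono α)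
      (2 * (ρ⁻¹ ^ (k + 1) * ((α.degree + 1) ^ (k + 1) * ρ ^ α.degree))) := by
  have hρi : 1 ≤ ρ⁻¹ := (one_le_inv₀ hρ).2 hρ1
  have hfd : ∀ (α : σ →₀ ℕ) (x : σ → ℂ), HasFDerivAt (𝕜 := ℝ) (HolFrob.mono α)
      (∑ i, ((α i : ℂ) * HolFrob.mono (α - single i 1) x) •
        (ContinuousLinearMap.proj i : (σ → ℂ) →L[ℝ] ℂ)) x := fun α x =>
    ((hasFDerivAt_mono α x).restrictScalars ℝ).congr_fderiv (by
      ext v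
      simp [_root_.sum_apply])
  have hproj : ∀ i, ‖(ContinuousLinearMap.proj i : (σ → ℂ) →L[ℝ] ℂ)‖ ≤ 1 := fun i =>
    ContinuousLinearMap.opNorm_le_bound _ zero_le_one fun v => by
      rw [one_mul]; exact norm_le_pi_norm v i
  have hsum : ∀ (α : σ →₀ ℕ) (j : ℕ),
      ∑ i, (α i : ℝ) * (((α - single i 1).degree + 1) ^ j * ρ ^ (α - single i 1).degree) ≤
        ρ⁻¹ * (((α.degree : ℝ) + 1) ^ (j + 1) * ρ ^ α.degree) := by
    intro α j
    refine (Finset.sum_le_sum fun i _ => mul_pow_degree_sub_single_le α i hρ j).trans ?_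
    rw [← Finset.sum_mul, sum_natCast_eq_degree]
    calc _ ≤ ((α.degree : ℝ) + 1) * ((α.degree + 1) ^ j * (ρ ^ α.degree / ρ)) := by
          gcongr
          linarith
      _ = _ := by rw [pow_succ]; ring
  have hzyg : ∀ (α : σ →₀ ℕ), ZygBound r' r (Metric.ball 0 ρ) (HolFrob.mono α)
      (2 * (ρ⁻¹ * ((α.degree + 1) * ρ ^ α.degree))) := by
    intro α
    refine HZBound.of_contDiff_lipschitz he Metric.isOpen_ball (convex_ball _ _) (by positivity)
      (fun x _ => (hfd α x).differentiableAt.differentiableWithinAt) (fun x hx => ?_)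
      fun x hx => ?_
    · refine (norm_mono_le α (mem_ball_zero_iff.1 hx).le).trans ?_
      rw [← mul_assoc]
      refine le_mul_of_one_le_left (by positivity) ?_
      nlinarith [(Nat.cast_nonneg α.degree : (0 : ℝ) ≤ α.degree)]
    · rw [(hfd α x).fderiv]
      have h0 := hsum α 0
      simp only [pow_zero, one_mul, zero_add, pow_one] at h0
      refine (norm_sum_le _ _).trans ((Finset.sum_le_sum fun i _ => ?_).trans h0)
      rw [norm_smul, norm_mul, Complex.norm_natCast]
      have h1 := norm_mono_le (α - single i 1) (mem_ball_zero_iff.1 hx).le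
      exact (mul_le_of_le_one_right (by positivity) (hproj i)).trans
        (mul_le_mul_of_nonneg_left h1 (Nat.cast_nonneg _))
  have hpow : ∀ (α : σ →₀ ℕ) (k : ℕ), ρ⁻¹ * (((α.degree : ℝ) + 1) * ρ ^ α.degree) ≤
      ρ⁻¹ ^ (k + 1) * ((α.degree + 1) ^ (k + 1) * ρ ^ α.degree) := by
    intro α k
    have h1 : (1 : ℝ) ≤ (α.degree : ℝ) + 1 := by
      linarith [(Nat.cast_nonneg α.degree : (0 : ℝ) ≤ α.degree)]
    gcongr
    · exact le_self_pow₀ hρi (by omega)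
    · exact le_self_pow₀ h1 (by omega)
  induction k generalizing α with
  | zero => exact (hzyg α).mono (mul_le_mul_of_nonneg_left (hpow α 0) two_pos.le)
  | succ k ih =>
    refine HZBound.of_hasFDerivAt Metric.isOpen_ball
      ((hzyg α).mono (mul_le_mul_of_nonneg_left (hpow α (k + 1)) two_pos.le))
      (fun x _ => hfd α x) ?_
    have h1 : ∀ i ∈ Finset.univ, HZBound r' r (Metric.ball (0 : σ → ℂ) ρ) k
        (fun x => ((α i : ℂ) * HolFrob.mono (α - single i 1) x) •
          (ContinuousLinearMap.proj i : (σ → ℂ) →L[ℝ] ℂ))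
        (α i * (2 * (ρ⁻¹ ^ (k + 1) * (((α - single i 1).degree + 1) ^ (k + 1) *
          ρ ^ (α - single i 1).degree)))) := by
      intro i _
      let B : ℂ →L[ℝ] (σ → ℂ) →L[ℝ] ℂ := (α i : ℝ) •
        (ContinuousLinearMap.lsmul ℝ ℂ).flip (ContinuousLinearMap.proj i : (σ → ℂ) →L[ℝ] ℂ)
      have hB : ‖B‖ ≤ α i := by
        refine ContinuousLinearMap.opNorm_le_bound _ (Nat.cast_nonneg _) fun c => ?_
        simp only [B, _root_.smul_apply, norm_smul, Real.norm_natCast,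
          ContinuousLinearMap.flip_apply, ContinuousLinearMap.lsmul_apply]
        gcongr
        exact mul_le_of_le_one_right (norm_nonneg _) (hproj i)
      refine ((ih (α - single i 1)).clm_comp Metric.isOpen_ball B hB).congr Metric.isOpen_ball
        fun x _ => ?_
      ext v
      simp [B, mul_assoc]
    refine (HZBound.sum Metric.isOpen_ball _ h1).mono ?_
    calc _ = 2 * (ρ⁻¹ ^ (k + 1) * ∑ i, (α i : ℝ) * (((α - single i 1).degree + 1) ^ (k + 1) *
          ρ ^ (α - single i 1).degree)) := by
          rw [Finset.mul_sum, Finset.mul_sum]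
          exact Finset.sum_congr rfl fun i _ => by ring
      _ ≤ 2 * (ρ⁻¹ ^ (k + 1) *
          (ρ⁻¹ * (((α.degree : ℝ) + 1) ^ (k + 1 + 1) * ρ ^ α.degree))) := by
          gcongr
          exact hsum α (k + 1)
      _ = _ := by ring

variable {E : Type} [NormedAddCommGroup E] [NormedSpace ℂ E] [NormedSpace ℝ E]
  [IsScalarTower ℝ ℂ E]

/-- The set where the affine coordinates `T (ζ - ζ₀)` are smaller than `ρ`. -/
def polyNhd (T : E →L[ℂ] (σ → ℂ)) (ζ₀ : E) (ρ : ℝ) : Set E := {ζ | ‖T (ζ - ζ₀)‖ < ρ}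

lemma isOpen_polyNhd (T : E →L[ℂ] (σ → ℂ)) (ζ₀ : E) (ρ : ℝ) : IsOpen (polyNhd T ζ₀ ρ) :=
  isOpen_lt (by fun_prop) continuous_const

lemma convex_polyNhd (T : E →L[ℂ] (σ → ℂ)) (ζ₀ : E) (ρ : ℝ) : Convex ℝ (polyNhd T ζ₀ ρ) := by
  intro x hx y hy a b ha hb hab
  have h1 : a • x + b • y - ζ₀ = a • (x - ζ₀) + b • (y - ζ₀) := by
    conv_lhs => rw [← one_smul ℝ ζ₀, ← hab]
    module
  have h2 := convex_ball (0 : σ → ℂ) ρ (mem_ball_zero_iff.2 hx) (mem_ball_zero_iff.2 hy) ha hb hab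
  rw [mem_ball_zero_iff] at h2
  change ‖T (a • x + b • y - ζ₀)‖ < ρ
  rw [h1, map_add, T.map_smul_of_tower, T.map_smul_of_tower]
  exact h2

lemma mem_polyNhd_self (T : E →L[ℂ] (σ → ℂ)) (ζ₀ : E) {ρ : ℝ} (hρ : 0 < ρ) :
    ζ₀ ∈ polyNhd T ζ₀ ρ := by simpa [polyNhd] using hρ

lemma exists_hzBound_mono_comp (he : ZygExp r' r) (k : ℕ) (T : E →L[ℂ] (σ → ℂ)) (ζ₀ : E) {ρ : ℝ}
    (hρ : 0 < ρ) (hρ1 : ρ ≤ 1) :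
    ∃ B, 0 ≤ B ∧ ∀ α : σ →₀ ℕ, HZBound r' r (polyNhd T ζ₀ ρ) k
      (fun ζ => HolFrob.mono α (T (ζ - ζ₀))) (B * ((α.degree + 1) ^ (k + 1) * ρ ^ α.degree)) := by
  refine ⟨2 * ρ⁻¹ ^ (k + 1) * (max 1 ‖T.restrictScalars ℝ‖) ^ (k + 1), by positivity, fun α => ?_⟩
  have h := (HZBound.mono_ball he hρ hρ1 k α).comp_affine he Metric.isOpen_ball
    (T.restrictScalars ℝ) (-(T ζ₀)) (le_max_left 1 _) (le_max_right _ _) (isOpen_polyNhd T ζ₀ ρ)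
    fun ζ hζ => by
      rw [mem_ball_zero_iff, neg_add_eq_sub]
      simpa [polyNhd] using hζ
  refine (h.mono (le_of_eq (by ring))).congr (isOpen_polyNhd T ζ₀ ρ) fun ζ _ => ?_
  simp [neg_add_eq_sub]

variable {S : Type} [NormedAddCommGroup S] [NormedSpace ℝ S]
  {F : Type} [NormedAddCommGroup F] [NormedSpace ℝ F] [NormedSpace ℂ F] [IsScalarTower ℝ ℂ F]

/-- The power series with parameter-dependent coefficients `g` in the coordinates `T (ζ - ζ₀)`. -/
noncomputable def tensorSeries (T : E →L[ℂ] (σ → ℂ)) (ζ₀ : E) (g : (σ →₀ ℕ) → S → F) (p : E × S) :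
    F :=
  evalSeries (fun α => g α p.2) (T (p.1 - ζ₀))

/-- Each term is a product of a function of ζ and a function of s, so the bounds multiply and sum. B
does not depend on g or C, so it serves all parameter values uniformly when the coefficients are
frozen. -/
lemma exists_hzBound_tensorSeries [CompleteSpace F] (he : ZygExp r' r) (k : ℕ)
    (T : E →L[ℂ] (σ → ℂ)) (ζ₀ : E)
    {ρ : ℝ} (hρ : 0 < ρ) (hρ1 : ρ ≤ 1) {K : ℝ} (hK : 0 ≤ K) (hKρ : K * ρ < 1) {V : Set S}
    (hV : IsOpen V) (hVc : Convex ℝ V) :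
    ∃ B, 0 ≤ B ∧ ∀ (g : (σ →₀ ℕ) → S → F) (C : ℝ),
      (∀ α, HZBound r' r V k (g α) (C * K ^ α.degree)) →
      HZBound r' r (polyNhd T ζ₀ ρ ×ˢ V) k (tensorSeries T ζ₀ g) (B * C) := by
  obtain ⟨B, hB, hu⟩ := exists_hzBound_mono_comp he k T ζ₀ hρ hρ1
  have hO : IsOpen (polyNhd T ζ₀ ρ ×ˢ V) := (isOpen_polyNhd T ζ₀ ρ).prod hV
  have hs : Summable fun α : σ →₀ ℕ =>
      4 * 2 ^ k * B * (((α.degree : ℝ) + 1) ^ (k + 1) * (K * ρ) ^ α.degree) :=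
    (summable_degree_pow_mul_pow (k + 1) (by positivity) hKρ).mul_left _
  refine ⟨∑' α : σ →₀ ℕ, 4 * 2 ^ k * B * (((α.degree : ℝ) + 1) ^ (k + 1) * (K * ρ) ^ α.degree),
    tsum_nonneg fun α => ?_, fun g C hg => ?_⟩
  · positivity
  · have h1 : ∀ α, HZBound r' r (polyNhd T ζ₀ ρ ×ˢ V) k
        (fun p => HolFrob.mono α (T (p.1 - ζ₀)) • g α p.2)
        (4 * 2 ^ k * B * (((α.degree : ℝ) + 1) ^ (k + 1) * (K * ρ) ^ α.degree) * C) := by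
      intro α
      have h2 := (hu α).comp_affine he (isOpen_polyNhd T ζ₀ ρ) (ContinuousLinearMap.fst ℝ E S) 0
        le_rfl (ContinuousLinearMap.norm_fst_le ℝ E S) hO fun p hp => by simpa using hp.1
      have h3 := (hg α).comp_affine he hV (ContinuousLinearMap.snd ℝ E S) 0
        le_rfl (ContinuousLinearMap.norm_snd_le ℝ E S) hO fun p hp => by simpa using hp.2
      refine ((h2.smul he hO h3).congr hO fun p _ => ?_).mono (le_of_eq ?_)
      · simp
      · rw [one_pow, mul_pow]; ring
    refine (HZBound.tsum hO ((convex_polyNhd T ζ₀ ρ).prod hVc).isPreconnected h1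
      (hs.mul_right C)).mono (le_of_eq ?_)
    exact tsum_mul_right

lemma hzBound_fst_slice (he : ZygExp r' r) {k : ℕ} {U : Set E} {V : Set S} (hU : IsOpen U)
    (hV : IsOpen V) {f : E × S → F} {C : ℝ} (hf : HZBound r' r (U ×ˢ V) k f C) {s : S}
    (hs : s ∈ V) : HZBound r' r U k (fun ζ => f (ζ, s)) C := by
  have h := hf.comp_affine he (hU.prod hV) (ContinuousLinearMap.inl ℝ E S) (0, s) le_rfl
    (ContinuousLinearMap.norm_inl_le_one ℝ E S) hU fun ζ hζ => by simpa using ⟨hζ, hs⟩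
  simpa using h

lemma hzBound_snd_slice (he : ZygExp r' r) {k : ℕ} {U : Set E} {V : Set S} (hU : IsOpen U)
    (hV : IsOpen V) {f : E × S → F} {C : ℝ} (hf : HZBound r' r (U ×ˢ V) k f C) {ζ : E}
    (hζ : ζ ∈ U) : HZBound r' r V k (fun s => f (ζ, s)) C := by
  have h := hf.comp_affine he (hU.prod hV) (ContinuousLinearMap.inr ℝ E S) (ζ, 0) le_rfl
    (ContinuousLinearMap.norm_inr_le_one ℝ E S) hV fun s hs => by simpa using ⟨hζ, hs⟩
  simpa using h

/-- Cauchy estimates of class `𝒞^β` for the coefficients of a power series with parameter. -/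
def ParamBound (β : ℝ) (V : Set S) (K : ℝ) (g : (σ →₀ ℕ) → S → F) : Prop :=
  ∃ C, ∀ α, HZBound (hzLow β) (hzRem β) V (hzOrder β) (g α) (C * K ^ α.degree)

variable [CompleteSpace F] {T : E →L[ℂ] (σ → ℂ)} {ζ₀ : E} {g : (σ →₀ ℕ) → S → F} {β K ρ : ℝ}
  {V : Set S}

lemma ParamBound.hzLoc_tensorSeries (hβ : 0 < β) (hg : ParamBound β V K g) (hρ : 0 < ρ)
    (hρ1 : ρ ≤ 1) (hK : 0 ≤ K) (hKρ : K * ρ < 1) (hV : IsOpen V) (hVc : Convex ℝ V) {U : Set E}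
    (hU : U ⊆ polyNhd T ζ₀ ρ) {V' : Set S} (hV' : V' ⊆ V) :
    HZLoc β (U ×ˢ V') (tensorSeries T ζ₀ g) := by
  obtain ⟨C, hg⟩ := hg
  obtain ⟨B, _, hB⟩ := exists_hzBound_tensorSeries (F := F) (zygExp_hz hβ) (hzOrder β) T ζ₀ hρ hρ1
    hK hKρ hV hVc
  intro Ω hΩ hΩc hΩr
  exact HZBound.hzNorm_lt_top hβ hΩ hΩc ((hB g C hg).subset
    ((subset_closure.trans hΩr.2).trans (Set.prod_mono hU hV')))

lemma ParamBound.mixedInftyLoc_tensorSeries (hβ : 0 < β) (hg : ParamBound β V K g) (hρ : 0 < ρ)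
    (hρ1 : ρ ≤ 1) (hK : 0 ≤ K) (hKρ : K * ρ < 1) (hV : IsOpen V) (hVc : Convex ℝ V) {U : Set E}
    (hU : U ⊆ polyNhd T ζ₀ ρ) {V' : Set S} (hV' : V' ⊆ V) :
    MixedInftyLoc β U V' (tensorSeries T ζ₀ g) := by
  have he := zygExp_hz hβ
  have hO := isOpen_polyNhd T ζ₀ ρ
  obtain ⟨C, hg⟩ := hg
  obtain ⟨B, _, hB⟩ := exists_hzBound_tensorSeries (F := F) he (hzOrder β) T ζ₀ hρ hρ1 hK hKρ hV hVc
  have h1 := hB g C hg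
  refine ⟨(h1.continuousOn he).mono (Set.prod_mono hU hV'), ?_⟩
  intro U' hU'o hU'c hU'r V'' hV''o hV''c hV''r γ hγ
  have hU'O : U' ⊆ polyNhd T ζ₀ ρ := (subset_closure.trans hU'r.2).trans hU
  have hV''V : V'' ⊆ V := (subset_closure.trans hV''r.2).trans hV'
  have hγe := zygExp_hz hγ
  obtain ⟨B', _, hB'⟩ := exists_hzBound_tensorSeries (F := F) hγe (hzOrder γ) T ζ₀ hρ hρ1 hK hKρ
    (isOpen_univ (X := S)) convex_univ
  -- With s frozen the coefficients are constants, which have bounds of every order γ; the series is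
  -- regarded as one with a trivial parameter in all of S.
  have h2 : ∀ s ∈ V, HZBound (hzLow γ) (hzRem γ) (polyNhd T ζ₀ ρ) (hzOrder γ)
      (fun ζ => tensorSeries T ζ₀ g (ζ, s)) (B' * C) := by
    intro s hs
    have h3 := hB' (fun α _ => g α s) C fun α => (HZBound.const (g α s)).mono
      ((hg α).zyg.norm_le s hs)
    exact hzBound_fst_slice hγe hO isOpen_univ h3 (Set.mem_univ s)
  refine ENNReal.add_lt_top.2 ⟨lt_of_le_of_lt (iSup₂_le fun ζ hζ => ?_)
    (b := (hzOrder β + 1 : ℕ) * (ENNReal.ofReal (B * C) + ENNReal.ofReal (B * C))) (by finiteness),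
    lt_of_le_of_lt (iSup₂_le fun s hs => ?_)
    (b := (hzOrder γ + 1 : ℕ) * (ENNReal.ofReal (B' * C) + ENNReal.ofReal (B' * C)))
    (by finiteness)⟩
  · exact HZBound.hzNorm_le hβ hV''o hV''c ((hzBound_snd_slice he hO hV h1 (hU'O hζ)).subset hV''V)
  · exact HZBound.hzNorm_le hγ hU'o hU'c ((h2 s (hV''V hs)).subset hU'O)

end TensorSeries

end HolFrob

namespace HolFrob

set_option linter.unusedSectionVars false

/-! ### The bi-parameter classes: cut-offs and factorisation of dyadic blocks. -/

section BiParameter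

open Finsupp MeasureTheory

lemma exists_hzBound_of_contDiff {r' r : ℝ} (he : ZygExp r' r) {E F : Type} [NormedAddCommGroup E]
    [NormedSpace ℝ E] [NormedAddCommGroup F] [NormedSpace ℝ F]
    (k : ℕ) {f : E → F} (hf : ContDiff ℝ ∞ f)
    (hc : HasCompactSupport f) : ∃ C, HZBound r' r Set.univ k f C := by
  have key : ∀ {F : Type} [NormedAddCommGroup F] [NormedSpace ℝ F] {f : E → F}, ContDiff ℝ ∞ f →
      HasCompactSupport f → ∃ C, ZygBound r' r Set.univ f C := by
    intro F _ _ f hf hc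
    obtain ⟨C, hC⟩ := hc.exists_bound_of_continuous hf.continuous
    obtain ⟨D, hD⟩ := (hc.fderiv (𝕜 := ℝ)).exists_bound_of_continuous
      (hf.continuous_fderiv (by simp))
    refine ⟨_, HZBound.of_contDiff_lipschitz he isOpen_univ convex_univ (C := max 0 (max C D))
      (le_max_left _ _) (hf.differentiable (by simp)).differentiableOn (fun x _ => ?_)
      fun x _ => ?_⟩
    · exact (hC x).trans ((le_max_left _ _).trans (le_max_right _ _))
    · exact (hD x).trans ((le_max_right _ _).trans (le_max_right _ _))
  induction k generalizing F with
  | zero => exact key hf hc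
  | succ k ih =>
    obtain ⟨C, hC⟩ := key hf hc
    obtain ⟨D, hD⟩ := ih (hf.fderiv_right (m := ∞) (by simp)) (hc.fderiv (𝕜 := ℝ))
    exact ⟨max C D, HZBound.of_hasFDerivAt isOpen_univ (hC.mono (le_max_left _ _))
      (fun x _ => (hf.differentiable (by simp) x).hasFDerivAt) (hD.mono (le_max_right _ _))⟩

/-- Cutting off extends functions with bounds on an open set to the whole space. -/
lemma exists_cutoff {r' r : ℝ} (he : ZygExp r' r) {E : Type}
    [NormedAddCommGroup E] [InnerProductSpace ℝ E] [FiniteDimensional ℝ E] (p : E) {δ : ℝ}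
    (hδ : 0 < δ) (hδ1 : δ ≤ 1) : ∃ χ : E → ℂ, (∀ x ∈ Metric.closedBall p δ, χ x = 1) ∧
      ∀ (k : ℕ) (F : Type) [NormedAddCommGroup F] [NormedSpace ℝ F] [NormedSpace ℂ F]
        [IsScalarTower ℝ ℂ F], ∃ B, 0 ≤ B ∧ ∀ (f : E → F) (C : ℝ) (Ω : Set E), IsOpen Ω →
        Metric.ball p (3 * δ) ⊆ Ω →
        HZBound r' r Ω k f C → HZBound r' r Set.univ k (fun x => χ x • f x) (B * C) := by
  let χ : ContDiffBump p := ⟨δ, 2 * δ, hδ, by linarith⟩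
  refine ⟨fun x => (χ x : ℂ), fun x hx => by
    beta_reduce
    rw [χ.one_of_mem_closedBall hx, Complex.ofReal_one],
    ?_⟩
  intro k F _ _ _ _
  have hcs : HasCompactSupport (fun x => (χ x : ℂ)) :=
    χ.hasCompactSupport.comp_left (g := fun r : ℝ => (r : ℂ)) (by simp)
  have hsm : ContDiff ℝ ∞ (fun x => (χ x : ℂ)) := Complex.ofRealCLM.contDiff.comp χ.contDiff
  obtain ⟨B, hB⟩ := exists_hzBound_of_contDiff he k hsm hcs
  have hB0 := hB.nonneg
  refine ⟨2 * (4 * 2 ^ k * B) / δ, by positivity, fun f C Ω hΩ hΩb hf => ?_⟩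
  have h1 := (hB.subset (Set.subset_univ Ω)).smul he hΩ hf
  refine (h1.extend he hΩ hδ hδ1 fun x hx => ?_).mono (le_of_eq (by ring))
  have h2 : x ∈ Metric.closedBall p (2 * δ) := by
    rw [show Metric.closedBall p (2 * δ) = tsupport χ from χ.tsupport_eq.symm]
    refine closure_mono ?_ hx
    intro y hy h0
    exact hy (by simp [h0])
  refine (Metric.ball_subset_ball' ?_).trans hΩb
  rw [Metric.mem_closedBall] at h2
  linarith

variable {E S F : Type} [NormedAddCommGroup E] [InnerProductSpace ℝ E] [FiniteDimensional ℝ E]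
  [MeasurableSpace E] [BorelSpace E] [NormedAddCommGroup S] [InnerProductSpace ℝ S]
  [FiniteDimensional ℝ S] [MeasurableSpace S] [BorelSpace S]
  [NormedAddCommGroup F] [NormedSpace ℝ F] [NormedSpace ℂ F] [IsScalarTower ℝ ℂ F] [CompleteSpace F]

lemma hasSum_convolution {τ : Type} [Countable τ] (φ : 𝓢(E, ℝ)) {h : τ → E → F} {b : τ → ℝ}
    (hc : ∀ i, Continuous (h i)) (hb : ∀ i x, ‖h i x‖ ≤ b i) (hs : Summable b) (x : E) :
    HasSum (fun i => ∫ t, φ (x - t) • h i t) (∫ t, φ (x - t) • ∑' i, h i t) := by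
  have hφ : Integrable fun t => φ (x - t) := φ.integrable.comp_sub_left x
  have hi : ∀ i, Integrable fun t => φ (x - t) • h i t := fun i =>
    hφ.smul_bdd (b i) (hc i).aestronglyMeasurable (.of_forall fun t => hb i t)
  have hle : ∀ i, ∫ t, ‖φ (x - t) • h i t‖ ≤ (∫ t, ‖φ (x - t)‖) * b i := fun i => by
    rw [← integral_mul_const]
    refine integral_mono (hi i).norm (hφ.norm.mul_const _) fun t => ?_
    simp only [norm_smul]
    gcongr
    exact hb i t
  have h1 := hasSum_integral_of_summable_integral_norm hi (Summable.of_nonneg_of_le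
    (fun i => integral_nonneg fun t => norm_nonneg _) hle (hs.mul_left _))
  refine (congrArg (HasSum _) (integral_congr_ae (.of_forall fun t => ?_))).mp h1
  exact Summable.tsum_const_smul _ (Summable.of_norm_bounded hs fun i => hb i t)

/-- Convolution in one variable acts on one tensor factor only, and the summable majorant allows
both integrals to be exchanged with the sum. -/
lemma convFst_convSnd_tensor {τ : Type} [Countable τ] (φ : 𝓢(E, ℝ)) (ψ : 𝓢(S, ℝ))
    {u : τ → E → ℂ} {v : τ → S → F} {b c : τ → ℝ} (hu : ∀ i, Continuous (u i))
    (hv : ∀ i, Continuous (v i)) (hub : ∀ i x, ‖u i x‖ ≤ b i) (hvb : ∀ i s, ‖v i s‖ ≤ c i)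
    (hs : Summable fun i => b i * c i) (p : E × S) :
    HasSum (fun i => (∫ y, φ (p.1 - y) • u i y) • ∫ t, ψ (p.2 - t) • v i t)
      (convFst φ (convSnd ψ fun q => ∑' i, u i q.1 • v i q.2) p) := by
  have hψ : Integrable fun t => ψ (p.2 - t) := ψ.integrable.comp_sub_left p.2
  have h1 : ∀ y, convSnd ψ (fun q => ∑' i, u i q.1 • v i q.2) (y, p.2) =
      ∑' i, u i y • ∫ t, ψ (p.2 - t) • v i t := by
    intro y
    have h2 := hasSum_convolution ψ (h := fun i s => u i y • v i s) (b := fun i => b i * c i)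
      (fun i => (hv i).const_smul _) (fun i s => by
        rw [norm_smul]
        exact mul_le_mul (hub i y) (hvb i s) (norm_nonneg _) ((norm_nonneg _).trans (hub i y)))
      hs p.2
    rw [convSnd, ← h2.tsum_eq]
    refine tsum_congr fun i => ?_
    rw [← integral_smul]
    simp only [smul_comm (u i y)]
  have hle : ∀ i, ‖∫ t, ψ (p.2 - t) • v i t‖ ≤ (∫ t, ‖ψ (p.2 - t)‖) * c i := fun i => by
    rw [← integral_mul_const]
    refine norm_integral_le_of_norm_le (hψ.norm.mul_const _) (.of_forall fun t => ?_)
    rw [norm_smul]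
    gcongr
    exact hvb i t
  have h3 := hasSum_convolution φ (h := fun i y => u i y • ∫ t, ψ (p.2 - t) • v i t)
    (b := fun i => (∫ t, ‖ψ (p.2 - t)‖) * (b i * c i)) (fun i => (hu i).smul continuous_const)
    (fun i y => by
      rw [norm_smul]
      refine (mul_le_mul (hub i y) (hle i) (norm_nonneg _)
        ((norm_nonneg _).trans (hub i y))).trans_eq (by ring)) (hs.mul_left _) p.1
  simp only [← h1] at h3
  refine (congrArg (fun f => HasSum f _) (funext fun i => ?_)).mp h3
  rw [← integral_smul_const]
  simp only [smul_assoc]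

variable [NormedSpace ℂ E] [IsScalarTower ℝ ℂ E] {σ : Type} [Fintype σ] {T : E →L[ℂ] (σ → ℂ)}
  {ζ₀ : E} {g : (σ →₀ ℕ) → S → F} {β K ρ : ℝ} {V : Set S}

/-- The extension is the series of the products (χ₁ · monomial)(χ₂ · g_α). Its dyadic blocks factor,
the first factor decaying at rate γ and the second at rate β. Any γ is allowed because the bounds of
the monomials stay summable at every order. -/
lemma ParamBound.biHZInfty_tensorSeries (hβ : 0 < β) (hg : ParamBound β V K g) (hρ : 0 < ρ)
    (hρ1 : ρ ≤ 1) (hK : 0 ≤ K) (hKρ : K * ρ < 1) (hV : IsOpen V) {s₀ : S} {δ : ℝ} (hδ : 0 < δ)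
    (hδ1 : δ ≤ 1) (hδO : Metric.ball ζ₀ (3 * δ) ⊆ polyNhd T ζ₀ ρ) (hδV : Metric.ball s₀ (3 * δ) ⊆ V)
    {U : Set E} (hU : U ⊆ Metric.closedBall ζ₀ δ) {V' : Set S}
    (hV' : V' ⊆ Metric.closedBall s₀ δ) :
    BiHZInfty β U V' (tensorSeries T ζ₀ g) := by
  intro γ hγ φ ψ hφ hψ
  have heβ := zygExp_hz hβ
  have heγ := zygExp_hz hγ
  obtain ⟨C, hg⟩ := hg
  obtain ⟨χ₁, hχ₁, h₁⟩ := exists_cutoff heγ ζ₀ hδ hδ1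
  obtain ⟨χ₂, hχ₂, h₂⟩ := exists_cutoff heβ s₀ hδ hδ1
  obtain ⟨B₁, hB₁0, hB₁⟩ := h₁ (hzOrder γ) ℂ
  obtain ⟨B₂, hB₂0, hB₂⟩ := h₂ (hzOrder β) F
  obtain ⟨B, hB, hu⟩ := exists_hzBound_mono_comp heγ (hzOrder γ) T ζ₀ hρ hρ1
  obtain ⟨A₁, hA₁0, hA₁⟩ := exists_dyadic_bound ℂ heγ (hzOrder γ) hφ
  obtain ⟨A₂, hA₂0, hA₂⟩ := exists_dyadic_bound F heβ (hzOrder β) hψ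
  have hC : 0 ≤ C := by simpa using (hg 0).nonneg
  let u : (σ →₀ ℕ) → E → ℂ := fun α ζ => χ₁ ζ • HolFrob.mono α (T (ζ - ζ₀))
  let v : (σ →₀ ℕ) → S → F := fun α s => χ₂ s • g α s
  let b : (σ →₀ ℕ) → ℝ := fun α =>
    B₁ * (B * ((α.degree + 1) ^ (hzOrder γ + 1) * ρ ^ α.degree))
  let c : (σ →₀ ℕ) → ℝ := fun α => B₂ * (C * K ^ α.degree)
  have hub : ∀ α, HZBound (hzLow γ) (hzRem γ) Set.univ (hzOrder γ) (u α) (b α) := fun α =>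
    hB₁ _ _ _ (isOpen_polyNhd T ζ₀ ρ) hδO (hu α)
  have hvb : ∀ α, HZBound (hzLow β) (hzRem β) Set.univ (hzOrder β) (v α) (c α) := fun α =>
    hB₂ _ _ _ hV hδV (hg α)
  have hs : Summable fun α => b α * c α := by
    refine ((summable_degree_pow_mul_pow (σ := σ) (hzOrder γ + 1) (by positivity) hKρ).mul_left
      (B₁ * B * B₂ * C)).congr fun α => ?_
    simp only [b, c]
    rw [mul_pow]
    ring
  have huc : ∀ α, Continuous (u α) := fun α =>
    continuousOn_univ.1 ((hub α).continuousOn heγ)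
  have hvc : ∀ α, Continuous (v α) := fun α =>
    continuousOn_univ.1 ((hvb α).continuousOn heβ)
  have hub' : ∀ α x, ‖u α x‖ ≤ b α := fun α x => (hub α).zyg.norm_le x (Set.mem_univ x)
  have hvb' : ∀ α x, ‖v α x‖ ≤ c α := fun α x => (hvb α).zyg.norm_le x (Set.mem_univ x)
  have huv : ∀ α (q : E × S), ‖u α q.1 • v α q.2‖ ≤ b α * c α := fun α q => by
    rw [norm_smul]
    exact mul_le_mul (hub' α _) (hvb' α _) (norm_nonneg _) ((norm_nonneg _).trans (hub' α q.1))
  -- Both cut-offs equal 1 on the closed δ-balls, so this global function agrees with the series on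
  -- U × V'.
  refine ⟨fun q => ∑' α, u α q.1 • v α q.2, ?_, ⟨∑' α, b α * c α, fun q => ?_⟩, ?_, ?_⟩
  · exact continuous_tsum (fun α => ((huc α).comp continuous_fst).smul
      ((hvc α).comp continuous_snd)) hs huv
  · exact tsum_of_norm_bounded hs.hasSum fun α => huv α q
  · refine lt_of_le_of_lt (iSup_le fun j => iSup_le fun k => iSup_le fun p => ?_)
      (b := ENNReal.ofReal (∑' α, A₁ * A₂ * (b α * c α))) ENNReal.ofReal_lt_top
    rw [← ofReal_norm, ← ENNReal.ofReal_mul (by positivity)]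
    refine ENNReal.ofReal_le_ofReal ?_
    have h3 := convFst_convSnd_tensor (φ j) (ψ k) huc hvc hub' hvb' hs p
    have h4 := h3.const_smul ((2 : ℝ) ^ (j * γ + k * β))
    rw [← Real.norm_of_nonneg (show 0 ≤ (2 : ℝ) ^ (j * γ + k * β) by positivity), ← norm_smul,
      ← h4.tsum_eq]
    refine tsum_of_norm_bounded (hs.mul_left (A₁ * A₂)).hasSum fun α => ?_
    have h5 := hA₁ (u α) (b α) (hub α) j p.1
    have h6 := hA₂ (v α) (c α) (hvb α) k p.2
    rw [hzOrder_add_hzRem] at h5 h6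
    rw [norm_smul, norm_smul, Real.norm_of_nonneg (by positivity), Real.rpow_add two_pos]
    calc _ = ((2 : ℝ) ^ (j * γ) * ‖∫ y, φ j (p.1 - y) • u α y‖) *
          ((2 : ℝ) ^ (k * β) * ‖∫ t, ψ k (p.2 - t) • v α t‖) := by ring
      _ ≤ (A₁ * b α) * (A₂ * c α) := mul_le_mul h5 h6 (by positivity)
          ((by positivity : 0 ≤ (2 : ℝ) ^ (j * γ) * ‖∫ y, φ j (p.1 - y) • u α y‖).trans h5)
      _ = _ := by ring
  · rintro ⟨ζ, s⟩ ⟨hζ, hs'⟩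
    simp only [u, v, hχ₁ ζ (hU hζ), hχ₂ s (hV' hs'), one_smul]
    rfl

end BiParameter

end HolFrob

namespace HolFrob

set_option linter.unusedSectionVars false

/-! ### Reduction of commuting fields to graph form. -/

section GraphForm

variable {X S : Type} [NormedAddCommGroup X] [NormedSpace ℂ X] [NormedSpace ℝ X]
  [IsScalarTower ℝ ℂ X] [NormedAddCommGroup S] [NormedSpace ℝ S]
  {r' r : ℝ} {k : ℕ} {O : Set X} {V : Set S}

/-- Functions of class `𝒞^{k+r}` on `O × V` which are holomorphic in the first variable. -/
def HolHZ (r' r : ℝ) (k : ℕ) (O : Set X) (V : Set S) (f : X × S → ℂ) : Prop :=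
  (∃ C, HZBound r' r (O ×ˢ V) k f C) ∧ ∀ s ∈ V, DifferentiableOn ℂ (fun x => f (x, s)) O

namespace HolHZ

variable {f g : X × S → ℂ}

lemma subset (hf : HolHZ r' r k O V f) {O' : Set X} {V' : Set S} (hO : O' ⊆ O) (hV : V' ⊆ V) :
    HolHZ r' r k O' V' f :=
  ⟨hf.1.imp fun _ h => h.subset (Set.prod_mono hO hV), fun s hs => (hf.2 s (hV hs)).mono hO⟩

lemma const (c : ℂ) : HolHZ r' r k O V fun _ => c :=
  ⟨⟨_, HZBound.const c⟩, fun _ _ => differentiableOn_const c⟩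

lemma add (hO : IsOpen O) (hV : IsOpen V) (hf : HolHZ r' r k O V f) (hg : HolHZ r' r k O V g) :
    HolHZ r' r k O V fun p => f p + g p :=
  ⟨let ⟨_, h1⟩ := hf.1; let ⟨_, h2⟩ := hg.1; ⟨_, h1.add (hO.prod hV) h2⟩,
    fun s hs => (hf.2 s hs).add (hg.2 s hs)⟩

lemma mul (he : ZygExp r' r) (hO : IsOpen O) (hV : IsOpen V) (hf : HolHZ r' r k O V f)
    (hg : HolHZ r' r k O V g) : HolHZ r' r k O V fun p => f p * g p :=
  ⟨let ⟨_, h1⟩ := hf.1; let ⟨_, h2⟩ := hg.1; ⟨_, h1.mul he (hO.prod hV) h2⟩,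
    fun s hs => (hf.2 s hs).mul (hg.2 s hs)⟩

lemma inv (he : ZygExp r' r) (hO : IsOpen O) (hV : IsOpen V) (hf : HolHZ r' r k O V f) {c : ℝ}
    (hc : 0 < c) (hfc : ∀ p ∈ O ×ˢ V, c ≤ ‖f p‖) : HolHZ r' r k O V fun p => (f p)⁻¹ :=
  ⟨let ⟨_, h1⟩ := hf.1; h1.inv he (hO.prod hV) hc hfc,
    fun s hs => (hf.2 s hs).inv fun x hx =>
      norm_pos_iff.1 (hc.trans_le (hfc (x, s) ⟨hx, hs⟩))⟩

lemma sum (hO : IsOpen O) (hV : IsOpen V) {τ : Type} (s : Finset τ) {f : τ → X × S → ℂ}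
    (hf : ∀ i ∈ s, HolHZ r' r k O V (f i)) : HolHZ r' r k O V fun p => ∑ i ∈ s, f i p := by
  classical
  induction s using Finset.induction_on with
  | empty => simpa using const 0
  | insert i s hi ih =>
    simp only [Finset.sum_insert hi]
    exact (hf i (Finset.mem_insert_self _ _)).add hO hV
      (ih fun j hj => hf j (Finset.mem_insert_of_mem hj))

lemma prod (he : ZygExp r' r) (hO : IsOpen O) (hV : IsOpen V) {τ : Type} (s : Finset τ)
    {f : τ → X × S → ℂ} (hf : ∀ i ∈ s, HolHZ r' r k O V (f i)) :
    HolHZ r' r k O V fun p => ∏ i ∈ s, f i p := by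
  classical
  induction s using Finset.induction_on with
  | empty => simpa using const 1
  | insert i s hi ih =>
    simp only [Finset.prod_insert hi]
    exact (hf i (Finset.mem_insert_self _ _)).mul he hO hV
      (ih fun j hj => hf j (Finset.mem_insert_of_mem hj))

lemma det (he : ZygExp r' r) (hO : IsOpen O) (hV : IsOpen V) {ι : Type} [Fintype ι] [DecidableEq ι]
    {M : X × S → Matrix ι ι ℂ} (hM : ∀ i j, HolHZ r' r k O V fun p => M p i j) :
    HolHZ r' r k O V fun p => (M p).det := by
  simp only [Matrix.det_apply']
  exact sum hO hV _ fun π _ => (const _).mul he hO hV (prod he hO hV _ fun i _ => hM _ _)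

lemma continuousOn (he : ZygExp r' r) (hf : HolHZ r' r k O V f) : ContinuousOn f (O ×ˢ V) :=
  let ⟨_, h⟩ := hf.1; h.continuousOn he

end HolHZ

variable {ι κ : Type} [Fintype ι] [Fintype κ] [DecidableEq ι]

/-- Fields close to coordinate fields span the same distribution as fields in graph form. -/
lemma exists_graph_form (he : ZygExp r' r) {R : ℝ} (hR : 0 < R) {x₀ : X} {s₀ : S} {ε : ℝ}
    (hε : 0 < ε) {b : ι → ι ⊕ κ → X × S → ℂ}
    (hb : ∀ j i, HolHZ r' r k (Metric.ball x₀ R) (Metric.ball s₀ ε) (b j i))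
    (hb0 : ∀ j l, b j (.inl l) (x₀, s₀) = if j = l then 1 else 0) :
    ∃ δ > 0, δ ≤ R ∧ δ ≤ ε ∧ ∃ a : ι → κ → X × S → ℂ,
      (∀ j l, HolHZ r' r k (Metric.ball x₀ δ) (Metric.ball s₀ δ) (a j l)) ∧
      ∀ p ∈ Metric.ball x₀ δ ×ˢ Metric.ball s₀ δ,
        (Matrix.of fun j l => b j (.inl l) p).det ≠ 0 ∧
        ∀ j l, b j (.inr l) p = ∑ i, b j (.inl i) p * a i l p := by
  let M : X × S → Matrix ι ι ℂ := fun p => Matrix.of fun j l => b j (.inl l) p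
  have hM : ∀ i j, HolHZ r' r k (Metric.ball x₀ R) (Metric.ball s₀ ε) fun p => M p i j :=
    fun i j => hb i (.inl j)
  have hO := Metric.isOpen_ball (x := x₀) (ε := R)
  have hV := Metric.isOpen_ball (x := s₀) (ε := ε)
  have hdet := HolHZ.det he hO hV hM
  have hdet0 : (M (x₀, s₀)).det = 1 := by
    rw [show M (x₀, s₀) = 1 from Matrix.ext fun j l => by simp [M, hb0, Matrix.one_apply]]
    exact Matrix.det_one
  have hmem : (x₀, s₀) ∈ Metric.ball x₀ R ×ˢ Metric.ball s₀ ε :=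
    ⟨Metric.mem_ball_self hR, Metric.mem_ball_self hε⟩
  have hc := (hdet.continuousOn he).continuousAt ((hO.prod hV).mem_nhds hmem)
  have hev : ∀ᶠ p in nhds (x₀, s₀), (2⁻¹ : ℝ) < ‖(M p).det‖ :=
    continuousAt_const.eventually_lt hc.norm (by rw [hdet0]; norm_num)
  obtain ⟨δ₀, hδ₀, hδ⟩ := Metric.eventually_nhds_iff_ball.1 hev
  set δ := min δ₀ (min R ε)
  have hδR : δ ≤ R := (min_le_right _ _).trans (min_le_left _ _)
  have hδε : δ ≤ ε := (min_le_right _ _).trans (min_le_right _ _)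
  have hO' := Metric.isOpen_ball (x := x₀) (ε := δ)
  have hV' := Metric.isOpen_ball (x := s₀) (ε := δ)
  have hsub : ∀ {f : X × S → ℂ}, HolHZ r' r k (Metric.ball x₀ R) (Metric.ball s₀ ε) f →
      HolHZ r' r k (Metric.ball x₀ δ) (Metric.ball s₀ δ) f := fun hf =>
    hf.subset (Metric.ball_subset_ball hδR) (Metric.ball_subset_ball hδε)
  have hlow : ∀ p ∈ Metric.ball x₀ δ ×ˢ Metric.ball s₀ δ, 2⁻¹ ≤ ‖(M p).det‖ := fun p hp => by
    refine (hδ p ?_).le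
    rw [← ball_prod_same]
    exact Set.prod_mono (Metric.ball_subset_ball (min_le_left _ _))
      (Metric.ball_subset_ball (min_le_left _ _)) hp
  -- The block is inverted by Cramer's rule: cofactors are polynomial in the entries, and the
  -- determinant, equal to 1 at the centre, stays above 1/2 in modulus.
  have hadj : ∀ i j, HolHZ r' r k (Metric.ball x₀ δ) (Metric.ball s₀ δ)
      fun p => (M p).adjugate i j := by
    intro i j
    simp only [Matrix.adjugate_apply]
    refine HolHZ.det he hO' hV' fun i' j' => ?_
    by_cases h : i' = j
    · simp only [h, Matrix.updateRow_self]
      exact HolHZ.const _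
    · simp only [Matrix.updateRow_ne h]
      exact hsub (hM i' j')
  refine ⟨δ, lt_min hδ₀ (lt_min hR hε), hδR, hδε,
    fun j l p => ∑ i, (M p).det⁻¹ * ((M p).adjugate j i * b i (.inr l) p),
    fun j l => HolHZ.sum hO' hV' _ fun i _ =>
      ((hsub hdet).inv he hO' hV' (by norm_num) hlow).mul he hO' hV'
        ((hadj j i).mul he hO' hV' (hsub (hb i _))), fun p hp => ?_⟩
  have hne : (M p).det ≠ 0 := norm_pos_iff.1 (by linarith [hlow p hp])
  refine ⟨hne, fun j l => ?_⟩
  have h1 : ∀ i, ∑ q, b j (.inl q) p * (M p).adjugate q i = if j = i then (M p).det else 0 := by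
    intro i
    have h2 := congrFun (congrFun (Matrix.mul_adjugate (M p)) j) i
    rw [Matrix.mul_apply] at h2
    simpa [M, Matrix.one_apply] using h2
  calc b j (.inr l) p = ∑ i, (if j = i then (M p).det else 0) * ((M p).det⁻¹ * b i (.inr l) p) := by
        simp only [ite_mul, zero_mul, Finset.sum_ite_eq, Finset.mem_univ, if_true]
        rw [mul_inv_cancel_left₀ hne]
    _ = _ := by
        simp only [← h1, Finset.sum_mul, Finset.mul_sum]
        rw [Finset.sum_comm]
        exact Finset.sum_congr rfl fun q _ => Finset.sum_congr rfl fun i _ => by ring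

/-- If the fields `b_j` commute, then so do the fields in graph form spanning the same
distribution. -/
lemma graph_commute [DecidableEq κ] {B : ι → (ι ⊕ κ → ℂ) → ι ⊕ κ → ℂ} {a : ι → κ → (ι ⊕ κ → ℂ) → ℂ}
    {x : ι ⊕ κ → ℂ} (hB : ∀ j, DifferentiableAt ℂ (B j) x)
    (ha : ∀ j l, DifferentiableAt ℂ (a j l) x)
    (hcomm : ∀ i j, fderiv ℂ (B i) x (B j x) = fderiv ℂ (B j) x (B i x))
    (hdet : (Matrix.of fun j l => B j x (.inl l)).det ≠ 0)
    (hrel : ∀ᶠ y in nhds x, ∀ j l, B j y (.inr l) = ∑ i, B j y (.inl i) * a i l y) (i j : ι) (l : κ) :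
    fderiv ℂ (a j l) x (graphVec i fun l => a i l x) =
      fderiv ℂ (a i l) x (graphVec j fun l => a j l x) := by
  have hBi : ∀ j t, HasFDerivAt (fun y => B j y t)
      ((ContinuousLinearMap.proj t).comp (fderiv ℂ (B j) x)) x := fun j t =>
    (ContinuousLinearMap.proj (R := ℂ) (φ := fun _ : ι ⊕ κ => ℂ) t).hasFDerivAt.comp x
      (hB j).hasFDerivAt
  have hBvec : ∀ q, B q x = ∑ p, B q x (.inl p) • graphVec p fun l => a p l x := by
    intro q
    ext t
    rcases t with t | t
    · simp [graphVec, Finset.sum_apply, Pi.single_apply]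
    · rw [hrel.self_of_nhds q t]
      simp [graphVec, Finset.sum_apply]
  let M : Matrix ι ι ℂ := Matrix.of fun j l => B j x (.inl l)
  let A : Matrix ι ι ℂ := Matrix.of fun p q => fderiv ℂ (a p l) x (graphVec q fun l => a q l x)
  -- The relation B_p^l = ∑ B_p^i a_i^l is differentiated along B_q, and B_q is expanded in the
  -- graph vectors. The right side depends on p, q only through the derivative of B_p along B_q,
  -- hence is symmetric when the fields commute; A is then symmetric because M is invertible.
  have h1 : ∀ p q, (M * A * M.transpose) p q = fderiv ℂ (B p) x (B q x) (.inr l) -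
      ∑ i, a i l x * fderiv ℂ (B p) x (B q x) (.inl i) := by
    intro p q
    have h2 : HasFDerivAt (fun y => B p y (.inr l)) (∑ i, (B p x (.inl i) • fderiv ℂ (a i l) x +
        a i l x • (ContinuousLinearMap.proj (.inl i)).comp (fderiv ℂ (B p) x))) x := by
      refine (HasFDerivAt.fun_sum fun i _ =>
        (hBi p (.inl i)).mul (ha i l).hasFDerivAt).congr_of_eventuallyEq ?_
      filter_upwards [hrel] with y hy using hy p l
    have h3 := congrArg (fun L : (ι ⊕ κ → ℂ) →L[ℂ] ℂ => L (B q x)) ((hBi p (.inr l)).unique h2)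
    simp only [ContinuousLinearMap.comp_apply, ContinuousLinearMap.proj_apply, _root_.sum_apply,
      _root_.add_apply, _root_.smul_apply, smul_eq_mul, Finset.sum_add_distrib] at h3
    rw [h3, add_sub_cancel_right]
    simp only [Matrix.mul_apply, Matrix.transpose_apply, M, A, Matrix.of_apply, Finset.sum_mul]
    rw [Finset.sum_comm]
    refine Finset.sum_congr rfl fun i _ => ?_
    conv_rhs => rw [hBvec q, map_sum, Finset.mul_sum]
    refine Finset.sum_congr rfl fun i' _ => ?_
    rw [map_smul, smul_eq_mul]
    ring
  have h4 : (M * A * M.transpose).transpose = M * A * M.transpose := by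
    ext p q
    rw [Matrix.transpose_apply, h1, h1, hcomm]
  have hM : IsUnit M := (Matrix.isUnit_iff_isUnit_det _).2 (isUnit_iff_ne_zero.2 hdet)
  have hMt : IsUnit M.transpose := (Matrix.isUnit_iff_isUnit_det _).2 (by
    rw [Matrix.det_transpose]
    exact isUnit_iff_ne_zero.2 hdet)
  have h5 : A.transpose = A := by
    rw [Matrix.transpose_mul, Matrix.transpose_mul, Matrix.transpose_transpose,
      Matrix.mul_assoc] at h4
    exact hMt.mul_right_cancel (hM.mul_left_cancel (by rw [← Matrix.mul_assoc] at h4 ⊢; simpa [Matrix.mul_assoc] using h4))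
  exact congrFun (congrFun h5 i) j

end GraphForm

end HolFrob

namespace HolFrob

set_option linter.unusedSectionVars false

/-! ### First integrals near a point in adapted coordinates. -/

section FirstIntegrals

open Finsupp

variable {E S : Type} [NormedAddCommGroup E] [NormedSpace ℂ E] [NormedSpace ℝ E]
  [IsScalarTower ℝ ℂ E] [FiniteDimensional ℂ E] [NormedAddCommGroup S] [NormedSpace ℝ S]
  [FiniteDimensional ℝ S]
  {ι κ : Type} [Fintype ι] [Fintype κ] [DecidableEq ι] [DecidableEq κ]

/-- Linearly independent vectors are the first vectors of some system of coordinates. -/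
lemma exists_adapted_coordinates {v : ι → E} (hv : LinearIndependent ℂ v)
    (hd : Module.finrank ℂ E = Fintype.card ι + Fintype.card κ) :
    ∃ T : E ≃L[ℂ] (ι ⊕ κ → ℂ), ∀ j, T (v j) = Pi.single (.inl j) 1 := by
  classical
  let B := Module.Basis.sumExtend hv
  have : Finite (ι ⊕ Module.Basis.sumExtendIndex hv) := Module.Finite.finite_basis B
  have : Finite (Module.Basis.sumExtendIndex hv) :=
    Finite.of_injective _ (Sum.inr_injective (α := ι))
  have : Fintype (Module.Basis.sumExtendIndex hv) := Fintype.ofFinite _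
  have hc : Fintype.card (Module.Basis.sumExtendIndex hv) = Fintype.card κ := by
    have := Module.finrank_eq_card_basis B
    rw [Fintype.card_sum, hd] at this
    omega
  let e := Fintype.equivOfCardEq hc
  let B' := B.reindex (Equiv.sumCongr (Equiv.refl ι) e)
  refine ⟨B'.equivFun.toContinuousLinearEquiv, fun j => ?_⟩
  have h1 : B' (.inl j) = v j := by
    simp only [B', B, Module.Basis.sumExtend, Module.Basis.coe_reindex, Function.comp_apply]
    rw [Module.Basis.extend_apply_self]
    rfl
  rw [← h1]
  ext i
  simp [Pi.single_apply, eq_comm]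

/-- The graph theorem is applied in coordinates T in which the fields at the base point are
coordinate vectors. Since the b_j are combinations of the graph vectors, they annihilate the same
functions. -/
theorem exists_first_integrals {β : ℝ} (hβ : 0 < β) {U₀ : Set E} (hU₀ : IsOpen U₀) {V₀ : Set S}
    (hV₀ : IsOpen V₀) {b : ι → E × S → E} (hb : ∀ j, HZLoc β (U₀ ×ˢ V₀) (b j))
    (hhol : ∀ j, ∀ s ∈ V₀, DifferentiableOn ℂ (fun ζ => b j (ζ, s)) U₀)
    (hcomm : ∀ i j, ∀ ζ ∈ U₀, ∀ s ∈ V₀,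
      VectorField.lieBracket ℂ (fun η => b i (η, s)) (fun η => b j (η, s)) ζ = 0)
    {ζ₀ : E} (hζ₀ : ζ₀ ∈ U₀) {s₀ : S} (hs₀ : s₀ ∈ V₀)
    (hLI : LinearIndependent ℂ fun j => b j (ζ₀, s₀))
    (hd : Module.finrank ℂ E = Fintype.card ι + Fintype.card κ) :
    ∃ (T : E ≃L[ℂ] (ι ⊕ κ → ℂ)) (ρ K δ : ℝ), 0 < ρ ∧ ρ ≤ 1 ∧ 1 ≤ K ∧ 2 * K * ρ < 1 ∧ 0 < δ ∧
      polyNhd (T : E →L[ℂ] (ι ⊕ κ → ℂ)) ζ₀ ρ ⊆ U₀ ∧ Metric.ball s₀ δ ⊆ V₀ ∧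
      ∃ g : κ → (ι ⊕ κ →₀ ℕ) → S → ℂ, (∀ l, ParamBound β (Metric.ball s₀ δ) K (g l)) ∧
        ∀ s ∈ Metric.ball s₀ δ, (∀ l, g l 0 s = 0) ∧
          (∀ l l', g l (single (.inr l') 1) s = if l' = l then 1 else 0) ∧
          ∀ ζ ∈ polyNhd (T : E →L[ℂ] (ι ⊕ κ → ℂ)) ζ₀ ρ, ∀ l j,
            fderiv ℂ (evalSeries fun α => g l α s) (T (ζ - ζ₀)) (T (b j (ζ, s))) = 0 := by
  have he := zygExp_hz hβ
  obtain ⟨T, hT⟩ := exists_adapted_coordinates (κ := κ) hLI hd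
  have : FiniteDimensional ℝ E := FiniteDimensional.trans ℝ ℂ E
  have : ProperSpace E := FiniteDimensional.proper ℝ E
  have : ProperSpace S := FiniteDimensional.proper ℝ S
  obtain ⟨ε₀, hε₀, hsub₀⟩ := Metric.isOpen_iff.1 (hU₀.prod hV₀) (ζ₀, s₀) ⟨hζ₀, hs₀⟩
  -- The factor 3 is lost when the local norm is converted into a bound with a constant.
  obtain ⟨ε, hε, hεε₀⟩ : ∃ ε > 0, 3 * ε < ε₀ := ⟨ε₀ / 4, by positivity, by linarith⟩
  have hcl : Metric.closedBall (ζ₀, s₀) (3 * ε) ⊆ U₀ ×ˢ V₀ :=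
    (Metric.closedBall_subset_ball hεε₀).trans hsub₀
  have hrel : RelCompactIn (Metric.ball (ζ₀, s₀) (3 * ε)) (U₀ ×ˢ V₀) :=
    ⟨(isCompact_closedBall (ζ₀, s₀) (3 * ε)).of_isClosed_subset isClosed_closure
      Metric.closure_ball_subset_closedBall, Metric.closure_ball_subset_closedBall.trans hcl⟩
  have hbd : ∀ j, ∃ C, HZBound (hzLow β) (hzRem β) (Metric.ball (ζ₀, s₀) ε) (hzOrder β) (b j) C :=
    fun j => exists_hzBound_of_hzNorm hβ Metric.isOpen_ball hε subset_rfl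
      (hb j _ Metric.isOpen_ball (convex_ball _ _) hrel)
  have hball : Metric.ball ζ₀ ε ×ˢ Metric.ball s₀ ε ⊆ U₀ ×ˢ V₀ := by
    rw [ball_prod_same]
    exact (Metric.ball_subset_closedBall.trans
      (Metric.closedBall_subset_closedBall (by linarith))).trans hcl
  have hballU : Metric.ball ζ₀ ε ⊆ U₀ := fun ζ hζ =>
    (hball (Set.mk_mem_prod hζ (Metric.mem_ball_self hε))).1
  have hballV : Metric.ball s₀ ε ⊆ V₀ := fun s hs =>
    (hball (Set.mk_mem_prod (Metric.mem_ball_self hε) hs)).2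
  set N := ‖(T.symm : (ι ⊕ κ → ℂ) →L[ℂ] E)‖
  have hN : 0 ≤ N := norm_nonneg _
  let R := ε / (N + 1)
  have hR : 0 < R := by positivity
  have hmap : ∀ x ∈ Metric.ball (0 : ι ⊕ κ → ℂ) R, ζ₀ + T.symm x ∈ Metric.ball ζ₀ ε := by
    intro x hx
    rw [mem_ball_zero_iff, lt_div_iff₀ (by positivity)] at hx
    rw [mem_ball_iff_norm, add_sub_cancel_left]
    have := (T.symm : (ι ⊕ κ → ℂ) →L[ℂ] E).le_opNorm x
    have h2 : (T.symm : (ι ⊕ κ → ℂ) →L[ℂ] E) x = T.symm x := rfl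
    rw [h2] at this
    nlinarith [norm_nonneg x]
  let B : ι → S → (ι ⊕ κ → ℂ) → ι ⊕ κ → ℂ := fun j s x => T (b j (ζ₀ + T.symm x, s))
  have hBd : ∀ j, ∀ s ∈ V₀, ∀ x ∈ Metric.ball (0 : ι ⊕ κ → ℂ) R, HasFDerivAt (B j s)
      ((T : E →L[ℂ] (ι ⊕ κ → ℂ)).comp ((fderiv ℂ (fun ζ => b j (ζ, s)) (ζ₀ + T.symm x)).comp
        (T.symm : (ι ⊕ κ → ℂ) →L[ℂ] E))) x := by
    intro j s hs x hx
    have h1 : HasFDerivAt (fun ζ => b j (ζ, s)) _ (ζ₀ + T.symm x) :=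
      ((hhol j s hs).differentiableAt (hU₀.mem_nhds (hballU (hmap x hx)))).hasFDerivAt
    have h2 : HasFDerivAt (fun x => ζ₀ + T.symm x) (T.symm : (ι ⊕ κ → ℂ) →L[ℂ] E) x :=
      (T.symm.hasFDerivAt (x := x)).const_add ζ₀
    exact T.hasFDerivAt.comp x (HasFDerivAt.comp (g := fun ζ => b j (ζ, s)) x h1 h2)
  have hHol : ∀ j i, HolHZ (hzLow β) (hzRem β) (hzOrder β) (Metric.ball 0 R) (Metric.ball s₀ ε)
      fun p : (ι ⊕ κ → ℂ) × S => B j p.2 p.1 i := by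
    intro j i
    refine ⟨?_, fun s hs x hx => ?_⟩
    · obtain ⟨C, hC⟩ := hbd j
      let L : (ι ⊕ κ → ℂ) × S →L[ℝ] E × S :=
        ((T.symm : (ι ⊕ κ → ℂ) →L[ℂ] E).restrictScalars ℝ).prodMap (ContinuousLinearMap.id ℝ S)
      have h1 := hC.comp_affine he Metric.isOpen_ball L (ζ₀, 0) (le_max_left 1 ‖L‖)
        (le_max_right _ _) (Metric.isOpen_ball.prod Metric.isOpen_ball)
        (O := Metric.ball 0 R ×ˢ Metric.ball s₀ ε) fun p hp => by
          rw [← ball_prod_same]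
          exact ⟨by simpa [L, add_comm] using hmap p.1 hp.1, by simpa [L] using hp.2⟩
      have h2 := h1.clm_comp (Metric.isOpen_ball.prod Metric.isOpen_ball)
        (((ContinuousLinearMap.proj i).comp (T : E →L[ℂ] (ι ⊕ κ → ℂ))).restrictScalars ℝ) le_rfl
      refine ⟨_, h2.congr (Metric.isOpen_ball.prod Metric.isOpen_ball) fun p _ => ?_⟩
      have h3 : (ζ₀, 0) + L p = (ζ₀ + T.symm p.1, p.2) := by ext <;> simp [L]
      simp [h3, B]
    · exact ((differentiableAt_pi.1 (hBd j s (hballV hs) x hx).differentiableAt)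
        i).differentiableWithinAt
  obtain ⟨δ, hδ, hδR, hδε, a, ha, hrel⟩ := exists_graph_form (k := hzOrder β) (x₀ := 0) he hR hε
    (b := fun j i p => B j p.2 p.1 i) hHol fun j l => by
      simp [B, hT, Pi.single_apply, eq_comm]
  have hδV : Metric.ball s₀ δ ⊆ V₀ := (Metric.ball_subset_ball hδε).trans hballV
  choose C hC using fun j l => (ha j l).1
  have hadiff : ∀ j l, ∀ s ∈ Metric.ball s₀ δ, ∀ x ∈ Metric.ball (0 : ι ⊕ κ → ℂ) δ,
      DifferentiableAt ℂ (fun x => a j l (x, s)) x := fun j l s hs x hx =>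
    ((ha j l).2 s hs).differentiableAt (Metric.isOpen_ball.mem_nhds hx)
  have hgc : ∀ i j l, ∀ s ∈ Metric.ball s₀ δ, ∀ x ∈ Metric.ball (0 : ι ⊕ κ → ℂ) δ,
      fderiv ℂ (fun x => a j l (x, s)) x (graphVec i fun l => a i l (x, s)) =
        fderiv ℂ (fun x => a i l (x, s)) x (graphVec j fun l => a j l (x, s)) := by
    intro i j l s hs x hx
    have hxR := Metric.ball_subset_ball hδR hx
    refine graph_commute (B := fun j => B j s) (a := fun j l x => a j l (x, s))
      (fun j => (hBd j s (hδV hs) x hxR).differentiableAt) (fun j l => hadiff j l s hs x hx)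
      (fun i j => ?_) (hrel (x, s) ⟨hx, hs⟩).1 ?_ i j l
    · rw [(hBd i s (hδV hs) x hxR).fderiv, (hBd j s (hδV hs) x hxR).fderiv]
      have h1 := hcomm j i _ (hballU (hmap x hxR)) s (hδV hs)
      rw [VectorField.lieBracket, sub_eq_zero] at h1
      simp only [B, ContinuousLinearMap.comp_apply, ContinuousLinearEquiv.coe_coe,
        ContinuousLinearEquiv.symm_apply_apply]
      rw [h1]
    · filter_upwards [Metric.isOpen_ball.mem_nhds hx] with y hy
      exact (hrel (y, s) ⟨hy, hs⟩).2
  obtain ⟨g, K, hK, hKδ, hg, hint⟩ := exists_first_integrals_of_graph he Metric.isOpen_ball hδ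
    (M := ∑ j, ∑ l, |C j l|) (fun j l => (hC j l).mono ((le_abs_self _).trans
      ((Finset.single_le_sum (f := fun l => |C j l|) (fun _ _ => abs_nonneg _)
        (Finset.mem_univ l)).trans (Finset.single_le_sum (f := fun j => ∑ l, |C j l|)
        (fun _ _ => Finset.sum_nonneg fun _ _ => abs_nonneg _) (Finset.mem_univ j)))))
    (fun j l s hs => (ha j l).2 s hs) hgc
  -- The choice ρ = 1/(4K) fits in the polydisc because Kδ ≥ 1, and gives 2Kρ = 1/2, which leaves
  -- room for derivatives, whose rate is 2K.
  have hρδ : 1 / (4 * K) ≤ δ := by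
    rw [div_le_iff₀ (by positivity)]
    nlinarith
  have hpoly : ∀ ζ ∈ polyNhd (T : E →L[ℂ] (ι ⊕ κ → ℂ)) ζ₀ (1 / (4 * K)),
      T (ζ - ζ₀) ∈ Metric.ball (0 : ι ⊕ κ → ℂ) δ := fun ζ hζ =>
    mem_ball_zero_iff.2 (lt_of_lt_of_le hζ hρδ)
  have hback : ∀ ζ, ζ₀ + T.symm (T (ζ - ζ₀)) = ζ := fun ζ => by simp
  refine ⟨T, 1 / (4 * K), K, δ, by positivity, ?_, hK, ?_, hδ, fun ζ hζ => ?_, hδV, g,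
    fun l => ⟨1, fun α => by simpa using hg l α⟩, fun s hs => ⟨(hint s hs).1, (hint s hs).2.1,
      fun ζ hζ l j => ?_⟩⟩
  · rw [div_le_one (by positivity)]
    linarith
  · rw [mul_one_div, div_lt_one (by positivity)]
    linarith
  · rw [← hback ζ]
    exact hballU (hmap _ (Metric.ball_subset_ball hδR (hpoly ζ hζ)))
  · have h1 : T (b j (ζ, s)) = ∑ p, T (b j (ζ, s)) (.inl p) •
        graphVec p fun l => a p l (T (ζ - ζ₀), s) := by
      have h2 := (hrel (T (ζ - ζ₀), s) ⟨hpoly ζ hζ, hs⟩).2 j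
      simp only [B, hback] at h2
      ext t
      rcases t with t | t
      · simp [graphVec, Finset.sum_apply, Pi.single_apply]
      · rw [h2 t]
        simp [graphVec, Finset.sum_apply]
    rw [h1, map_sum]
    refine Finset.sum_eq_zero fun p _ => ?_
    rw [map_smul, (hint s hs).2.2 _ ?_ l p, smul_zero]
    have h3 : ‖T (ζ - ζ₀)‖ < 1 / (4 * K) := hζ
    rw [lt_div_iff₀ (by positivity)] at h3
    nlinarith [norm_nonneg (T (ζ - ζ₀))]

end FirstIntegrals

end HolFrob

namespace HolFrob

set_option linter.unusedSectionVars false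

/-! ### The function classes depend only on values on the domain. -/

section Congruence

variable {E S F : Type} [NormedAddCommGroup E] [NormedSpace ℝ E]
  [NormedAddCommGroup S] [NormedSpace ℝ S] [NormedAddCommGroup F] [NormedSpace ℝ F]

lemma baseNorm_congr {r : ℝ} {Ω : Set E} (hΩ : Convex ℝ Ω) {f g : E → F} (h : Set.EqOn f g Ω) :
    baseNorm r Ω f = baseNorm r Ω g := by
  have h1 : ⨆ x ∈ Ω, ‖f x‖ₑ = ⨆ x ∈ Ω, ‖g x‖ₑ := biSup_congr fun x hx => by rw [h hx]
  have h2 : ⨆ x ∈ Ω, ⨆ y ∈ Ω, ⨆ (_ : x ≠ y), ‖f x - f y‖ₑ / edist x y ^ r =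
      ⨆ x ∈ Ω, ⨆ y ∈ Ω, ⨆ (_ : x ≠ y), ‖g x - g y‖ₑ / edist x y ^ r :=
    biSup_congr fun x hx => biSup_congr fun y hy => by rw [h hx, h hy]
  have h3 : ⨆ x ∈ Ω, ⨆ y ∈ Ω, ⨆ (_ : x ≠ y),
        ‖(2⁻¹ : ℝ) • (f x + f y) - f ((2⁻¹ : ℝ) • (x + y))‖ₑ / edist x y =
      ⨆ x ∈ Ω, ⨆ y ∈ Ω, ⨆ (_ : x ≠ y),
        ‖(2⁻¹ : ℝ) • (g x + g y) - g ((2⁻¹ : ℝ) • (x + y))‖ₑ / edist x y :=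
    biSup_congr fun x hx => biSup_congr fun y hy => by
      have h4 : (2⁻¹ : ℝ) • (x + y) ∈ Ω := by
        rw [smul_add]
        exact hΩ hx hy (by norm_num) (by norm_num) (by norm_num)
      rw [h hx, h hy, h h4]
  rw [baseNorm, baseNorm, h1, h2, h3]

lemma hzNorm_congr {α : ℝ} {Ω : Set E} (hΩ : Convex ℝ Ω) {f g : E → F} (h : Set.EqOn f g Ω) :
    hzNorm α Ω f = hzNorm α Ω g := by
  have h1 : ContDiffOn ℝ ((⌈α⌉₊ - 1 : ℕ) : ℕ∞) f Ω ↔ ContDiffOn ℝ ((⌈α⌉₊ - 1 : ℕ) : ℕ∞) g Ω :=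
    contDiffOn_congr h
  have h2 : ∀ i, baseNorm (α - (⌈α⌉₊ - 1 : ℕ)) Ω (iteratedFDerivWithin ℝ i f Ω) =
      baseNorm (α - (⌈α⌉₊ - 1 : ℕ)) Ω (iteratedFDerivWithin ℝ i g Ω) := fun i =>
    baseNorm_congr hΩ fun x hx => iteratedFDerivWithin_congr h hx i
  simp only [hzNorm, h2]
  classical exact if_congr h1 rfl rfl

/-- Needed because the derivatives of the first integrals coincide with their series only on U × V,
while the class is stated for a function on the whole product. -/
lemma MixedInftyLoc.congr {β : ℝ} {U : Set E} {V : Set S} {f g : E × S → F}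
    (hf : MixedInftyLoc β U V f) (h : Set.EqOn f g (U ×ˢ V)) : MixedInftyLoc β U V g := by
  refine ⟨hf.1.congr h.symm, fun U' hU'o hU'c hU' V' hV'o hV'c hV' γ hγ => ?_⟩
  have hU'U := subset_closure.trans hU'.2
  have hV'V := subset_closure.trans hV'.2
  refine lt_of_eq_of_lt ?_ (hf.2 U' hU'o hU'c hU' V' hV'o hV'c hV' γ hγ)
  refine congrArg₂ (· + ·) (biSup_congr fun x hx => ?_) (biSup_congr fun s hs => ?_)
  · exact hzNorm_congr hV'c fun s hs => (h ⟨hU'U hx, hV'V hs⟩).symm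
  · exact hzNorm_congr hU'c fun x hx => (h ⟨hU'U hx, hV'V hs⟩).symm

end Congruence

/-! ### Derivatives of parameter-dependent series in ζ. -/

section TensorDerivative

open Finsupp

variable {σ : Type} [Fintype σ] {E S F : Type} [NormedAddCommGroup E] [NormedSpace ℂ E]
  [NormedSpace ℝ E] [IsScalarTower ℝ ℂ E] [NormedAddCommGroup S] [NormedSpace ℝ S]
  [NormedAddCommGroup F] [NormedSpace ℝ F] [NormedSpace ℂ F] [IsScalarTower ℝ ℂ F]
  {T : E →L[ℂ] (σ → ℂ)} {ζ₀ : E} {g : (σ →₀ ℕ) → S → F} {β K ρ : ℝ} {V : Set S}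

/-- The coefficients of the derivative of a power series along a constant vector `w`. -/
noncomputable def dirDeriv (w : σ → ℂ) (g : (σ →₀ ℕ) → S → F) (α : σ →₀ ℕ) (s : S) : F :=
  ∑ i, w i • shiftDeriv i (fun α => g α s) α

lemma ParamBound.coeffBound (hg : ParamBound β V K g) {s : S} (hs : s ∈ V) :
    CoeffBound K fun α => g α s := by
  obtain ⟨C, hC⟩ := hg
  have h0 := (hC 0).nonneg
  exact ⟨C, by simpa using h0, fun α => (hC α).zyg.norm_le s hs⟩

/-- The integer factors α_i + 1 are absorbed by 2^|α|, so a ζ-derivative is a series of the same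
kind with doubled rate and unchanged class in s. -/
lemma ParamBound.dirDeriv (hV : IsOpen V) (hg : ParamBound β V K g)
    (w : σ → ℂ) : ParamBound β V (2 * K) (dirDeriv w g) := by
  obtain ⟨C, hC⟩ := hg
  have hC0 : 0 ≤ C := by simpa using (hC 0).nonneg
  refine ⟨∑ i, ‖w i‖ * (C * K), fun α => ?_⟩
  rw [Finset.sum_mul]
  refine HZBound.sum hV _ fun i _ => ?_
  let B : F →L[ℝ] F :=
    ((w i * ((α i : ℂ) + 1)) • ContinuousLinearMap.id ℂ F).restrictScalars ℝ
  have hB : ‖B‖ ≤ ‖w i‖ * 2 ^ α.degree := by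
    refine ContinuousLinearMap.opNorm_le_bound _ (by positivity) fun x => ?_
    change ‖(w i * ((α i : ℂ) + 1)) • x‖ ≤ _
    rw [norm_smul, norm_mul]
    gcongr
    have h1 : α i + 1 ≤ 2 ^ α.degree := by
      have h2 : α i ≤ α.degree := by
        rw [Finsupp.degree_eq_sum]
        exact Finset.single_le_sum (f := fun i => α i) (fun _ _ => Nat.zero_le _)
          (Finset.mem_univ i)
      exact Nat.lt_two_pow_self.trans_le (Nat.pow_le_pow_right two_pos h2)
    calc ‖(α i : ℂ) + 1‖ = ((α i + 1 : ℕ) : ℝ) := by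
          rw [← Complex.norm_natCast]; push_cast; rfl
      _ ≤ 2 ^ α.degree := by exact_mod_cast h1
  refine (((hC (α + single i 1)).clm_comp hV B hB).congr hV fun s _ => ?_).mono (le_of_eq ?_)
  · change _ = (w i * ((α i : ℂ) + 1)) • g (α + single i 1) s
    rw [shiftDeriv, mul_smul]
  · rw [map_add, Finsupp.degree_single, pow_succ, mul_pow]
    ring

variable [CompleteSpace F]

lemma ParamBound.analyticAt_tensorSeries (hg : ParamBound β V K g) (hK : 0 < K) {s : S}
    (hs : s ∈ V) {ζ : E} (hζ : K * ‖T (ζ - ζ₀)‖ < 1) :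
    AnalyticAt ℂ (fun ζ => tensorSeries T ζ₀ g (ζ, s)) ζ :=
  (analyticAt_evalSeries hK (hg.coeffBound hs) hζ).comp_of_eq
    ((T.analyticAt (ζ - ζ₀)).comp_of_eq (analyticAt_id.sub analyticAt_const) rfl) rfl

lemma ParamBound.hasFDerivAt_tensorSeries (hg : ParamBound β V K g) (hK : 0 < K) {s : S}
    (hs : s ∈ V) {ζ : E} (hζ : K * ‖T (ζ - ζ₀)‖ < 1) :
    HasFDerivAt (fun ζ => tensorSeries T ζ₀ g (ζ, s))
      ((fderiv ℂ (evalSeries fun α => g α s) (T (ζ - ζ₀))).comp T) ζ := by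
  have h1 := (analyticAt_evalSeries hK (hg.coeffBound hs) hζ).differentiableAt.hasFDerivAt
  have h2 : HasFDerivAt (fun ζ => T (ζ - ζ₀)) T ζ :=
    T.hasFDerivAt.comp ζ ((hasFDerivAt_id ζ).sub_const ζ₀)
  exact HasFDerivAt.comp (g := evalSeries fun α => g α s) ζ h1 h2

lemma ParamBound.fderiv_tensorSeries_apply (hg : ParamBound β V K g) (hK : 0 < K) {s : S}
    (hs : s ∈ V) {ζ : E} (hζ : 2 * K * ‖T (ζ - ζ₀)‖ < 1) (v : E) :
    fderiv ℂ (fun ζ => tensorSeries T ζ₀ g (ζ, s)) ζ v =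
      tensorSeries T ζ₀ (HolFrob.dirDeriv (T v) g) (ζ, s) := by
  have hζ' : K * ‖T (ζ - ζ₀)‖ < 1 := by nlinarith [norm_nonneg (T (ζ - ζ₀))]
  have hc := hg.coeffBound hs
  rw [(hg.hasFDerivAt_tensorSeries hK hs hζ').fderiv, ContinuousLinearMap.comp_apply,
    fderiv_evalSeries_apply hK hc hζ']
  have h1 : ∀ i, CoeffBound (2 * K) fun α => T v i • shiftDeriv i (fun α => g α s) α := by
    intro i
    obtain ⟨C, hC, h⟩ := hc.shiftDeriv hK.le i
    refine ⟨‖T v i‖ * C, by positivity, fun α => ?_⟩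
    rw [norm_smul, mul_assoc]
    gcongr
    exact h α
  refine Eq.trans ?_ (evalSeries_sum Finset.univ (by positivity) (fun i _ => h1 i) hζ).symm
  refine Finset.sum_congr rfl fun i _ => ?_
  simp only [evalSeries, ← tsum_const_smul'', smul_comm (T v i)]

end TensorDerivative

end HolFrob

namespace HolFrob

set_option linter.unusedSectionVars false

/-! ### Linear algebra of annihilators of complexified distributions. -/

section Annihilator

lemma pairing_tmul {E F : Type} [NormedAddCommGroup E] [NormedSpace ℝ E] [NormedAddCommGroup F]
    [NormedSpace ℂ F] (θ : E →L[ℝ] F) (c : ℂ) (x : E) : pairing θ (c ⊗ₜ[ℝ] x) = c • θ x := by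
  simp [pairing]

/-- A linear form vanishing on the common kernel of the coordinates of a surjective map `D` is a
combination of these coordinates. -/
lemma exists_eq_sum_of_surjective {E : Type} [AddCommGroup E] [Module ℂ E] [FiniteDimensional ℂ E]
    {ι κ : Type} [Fintype ι] [Fintype κ] [DecidableEq κ]
    (hd : Module.finrank ℂ E = Fintype.card ι + Fintype.card κ)
    {D : E →ₗ[ℂ] EuclideanSpace ℂ κ} (hD : Function.Surjective D) {v : ι → E}
    (hv : LinearIndependent ℂ v) (hDv : ∀ j, D (v j) = 0) {θ : E →ₗ[ℂ] ℂ} (hθ : ∀ j, θ (v j) = 0) :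
    ∃ c : κ → ℂ, ∀ x, θ x = ∑ l, c l * D x l := by
  -- The v_j lie in the kernel and have the right number, so they span it. Thus θ factors through D,
  -- and a right inverse R of D produces the coefficients.
  have h1 : Submodule.span ℂ (Set.range v) = D.ker := by
    refine Submodule.eq_of_le_of_finrank_le (Submodule.span_le.2 ?_) ?_
    · rintro _ ⟨j, rfl⟩
      exact hDv j
    · have h2 := D.finrank_range_add_finrank_ker
      rw [LinearMap.range_eq_top.2 hD, finrank_top, finrank_euclideanSpace, hd] at h2
      rw [finrank_span_eq_card hv]
      omega
  have h2 : D.ker ≤ θ.ker := by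
    rw [← h1, Submodule.span_le]
    rintro _ ⟨j, rfl⟩
    exact hθ j
  obtain ⟨R, hR⟩ := D.exists_rightInverse_of_surjective (LinearMap.range_eq_top.2 hD)
  have hR' : ∀ w, D (R w) = w := fun w => LinearMap.congr_fun hR w
  refine ⟨fun l => θ (R (EuclideanSpace.single l 1)), fun x => ?_⟩
  have h3 : θ x = θ (R (D x)) := by
    have h4 : x - R (D x) ∈ θ.ker := h2 (by rw [LinearMap.mem_ker, map_sub, hR', sub_self])
    rwa [LinearMap.mem_ker, map_sub, sub_eq_zero] at h4
  have h5 : D x = ∑ l, D x l • EuclideanSpace.single l (1 : ℂ) := by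
    ext l
    simp [Finset.sum_apply, Pi.single_apply]
  rw [h3]
  conv_lhs => rw [h5, map_sum, map_sum]
  simp [mul_comm]

lemma sum_mul_apply_eq_zero {E : Type} [AddCommGroup E] [Module ℂ E] {κ : Type} [Fintype κ]
    [DecidableEq κ] {D : E →ₗ[ℂ] EuclideanSpace ℂ κ} (hD : Function.Surjective D) {c : κ → ℂ}
    (hc : ∀ x, ∑ l, c l * D x l = 0) (l : κ) : c l = 0 := by
  obtain ⟨x, hx⟩ := hD (EuclideanSpace.single l 1)
  have h := hc x
  rw [hx] at h
  simpa using h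

variable {n : ℕ} {κ ι : Type} [Fintype κ] [DecidableEq κ] [Fintype ι]

/-- The components of a complex linear map, as real linear maps. -/
noncomputable def realComponent (D : EuclideanSpace ℂ (Fin n) →L[ℂ] EuclideanSpace ℂ κ) (l : κ) :
    EuclideanSpace ℂ (Fin n) →L[ℝ] ℂ :=
  ((EuclideanSpace.proj l : EuclideanSpace ℂ κ →L[ℂ] ℂ).comp D).restrictScalars ℝ

/-- The form `dζ̄ˡ`. -/
noncomputable def conjCoord (l : Fin n) : EuclideanSpace ℂ (Fin n) →L[ℝ] ℂ :=
  (Complex.conjCLE : ℂ →L[ℝ] ℂ).comp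
    ((EuclideanSpace.proj l : EuclideanSpace ℂ (Fin n) →L[ℂ] ℂ).restrictScalars ℝ)

/-- The inclusion of `ℝⁿ` in `ℂⁿ` as a continuous linear map. -/
noncomputable def realInclCLM : EuclideanSpace ℝ (Fin n) →L[ℝ] EuclideanSpace ℂ (Fin n) :=
  LinearMap.toContinuousLinearMap
    { toFun := realIncl
      map_add' := fun x y => by ext; simp [realIncl]
      map_smul' := fun c x => by ext; simp [realIncl] }

lemma realInclCLM_apply (ξ : EuclideanSpace ℝ (Fin n)) : realInclCLM ξ = realIncl ξ := rfl

lemma pairing_partialZeta {F : Type} [NormedAddCommGroup F] [NormedSpace ℂ F]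
    (θ : EuclideanSpace ℂ (Fin n) →L[ℝ] F) (k : Fin n) :
    pairing θ (partialZeta k) = (1 / 2 : ℂ) • θ (EuclideanSpace.single k 1) -
      (Complex.I / 2) • θ (EuclideanSpace.single k Complex.I) := by
  rw [partialZeta, map_sub, pairing_tmul, pairing_tmul]

lemma pairing_partialZetaBar {F : Type} [NormedAddCommGroup F] [NormedSpace ℂ F]
    (θ : EuclideanSpace ℂ (Fin n) →L[ℝ] F) (k : Fin n) :
    pairing θ (partialZetaBar k) = (1 / 2 : ℂ) • θ (EuclideanSpace.single k 1) +
      (Complex.I / 2) • θ (EuclideanSpace.single k Complex.I) := by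
  rw [partialZetaBar, map_add, pairing_tmul, pairing_tmul]

lemma single_I (k : Fin n) : EuclideanSpace.single k Complex.I =
    Complex.I • EuclideanSpace.single k (1 : ℂ) := by
  ext i
  simp

lemma pairing_restrictScalars_partialZeta {F : Type} [NormedAddCommGroup F] [NormedSpace ℂ F]
    (D : EuclideanSpace ℂ (Fin n) →L[ℂ] F) (k : Fin n) :
    pairing (D.restrictScalars ℝ) (partialZeta k) = D (EuclideanSpace.single k 1) := by
  rw [pairing_partialZeta]
  simp only [ContinuousLinearMap.coe_restrictScalars', single_I, map_smul, smul_smul, ← sub_smul]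
  rw [show (1 / 2 : ℂ) - Complex.I / 2 * Complex.I = 1 by
    rw [div_mul_eq_mul_div, Complex.I_mul_I]; norm_num, one_smul]

lemma pairing_restrictScalars_partialZetaBar {F : Type} [NormedAddCommGroup F] [NormedSpace ℂ F]
    (D : EuclideanSpace ℂ (Fin n) →L[ℂ] F) (k : Fin n) :
    pairing (D.restrictScalars ℝ) (partialZetaBar k) = 0 := by
  rw [pairing_partialZetaBar]
  simp only [ContinuousLinearMap.coe_restrictScalars', single_I, map_smul, smul_smul, ← add_smul]
  rw [show (1 / 2 : ℂ) + Complex.I / 2 * Complex.I = 0 by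
    rw [div_mul_eq_mul_div, Complex.I_mul_I]; norm_num, zero_smul]

lemma pairing_holVector (θ : EuclideanSpace ℂ (Fin n) →L[ℝ] ℂ) (b : EuclideanSpace ℂ (Fin n)) :
    pairing θ (holVector b) = ∑ k, b k * pairing θ (partialZeta k) := by
  simp [holVector, map_sum]

lemma pairing_realComponent_holVector (D : EuclideanSpace ℂ (Fin n) →L[ℂ] EuclideanSpace ℂ κ)
    (l : κ) (b : EuclideanSpace ℂ (Fin n)) :
    pairing (realComponent D l) (holVector b) = D b l := by
  have h : b = ∑ k, b k • EuclideanSpace.single k (1 : ℂ) := by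
    ext l
    simp [Finset.sum_apply, Pi.single_apply]
  rw [pairing_holVector]
  simp only [realComponent, pairing_restrictScalars_partialZeta]
  conv_rhs => rw [h, map_sum]
  simp

lemma pairing_conjCoord_partialZeta (l k : Fin n) : pairing (conjCoord l) (partialZeta k) = 0 := by
  rw [pairing_partialZeta]
  by_cases h : l = k
  · subst h
    simp [conjCoord]
    rw [div_mul_eq_mul_div, Complex.I_mul_I]; norm_num
  · simp [conjCoord, h]

lemma pairing_conjCoord_partialZetaBar (l k : Fin n) :
    pairing (conjCoord l) (partialZetaBar k) = if l = k then 1 else 0 := by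
  rw [pairing_partialZetaBar]
  by_cases h : l = k
  · subst h
    simp [conjCoord]
    rw [div_mul_eq_mul_div, Complex.I_mul_I]; norm_num
  · simp [conjCoord, h]

/-- The form `θ` in terms of `dζᵏ` and `dζ̄ᵏ`. -/
lemma apply_eq_pairing (θ : EuclideanSpace ℂ (Fin n) →L[ℝ] ℂ) (ζ : EuclideanSpace ℂ (Fin n)) :
    θ ζ = pairing θ (holVector ζ) + ∑ k, pairing θ (partialZetaBar k) * conj (ζ k) := by
  have h : ζ = ∑ k, ((ζ k).re • EuclideanSpace.single k (1 : ℂ) +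
      (ζ k).im • EuclideanSpace.single k Complex.I) := by
    ext l
    simp [Finset.sum_apply, Pi.single_apply, Finset.sum_add_distrib]
  rw [pairing_holVector, ← Finset.sum_add_distrib]
  conv_lhs => rw [h, map_sum]
  refine Finset.sum_congr rfl fun k _ => ?_
  rw [pairing_partialZeta, pairing_partialZetaBar, map_add, map_smul, map_smul]
  generalize θ (EuclideanSpace.single k 1) = a
  generalize θ (EuclideanSpace.single k Complex.I) = c
  obtain ⟨z, hz⟩ : ∃ z : ℂ, ζ k = z := ⟨_, rfl⟩
  have hc : conj z = z.re - z.im * Complex.I := Complex.ext (by simp) (by simp)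
  rw [hz, hc]
  conv_rhs => rw [← Complex.re_add_im z]
  simp only [Complex.real_smul, smul_eq_mul, Complex.add_re, Complex.ofReal_re, Complex.mul_re,
    Complex.I_re, Complex.ofReal_im, Complex.I_im, Complex.add_im, Complex.mul_im, mul_zero,
    mul_one, sub_self, add_zero, zero_add]
  linear_combination (z.im * c : ℂ) * Complex.I_mul_I

/-- The pairing with a fixed tangent vector. -/
noncomputable def pairingWith {E : Type} [NormedAddCommGroup E] [NormedSpace ℝ E]
    (v : ℂ ⊗[ℝ] E) : (E →L[ℝ] ℂ) →ₗ[ℂ] ℂ where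
  toFun θ := pairing θ v
  map_add' θ η := by
    have h : pairing (θ + η) = pairing θ + pairing η := by ext; simp [pairing]
    rw [h, LinearMap.add_apply]
  map_smul' c θ := by
    have h : pairing (c • θ) = c • pairing θ := by ext; simp [pairing]
    rw [h, LinearMap.smul_apply, RingHom.id_apply]

lemma pairingWith_apply {E : Type} [NormedAddCommGroup E] [NormedSpace ℝ E] (v : ℂ ⊗[ℝ] E)
    (θ : E →L[ℝ] ℂ) : pairingWith v θ = pairing θ v := rfl

lemma mem_annihilator_span_range {E : Type} [NormedAddCommGroup E] [NormedSpace ℝ E] {τ : Type}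
    (w : τ → ℂ ⊗[ℝ] E) (θ : E →L[ℝ] ℂ) :
    θ ∈ annihilator (Submodule.span ℂ (Set.range w)) ↔ ∀ j, pairing θ (w j) = 0 := by
  constructor
  · exact fun h j => h _ (Submodule.subset_span ⟨j, rfl⟩)
  · intro h v hv
    have h1 : Submodule.span ℂ (Set.range w) ≤ (pairing θ).ker := by
      rw [Submodule.span_le]
      rintro _ ⟨j, rfl⟩
      exact h j
    exact h1 hv

variable {D : EuclideanSpace ℂ (Fin n) →L[ℂ] EuclideanSpace ℂ κ} {v : ι → EuclideanSpace ℂ (Fin n)}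

/-- The vector `holVector b` depends linearly on `b`. -/
noncomputable def holVectorHom : EuclideanSpace ℂ (Fin n) →ₗ[ℂ] ℂ ⊗[ℝ] EuclideanSpace ℂ (Fin n) where
  toFun := holVector
  map_add' x y := by simp [holVector, add_smul, Finset.sum_add_distrib]
  map_smul' c x := by simp [holVector, mul_smul, Finset.smul_sum]

/-- The vector `realVector b` depends linearly on `b`. -/
noncomputable def realVectorHom :
    EuclideanSpace ℂ (Fin n) →ₗ[ℂ] ℂ ⊗[ℝ] EuclideanSpace ℝ (Fin n) where
  toFun := realVector
  map_add' x y := by simp [realVector, TensorProduct.add_tmul, Finset.sum_add_distrib]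
  map_smul' c x := by simp [realVector, Finset.smul_sum, TensorProduct.smul_tmul']

/-- A covector splits into a ℂ-linear part, seen by the ∂/∂ζ^k, and a part spanned by the dζ̄^k.
Annihilating fields of type (1,0) constrains only the first, which must factor through D. -/
theorem isBasis_annihilator_holVector (hd : n = Fintype.card ι + Fintype.card κ)
    (hD : Function.Surjective D) (hv : LinearIndependent ℂ v) (hDv : ∀ j, D (v j) = 0) :
    LinearIndependent ℂ (Sum.elim (realComponent D) (conjCoord (n := n))) ∧
      Submodule.span ℂ (Set.range (Sum.elim (realComponent D) (conjCoord (n := n)))) =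
        annihilator (Submodule.span ℂ (Set.range fun j => holVector (v j))) := by
  constructor
  · rw [Fintype.linearIndependent_iff]
    intro c hc
    rw [Fintype.sum_sum_type] at hc
    simp only [Sum.elim_inl, Sum.elim_inr] at hc
    have h1 : ∀ w, ∑ l, c (.inl l) * pairing (realComponent D l) w +
        ∑ l, c (.inr l) * pairing (conjCoord l) w = 0 := fun w => by
      have := congrArg (pairingWith w) hc
      rw [map_add, map_sum, map_sum, map_zero] at this
      simpa [pairingWith_apply] using this
    rintro (l | l)
    · refine sum_mul_apply_eq_zero (D := D.toLinearMap) hD (c := fun l => c (.inl l))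
        (fun x => ?_) l
      have := h1 (holVector x)
      simpa [pairing_realComponent_holVector, pairing_holVector (conjCoord _),
        pairing_conjCoord_partialZeta] using this
    · have := h1 (partialZetaBar l)
      simpa [realComponent, pairing_restrictScalars_partialZetaBar,
        pairing_conjCoord_partialZetaBar] using this
  · refine le_antisymm (Submodule.span_le.2 ?_) fun θ hθ => ?_
    · rintro _ ⟨l | l, rfl⟩
      · exact (mem_annihilator_span_range _ _).2 fun j => by
          simp [pairing_realComponent_holVector, hDv]
      · exact (mem_annihilator_span_range _ _).2 fun j => by
          simp [pairing_holVector, pairing_conjCoord_partialZeta]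
    · rw [mem_annihilator_span_range] at hθ
      obtain ⟨c, hc⟩ := exists_eq_sum_of_surjective (by simpa using hd) (D := D.toLinearMap) hD hv
        hDv (θ := (pairing θ).comp holVectorHom) hθ
      have h1 : θ = ∑ l, c l • realComponent D l + ∑ k, pairing θ (partialZetaBar k) • conjCoord k := by
        ext1 ζ
        rw [apply_eq_pairing θ ζ]
        have h2 : pairing θ (holVector ζ) = ∑ l, c l * D ζ l := hc ζ
        rw [h2]
        simp [_root_.sum_apply, realComponent, conjCoord]
      rw [h1]
      exact add_mem (sum_mem fun l _ => Submodule.smul_mem _ _ (Submodule.subset_span ⟨.inl l, rfl⟩))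
        (sum_mem fun l _ => Submodule.smul_mem _ _ (Submodule.subset_span ⟨.inr l, rfl⟩))

lemma pairing_realVector (θ : EuclideanSpace ℝ (Fin n) →L[ℝ] ℂ) (b : EuclideanSpace ℂ (Fin n)) :
    pairing θ (realVector b) = ∑ k, b k * θ (EuclideanSpace.single k 1) := by
  simp [realVector, map_sum, pairing_tmul]

lemma pairing_comp_realVector (D : EuclideanSpace ℂ (Fin n) →L[ℂ] EuclideanSpace ℂ κ)
    (l : κ) (b : EuclideanSpace ℂ (Fin n)) :
    pairing ((realComponent D l).comp realInclCLM) (realVector b) = D b l := by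
  have h : b = ∑ k, b k • EuclideanSpace.single k (1 : ℂ) := by
    ext l
    simp [Finset.sum_apply, Pi.single_apply]
  have h1 : ∀ k : Fin n, realIncl (EuclideanSpace.single k 1) = EuclideanSpace.single k (1 : ℂ) := by
    intro k
    ext l
    by_cases hl : l = k <;> simp [realIncl, hl]
  rw [pairing_realVector]
  conv_rhs => rw [h, map_sum]
  simp [realComponent, realInclCLM_apply, h1]

/-- A complex covector on ℝⁿ is the restriction of a unique ℂ-linear form on ℂⁿ, so the question is
again about forms that factor through D; there are no dζ̄^k. -/
theorem isBasis_annihilator_realVector (hd : n = Fintype.card ι + Fintype.card κ)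
    (hD : Function.Surjective D) (hv : LinearIndependent ℂ v) (hDv : ∀ j, D (v j) = 0) :
    LinearIndependent ℂ (fun l => (realComponent D l).comp realInclCLM) ∧
      Submodule.span ℂ (Set.range fun l => (realComponent D l).comp realInclCLM) =
        annihilator (Submodule.span ℂ (Set.range fun j => realVector (v j))) := by
  constructor
  · rw [Fintype.linearIndependent_iff]
    intro c hc l
    refine sum_mul_apply_eq_zero (D := D.toLinearMap) hD (fun x => ?_) l
    have := congrArg (pairingWith (realVector x)) hc
    rw [map_sum, map_zero] at this
    simpa [pairingWith_apply, pairing_comp_realVector] using this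
  · refine le_antisymm (Submodule.span_le.2 ?_) fun θ hθ => ?_
    · rintro _ ⟨l, rfl⟩
      exact (mem_annihilator_span_range _ _).2 fun j => by simp [pairing_comp_realVector, hDv]
    · rw [mem_annihilator_span_range] at hθ
      obtain ⟨c, hc⟩ := exists_eq_sum_of_surjective (by simpa using hd) (D := D.toLinearMap) hD hv
        hDv (θ := (pairing θ).comp realVectorHom) hθ
      have h1 : θ = ∑ l, c l • (realComponent D l).comp realInclCLM := by
        ext1 ξ
        have h2 : pairing θ (realVector (realIncl ξ)) = ∑ l, c l * D (realIncl ξ) l :=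
          hc (realIncl ξ)
        have h3 : ξ = ∑ k, ξ k • EuclideanSpace.single k (1 : ℝ) := by
          ext l
          simp [Finset.sum_apply, Pi.single_apply]
        have h4 : θ ξ = pairing θ (realVector (realIncl ξ)) := by
          rw [pairing_realVector]
          conv_lhs => rw [h3, map_sum]
          simp [realIncl]
        rw [h4, h2]
        simp [_root_.sum_apply, realComponent, realInclCLM_apply]
      rw [h1]
      exact sum_mem fun l _ => Submodule.smul_mem _ _ (Submodule.subset_span ⟨l, rfl⟩)

end Annihilator

end HolFrob

namespace HolFrob

set_option linter.unusedSectionVars false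

/-! ### Assembling the first integrals into a submersion. -/

section FirstIntegralMap

open Finsupp

variable {E S : Type} [NormedAddCommGroup E] [NormedSpace ℂ E] [NormedSpace ℝ E]
  [IsScalarTower ℝ ℂ E] [NormedAddCommGroup S] [NormedSpace ℝ S]
  {σ ι κ : Type} [Fintype σ] [Fintype ι] [Fintype κ] [DecidableEq ι] [DecidableEq κ]

lemma ParamBound.toLp {β K : ℝ} {V : Set S} (hV : IsOpen V) {g : κ → (σ →₀ ℕ) → S → ℂ}
    (hg : ∀ l, ParamBound β V K (g l)) :
    ParamBound β V K fun α s => (WithLp.toLp 2 fun l => g l α s : EuclideanSpace ℂ κ) := by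
  choose C hC using hg
  let B : κ → ℂ →L[ℝ] EuclideanSpace ℂ κ := fun l =>
    ((ContinuousLinearMap.id ℂ ℂ).smulRight
      (EuclideanSpace.single l (1 : ℂ) : EuclideanSpace ℂ κ)).restrictScalars ℝ
  refine ⟨∑ l, ‖B l‖ * C l, fun α => ?_⟩
  rw [Finset.sum_mul]
  refine ((HZBound.sum hV Finset.univ fun l _ => (hC l α).clm_comp hV (B l) le_rfl).congr hV
    fun s _ => ?_).mono (Finset.sum_le_sum fun l _ => le_of_eq (by ring))
  ext l
  simp [B, Finset.sum_apply, Pi.single_apply]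

lemma tensorSeries_apply {β K : ℝ} {V : Set S} (hK : 0 ≤ K) {T : E →L[ℂ] (σ → ℂ)} {ζ₀ : E}
    {g : (σ →₀ ℕ) → S → EuclideanSpace ℂ κ} (hg : ParamBound β V K g) {s : S} (hs : s ∈ V) {ζ : E}
    (hζ : K * ‖T (ζ - ζ₀)‖ < 1) (l : κ) :
    tensorSeries T ζ₀ g (ζ, s) l = tensorSeries T ζ₀ (fun α s => g α s l) (ζ, s) := by
  obtain ⟨C, _, hC⟩ := hg.coeffBound hs
  have h1 := (EuclideanSpace.proj l : EuclideanSpace ℂ κ →L[ℂ] ℂ).hasSum (hasSum_evalSeries hK hC hζ)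
  refine h1.tsum_eq.symm.trans (tsum_congr fun α => ?_)
  simp

variable [FiniteDimensional ℂ E] [FiniteDimensional ℝ S]

/-- A map whose components are independent first integrals of commuting fields. -/
theorem exists_first_integral_map {β : ℝ} (hβ : 0 < β) {U₀ : Set E} (hU₀ : IsOpen U₀) {V₀ : Set S}
    (hV₀ : IsOpen V₀) {b : ι → E × S → E} (hb : ∀ j, HZLoc β (U₀ ×ˢ V₀) (b j))
    (hhol : ∀ j, ∀ s ∈ V₀, DifferentiableOn ℂ (fun ζ => b j (ζ, s)) U₀)
    (hcomm : ∀ i j, ∀ ζ ∈ U₀, ∀ s ∈ V₀,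
      VectorField.lieBracket ℂ (fun η => b i (η, s)) (fun η => b j (η, s)) ζ = 0)
    {ζ₀ : E} (hζ₀ : ζ₀ ∈ U₀) {s₀ : S} (hs₀ : s₀ ∈ V₀)
    (hLI : LinearIndependent ℂ fun j => b j (ζ₀, s₀))
    (hd : Module.finrank ℂ E = Fintype.card ι + Fintype.card κ) :
    ∃ (T : E →L[ℂ] (ι ⊕ κ → ℂ)) (ρ K δ η : ℝ), 0 < ρ ∧ ρ ≤ 1 ∧ 1 ≤ K ∧ 2 * K * ρ < 1 ∧ 0 < η ∧
      η ≤ 1 ∧ polyNhd T ζ₀ ρ ⊆ U₀ ∧ Metric.ball s₀ δ ⊆ V₀ ∧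
      Metric.ball ζ₀ (3 * η) ⊆ polyNhd T ζ₀ ρ ∧ Metric.ball s₀ (3 * η) ⊆ Metric.ball s₀ δ ∧
      ∃ g : (ι ⊕ κ →₀ ℕ) → S → EuclideanSpace ℂ κ, ParamBound β (Metric.ball s₀ δ) K g ∧
        g 0 s₀ = 0 ∧ ∀ ζ ∈ Metric.ball ζ₀ η, ∀ s ∈ Metric.ball s₀ η,
          Function.Surjective (fderiv ℂ (fun ζ => tensorSeries T ζ₀ g (ζ, s)) ζ) ∧
          ∀ j, fderiv ℂ (fun ζ => tensorSeries T ζ₀ g (ζ, s)) ζ (b j (ζ, s)) = 0 := by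
  obtain ⟨T, ρ, K, δ, hρ, hρ1, hK, hKρ, hδ, hU, hV, g, hg, hint⟩ :=
    exists_first_integrals hβ hU₀ hV₀ hb hhol hcomm hζ₀ hs₀ hLI hd
  have hK0 : 0 < K := by linarith
  have hs₀V := Metric.mem_ball_self (x := s₀) hδ
  have hζ₀U := mem_polyNhd_self (T : E →L[ℂ] (ι ⊕ κ → ℂ)) ζ₀ hρ
  have hO := isOpen_polyNhd (T : E →L[ℂ] (ι ⊕ κ → ℂ)) ζ₀ ρ
  have h2K : ∀ ζ ∈ polyNhd (T : E →L[ℂ] (ι ⊕ κ → ℂ)) ζ₀ ρ,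
      2 * K * ‖(T : E →L[ℂ] (ι ⊕ κ → ℂ)) (ζ - ζ₀)‖ < 1 := fun ζ hζ =>
    lt_of_le_of_lt (mul_le_mul_of_nonneg_left (le_of_lt hζ) (by positivity)) hKρ
  have h1K : ∀ ζ ∈ polyNhd (T : E →L[ℂ] (ι ⊕ κ → ℂ)) ζ₀ ρ,
      K * ‖(T : E →L[ℂ] (ι ⊕ κ → ℂ)) (ζ - ζ₀)‖ < 1 := fun ζ hζ => by
    nlinarith [h2K ζ hζ, norm_nonneg ((T : E →L[ℂ] (ι ⊕ κ → ℂ)) (ζ - ζ₀))]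
  -- The Jacobian of the first integrals in the w-directions. It is the identity at the base point
  -- by the normalisation of the linear coefficients, so it is invertible nearby, jointly in (ζ, s).
  let N : E × S → Matrix κ κ ℂ := fun p => Matrix.of fun l l' =>
    tensorSeries (T : E →L[ℂ] (ι ⊕ κ → ℂ)) ζ₀ (dirDeriv (Pi.single (.inr l') 1) (g l)) p
  have hNc : ContinuousOn N (polyNhd (T : E →L[ℂ] (ι ⊕ κ → ℂ)) ζ₀ ρ ×ˢ Metric.ball s₀ δ) :=
    continuousOn_pi.2 fun l => continuousOn_pi.2 fun l' =>
      (((hg l).dirDeriv Metric.isOpen_ball _).mixedInftyLoc_tensorSeries hβ hρ hρ1 (by positivity)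
        hKρ Metric.isOpen_ball (convex_ball _ _) subset_rfl subset_rfl).1
  have hN0 : N (ζ₀, s₀) = 1 := by
    ext l l'
    simp only [N, Matrix.of_apply, tensorSeries, sub_self, map_zero, evalSeries_zero, dirDeriv,
      shiftDeriv, Matrix.one_apply, Finsupp.zero_apply, zero_add, Nat.cast_zero, one_smul]
    rw [Finset.sum_eq_single (.inr l') (fun i _ hi => by simp [hi]) (by simp)]
    simp [(hint s₀ hs₀V).2.1 l l', eq_comm]
  have hev : ∀ᶠ p in nhds (ζ₀, s₀), (N p).det ≠ 0 := by
    have h1 : ContinuousAt (fun p => (N p).det) (ζ₀, s₀) :=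
      (Continuous.matrix_det continuous_id).continuousAt.comp
        (hNc.continuousAt ((hO.prod Metric.isOpen_ball).mem_nhds ⟨hζ₀U, hs₀V⟩))
    exact h1.eventually_ne (by simp [hN0])
  obtain ⟨η₁, hη₁, hη₁N⟩ := Metric.eventually_nhds_iff_ball.1 hev
  obtain ⟨η₂, hη₂, hη₂O⟩ := Metric.isOpen_iff.1 hO ζ₀ hζ₀U
  -- The balls of radius 3η have to stay in the domain to make room for the cut-offs.
  let η := min (min η₁ 1) (min (η₂ / 3) (δ / 3))
  have hη1 : η ≤ η₁ := (min_le_left _ _).trans (min_le_left _ _)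
  have hη3 : 3 * η ≤ η₂ := by
    linarith [(min_le_right (min η₁ 1) (min (η₂ / 3) (δ / 3))).trans (min_le_left _ _)]
  have hη4 : 3 * η ≤ δ := by
    linarith [(min_le_right (min η₁ 1) (min (η₂ / 3) (δ / 3))).trans (min_le_right _ _)]
  have hη0 : 0 < η := by positivity
  have hgF := ParamBound.toLp Metric.isOpen_ball hg
  refine ⟨T, ρ, K, δ, η, hρ, hρ1, hK, hKρ, hη0, (min_le_left _ _).trans (min_le_right _ _), hU, hV,
    (Metric.ball_subset_ball hη3).trans hη₂O, Metric.ball_subset_ball hη4, _, hgF, ?_,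
    fun ζ hζ s hs => ?_⟩
  · ext l
    exact (hint s₀ hs₀V).1 l
  have hζO : ζ ∈ polyNhd (T : E →L[ℂ] (ι ⊕ κ → ℂ)) ζ₀ ρ :=
    hη₂O (Metric.ball_subset_ball (by linarith) hζ)
  have hsV : s ∈ Metric.ball s₀ δ := Metric.ball_subset_ball (by linarith) hs
  have hcomp : ∀ (l : κ) (v : E), fderiv ℂ (fun ζ => tensorSeries (T : E →L[ℂ] (ι ⊕ κ → ℂ)) ζ₀
      (fun α s => (WithLp.toLp 2 fun l => g l α s : EuclideanSpace ℂ κ)) (ζ, s)) ζ v l =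
      fderiv ℂ (fun ζ => tensorSeries (T : E →L[ℂ] (ι ⊕ κ → ℂ)) ζ₀ (g l) (ζ, s)) ζ v := by
    intro l v
    have h1 := (hgF.hasFDerivAt_tensorSeries (T := (T : E →L[ℂ] (ι ⊕ κ → ℂ))) (ζ₀ := ζ₀) hK0 hsV
      (h1K ζ hζO)).differentiableAt.hasFDerivAt
    have h2 := (EuclideanSpace.proj l : EuclideanSpace ℂ κ →L[ℂ] ℂ).hasFDerivAt.comp ζ h1
    have h3 := h2.congr_of_eventuallyEq (f₁ := fun ζ =>
      tensorSeries (T : E →L[ℂ] (ι ⊕ κ → ℂ)) ζ₀ (g l) (ζ, s)) (by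
        filter_upwards [hO.mem_nhds hζO] with ξ hξ
        exact (tensorSeries_apply hK0.le hgF hsV (h1K ξ hξ) l).symm)
    rw [h3.fderiv]
    rfl
  refine ⟨fun w => ?_, fun j => ?_⟩
  · have hdet : IsUnit (N (ζ, s)).det := isUnit_iff_ne_zero.2 (hη₁N (ζ, s) (by
      rw [← ball_prod_same]
      exact ⟨Metric.ball_subset_ball hη1 hζ, Metric.ball_subset_ball hη1 hs⟩))
    -- A preimage of w already exists among combinations of the w-directions, found with the inverse
    -- Jacobian.
    refine ⟨∑ l', ((N (ζ, s))⁻¹.mulVec w) l' • T.symm (Pi.single (.inr l') 1), ?_⟩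
    ext l
    have h1 : ∀ l', fderiv ℂ (fun ζ => tensorSeries (T : E →L[ℂ] (ι ⊕ κ → ℂ)) ζ₀ (g l) (ζ, s)) ζ
        (T.symm (Pi.single (.inr l') 1)) = N (ζ, s) l l' := fun l' => by
      rw [(hg l).fderiv_tensorSeries_apply hK0 hsV (h2K ζ hζO)]
      simp [N]
    have h2 := congrFun (Matrix.mulVec_mulVec w (N (ζ, s)) (N (ζ, s))⁻¹) l
    rw [Matrix.mul_nonsing_inv _ hdet, Matrix.one_mulVec] at h2
    rw [hcomp, map_sum, ← h2, Matrix.mulVec, dotProduct]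
    refine Finset.sum_congr rfl fun l' _ => ?_
    rw [map_smul, h1, smul_eq_mul, mul_comm]
  · ext l
    rw [hcomp, ((hg l).hasFDerivAt_tensorSeries hK0 hsV (h1K ζ hζO)).fderiv]
    exact (hint s hsV).2.2 ζ hζO l j

end FirstIntegralMap

end HolFrob

/-! ### The holomorphic Frobenius theorem with parameter. -/

theorem mainTheorem8 {n m q : ℕ} (hm : 1 ≤ m) (hmn : m ≤ n) {β : ℝ} (hβ : 0 < β)
    (U₀ : Set (EuclideanSpace ℂ (Fin n))) (hU₀ : IsOpen U₀)
    (V₀ : Set (EuclideanSpace ℝ (Fin q))) (hV₀ : IsOpen V₀)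
    -- the coefficients `b j (ζ, s) = (b_j^1(ζ, s), …, b_j^n(ζ, s))` of `Z_j`
    (b : Fin m → EuclideanSpace ℂ (Fin n) × EuclideanSpace ℝ (Fin q) → EuclideanSpace ℂ (Fin n))
    (hb_reg : ∀ j, HolFrob.HZLoc β (U₀ ×ˢ V₀) (b j))
    (hb_hol : ∀ j, ∀ s ∈ V₀, DifferentiableOn ℂ (fun ζ => b j (ζ, s)) U₀)
    (hb_indep : ∀ ζ ∈ U₀, ∀ s ∈ V₀,
      LinearIndependent ℂ (fun j => HolFrob.holVector (b j (ζ, s))))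
    (hb_comm : ∀ i j, ∀ ζ ∈ U₀, ∀ s ∈ V₀,
      VectorField.lieBracket ℂ (fun η => b i (η, s)) (fun η => b j (η, s)) ζ = 0)
    (ζ₀ : EuclideanSpace ℂ (Fin n)) (hζ₀ : ζ₀ ∈ U₀)
    (s₀ : EuclideanSpace ℝ (Fin q)) (hs₀ : s₀ ∈ V₀) :
    ∃ (U : Set (EuclideanSpace ℂ (Fin n))) (V : Set (EuclideanSpace ℝ (Fin q)))
      (G : EuclideanSpace ℂ (Fin n) × EuclideanSpace ℝ (Fin q) → EuclideanSpace ℂ (Fin (n - m))),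
      IsOpen U ∧ ζ₀ ∈ U ∧ U ⊆ U₀ ∧ IsOpen V ∧ s₀ ∈ V ∧ V ⊆ V₀ ∧
      HolFrob.HZLoc β (U ×ˢ V) G ∧
      G (ζ₀, s₀) = 0 ∧
      -- regularity
      HolFrob.BiHZInfty β U V G ∧
      (∀ s ∈ V, DifferentiableOn ℂ (fun ζ => G (ζ, s)) U) ∧
      HolFrob.MixedInftyLoc β U V G ∧
      (∀ k, HolFrob.MixedInftyLoc β U V fun p =>
        HolFrob.pairing (fderiv ℝ (fun ζ => G (ζ, p.2)) p.1) (HolFrob.partialZeta k)) ∧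
      (∀ k, HolFrob.MixedInftyLoc β U V fun p =>
        HolFrob.pairing (fderiv ℝ (fun ζ => G (ζ, p.2)) p.1) (HolFrob.partialZetaBar k)) ∧
      -- the holomorphic basis `dG^1, …, dG^{n-m}, dζ̄^1, …, dζ̄^n` of the annihilator
      (∀ s ∈ V, ∀ θ : Fin (n - m) ⊕ Fin n →
          EuclideanSpace ℂ (Fin n) → EuclideanSpace ℂ (Fin n) →L[ℝ] ℂ,
        θ = Sum.elim (fun k => fderiv ℝ fun ζ => G (ζ, s) k)
          (fun l => fderiv ℝ fun ζ => (starRingEnd ℂ) (ζ l)) →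
        (∀ a, DifferentiableOn ℂ (θ a) U) ∧
        HolFrob.IsBasisOfAnnihilator U θ fun ζ =>
          Submodule.span ℂ (Set.range fun j => HolFrob.holVector (b j (ζ, s)))) ∧
      -- the real-analytic basis `d(G^1|_{ℝⁿ}), …, d(G^{n-m}|_{ℝⁿ})` on the real domain
      (∀ s ∈ V, ∀ θ : Fin (n - m) →
          EuclideanSpace ℝ (Fin n) → EuclideanSpace ℝ (Fin n) →L[ℝ] ℂ,
        θ = (fun k => fderiv ℝ fun ξ => G (HolFrob.realIncl ξ, s) k) →
        (∀ a, AnalyticOnNhd ℝ (θ a) (HolFrob.realIncl ⁻¹' U)) ∧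
        HolFrob.IsBasisOfAnnihilator (HolFrob.realIncl ⁻¹' U) θ fun ξ =>
          Submodule.span ℂ
            (Set.range fun j => HolFrob.realVector (b j (HolFrob.realIncl ξ, s)))) := by
  classical
  have hd : Module.finrank ℂ (EuclideanSpace ℂ (Fin n)) =
      Fintype.card (Fin m) + Fintype.card (Fin (n - m)) := by
    rw [finrank_euclideanSpace, Fintype.card_fin, Fintype.card_fin, Fintype.card_fin]
    omega
  have hd' : n = Fintype.card (Fin m) + Fintype.card (Fin (n - m)) := by
    rw [Fintype.card_fin, Fintype.card_fin]
    omega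
  have hLI : ∀ ζ ∈ U₀, ∀ s ∈ V₀, LinearIndependent ℂ fun j => b j (ζ, s) := fun ζ hζ s hs =>
    LinearIndependent.of_comp HolFrob.holVectorHom (hb_indep ζ hζ s hs)
  obtain ⟨T, ρ, K, δ, η, hρ, hρ1, hK, hKρ, hη, hη1, hTU, hδV, hηρ, hηδ, g, hg, hg0, hD⟩ :=
    HolFrob.exists_first_integral_map hβ hU₀ hV₀ hb_reg hb_hol hb_comm hζ₀ hs₀
      (hLI ζ₀ hζ₀ s₀ hs₀) hd
  have hK0 : 0 < K := by linarith
  have hKρ' : K * ρ < 1 := by nlinarith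
  let U := Metric.ball ζ₀ η
  let V := Metric.ball s₀ η
  have hUρ : U ⊆ HolFrob.polyNhd T ζ₀ ρ :=
    (Metric.ball_subset_ball (by linarith)).trans hηρ
  have hVδ : V ⊆ Metric.ball s₀ δ := (Metric.ball_subset_ball (by linarith)).trans hηδ
  have hUo : IsOpen U := Metric.isOpen_ball
  have h2K : ∀ ζ ∈ U, 2 * K * ‖T (ζ - ζ₀)‖ < 1 := fun ζ hζ =>
    lt_of_le_of_lt (mul_le_mul_of_nonneg_left (le_of_lt (hUρ hζ)) (by positivity)) hKρ
  have h1K : ∀ ζ ∈ U, K * ‖T (ζ - ζ₀)‖ < 1 := fun ζ hζ => by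
    nlinarith [h2K ζ hζ, norm_nonneg (T (ζ - ζ₀))]
  let G := HolFrob.tensorSeries T ζ₀ g
  have hGa : ∀ s ∈ V, AnalyticOnNhd ℂ (fun ζ => G (ζ, s)) U := fun s hs ζ hζ =>
    hg.analyticAt_tensorSeries hK0 (hVδ hs) (h1K ζ hζ)
  let D : EuclideanSpace ℝ (Fin q) → EuclideanSpace ℂ (Fin n) →
      EuclideanSpace ℂ (Fin n) →L[ℂ] EuclideanSpace ℂ (Fin (n - m)) :=
    fun s => fderiv ℂ fun ζ => G (ζ, s)
  have hGd : ∀ s ∈ V, ∀ ζ ∈ U, HasFDerivAt (fun ζ => G (ζ, s)) (D s ζ) ζ := fun s hs ζ hζ =>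
    (hGa s hs ζ hζ).differentiableAt.hasFDerivAt
  have hGr : ∀ s ∈ V, ∀ ζ ∈ U,
      fderiv ℝ (fun ζ => G (ζ, s)) ζ = (D s ζ).restrictScalars ℝ := fun s hs ζ hζ =>
    ((hGd s hs ζ hζ).restrictScalars ℝ).fderiv
  have hGk : ∀ s ∈ V, ∀ ζ ∈ U, ∀ k, HasFDerivAt (𝕜 := ℝ) (fun ζ => G (ζ, s) k)
      (HolFrob.realComponent (D s ζ) k) ζ := fun s hs ζ hζ k =>
    ((EuclideanSpace.proj k : EuclideanSpace ℂ (Fin (n - m)) →L[ℂ] ℂ).hasFDerivAt.comp ζ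
      (hGd s hs ζ hζ)).restrictScalars ℝ
  have hconj : ∀ l ζ, fderiv ℝ (fun ζ : EuclideanSpace ℂ (Fin n) => (starRingEnd ℂ) (ζ l)) ζ =
      HolFrob.conjCoord l := fun l ζ => (HolFrob.conjCoord l).hasFDerivAt.fderiv
  refine ⟨U, V, G, hUo, Metric.mem_ball_self hη, hUρ.trans hTU, Metric.isOpen_ball,
    Metric.mem_ball_self hη, hVδ.trans hδV,
    hg.hzLoc_tensorSeries hβ hρ hρ1 hK0.le hKρ' Metric.isOpen_ball (convex_ball _ _) hUρ hVδ,
    ?_, hg.biHZInfty_tensorSeries hβ hρ hρ1 hK0.le hKρ' Metric.isOpen_ball hη hη1 hηρ hηδ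
      Metric.ball_subset_closedBall Metric.ball_subset_closedBall,
    fun s hs => (hGa s hs).differentiableOn,
    hg.mixedInftyLoc_tensorSeries hβ hρ hρ1 hK0.le hKρ' Metric.isOpen_ball (convex_ball _ _) hUρ
      hVδ, fun k => ?_, fun k => ?_, ?_, ?_⟩
  · change HolFrob.evalSeries (fun α => g α s₀) (T (ζ₀ - ζ₀)) = 0
    rw [sub_self, map_zero, HolFrob.evalSeries_zero, hg0]
  -- For a holomorphic map ∂/∂ζ^k is the complex derivative in the k-th direction, which is again a
  -- tensor series; its rate 2K is still admissible as 2Kρ < 1.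
  · refine ((hg.dirDeriv Metric.isOpen_ball (T (EuclideanSpace.single k 1))).mixedInftyLoc_tensorSeries
      hβ hρ hρ1 (by positivity) hKρ Metric.isOpen_ball (convex_ball _ _) hUρ hVδ).congr ?_
    rintro ⟨ζ, s⟩ ⟨hζ, hs⟩
    beta_reduce
    rw [hGr s hs ζ hζ]
    refine Eq.trans ?_ (HolFrob.pairing_restrictScalars_partialZeta (D s ζ) k).symm
    exact (hg.fderiv_tensorSeries_apply hK0 (hVδ hs) (h2K ζ hζ) _).symm
  -- The ζ̄-derivatives vanish; zero is presented as the derivative series in the direction 0.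
  · refine ((hg.dirDeriv Metric.isOpen_ball 0).mixedInftyLoc_tensorSeries (T := T) (ζ₀ := ζ₀)
      hβ hρ hρ1 (by positivity) hKρ Metric.isOpen_ball (convex_ball _ _) hUρ hVδ).congr ?_
    rintro ⟨ζ, s⟩ ⟨hζ, hs⟩
    beta_reduce
    rw [hGr s hs ζ hζ]
    refine Eq.trans ?_ (HolFrob.pairing_restrictScalars_partialZetaBar (D s ζ) k).symm
    simp [HolFrob.tensorSeries, HolFrob.evalSeries, HolFrob.dirDeriv]
  · rintro s hs _ rfl
    refine ⟨?_, fun ζ hζ => ?_⟩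
    · rintro (k | l)
      -- The form is the composite of the holomorphic map D s with ℂ-linear maps, restriction of
      -- scalars being ℂ-linear on forms with values in ℂ.
      · have h1 : DifferentiableOn ℂ (fun ζ => ContinuousLinearMap.restrictScalarsL ℂ
            (EuclideanSpace ℂ (Fin n)) ℂ ℝ ℂ
            ((EuclideanSpace.proj k : EuclideanSpace ℂ (Fin (n - m)) →L[ℂ] ℂ).comp (D s ζ))) U := by
          have h2 : DifferentiableOn ℂ (D s) U := (hGa s hs).fderiv.differentiableOn
          exact (ContinuousLinearMap.differentiable _).comp_differentiableOn
            ((differentiableOn_const _).clm_comp h2)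
        exact h1.congr fun ζ hζ => (hGk s hs ζ hζ k).fderiv
      · exact (differentiableOn_const (HolFrob.conjCoord l)).congr fun ζ _ => hconj l ζ
    · have h1 : (fun a => Sum.elim (fun k => fderiv ℝ fun ζ => G (ζ, s) k)
          (fun l => fderiv ℝ fun ζ : EuclideanSpace ℂ (Fin n) => (starRingEnd ℂ) (ζ l)) a ζ) =
          Sum.elim (HolFrob.realComponent (D s ζ)) HolFrob.conjCoord := by
        ext1 (k | l)
        · exact (hGk s hs ζ hζ k).fderiv
        · exact hconj l ζ
      rw [h1]
      exact HolFrob.isBasis_annihilator_holVector hd' (hD ζ hζ s hs).1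
        (hLI ζ (hTU (hUρ hζ)) s (hδV (hVδ hs))) (hD ζ hζ s hs).2
  · rintro s hs _ rfl
    have hk : ∀ ξ ∈ HolFrob.realIncl ⁻¹' U, ∀ k,
        HasFDerivAt (fun ξ => G (HolFrob.realIncl ξ, s) k)
          ((HolFrob.realComponent (D s (HolFrob.realIncl ξ)) k).comp HolFrob.realInclCLM) ξ :=
      fun ξ hξ k => HasFDerivAt.comp (g := fun ζ => G (ζ, s) k) ξ
        (hGk s hs (HolFrob.realIncl ξ) hξ k) HolFrob.realInclCLM.hasFDerivAt
    refine ⟨fun k => AnalyticOnNhd.fderiv fun ξ hξ => ?_, fun ξ hξ => ?_⟩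
    · have h1 : AnalyticAt ℝ (fun ζ => G (ζ, s) k) (HolFrob.realIncl ξ) :=
        (((EuclideanSpace.proj k : EuclideanSpace ℂ (Fin (n - m)) →L[ℂ] ℂ).analyticAt _).comp
          (hGa s hs _ hξ)).restrictScalars
      exact AnalyticAt.comp (g := fun ζ => G (ζ, s) k) h1 (HolFrob.realInclCLM.analyticAt ξ)
    · have h1 : (fun k => fderiv ℝ (fun ξ => G (HolFrob.realIncl ξ, s) k) ξ) = fun k =>
          (HolFrob.realComponent (D s (HolFrob.realIncl ξ)) k).comp HolFrob.realInclCLM :=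
        funext fun k => (hk ξ hξ k).fderiv
      rw [h1]
      exact HolFrob.isBasis_annihilator_realVector hd' (hD _ hξ s hs).1
        (hLI _ (hTU (hUρ hξ)) s (hδV (hVδ hs))) (hD _ hξ s hs).2
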